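/- Let $\Sigma^2$ be a smooth 2-manifold, $(M^3,g)$ a smooth Riemannian 3-manifold with Levi-Civita connection $\nabla$, and $f\colon\Sigma^2\to M^3$ a front: $f$ is $C^\infty$ and each point of $\Sigma^2$ has a neighborhood with a smooth unit vector field $\nu$ along $f$, perpendicular to the image of $df$, such that $\nu$ is an immersion into $TM^3$. A singular point is a point where $f$ is not an immersion, and $K$ denotes the Gaussian curvature of the induced metric, defined on the set of regular points. Let $p$ be a non-degenerate singular point of the second kind. That is, fixing a smooth unit normal field $\nu$ of $f$ near $p$, the function $\lambda=\det_g(f_u,f_v,\nu)$ satisfies $d\lambda\neq0$ at $p$ (so that near $p$ the singular set is a regular curve $\gamma$ with $\gamma(0)=p$, the singular curve, and $\ker df(p)$ is a line), and $df(\gamma'(0))=0$. At a singular point $q$ near $p$, the limiting normal curvature is $\kappa_\nu(q)=\langle\nabla_{\partial_u}f_u,\nu\rangle/|f_u|^2$ at $q$, for any local coordinates $(u,v)$ centered at $q$ with $f_v(q)=0$. Coordinates $(u,v)$ centered at $p$ are called adapted if $f_u(p)=0$, the $u$-axis is the singular set, and $|f_v(p)|=1$; such coordinates exist, and in them we put $\omega_\nu(p)=\frac{d}{du}\big|_{u=0}\kappa_\nu(u,0)\,du$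 (whether this covector vanishes does not depend on the adapted coordinates). Let $\pi\colon\hat\Sigma_p\to\Sigma^2$ be the blow-up of $\Sigma^2$ at $p$; in coordinates centered at $p$ it is the quotient of $\{(r,\theta)\}$ by $(r,\theta)\sim(-r,\theta+\pi)$, projected by $(r,\theta)\mapsto(r\cos\theta,r\sin\theta)$. A $C^\infty$ function $\varphi$ on an open dense subset $O$ of a neighborhood $U$ of $p$ is rationally bounded at $p$ if there are $C^\infty$ functions $\Lambda,\psi$ on $\pi^{-1}(U)$ such that (a) $\pi^{-1}(O\setminus\{p\})=\pi^{-1}(U\setminus\{p\})\cap\{\Lambda\neq0\}$, (b) $\Lambda$ has only finitely many zeros on $\pi^{-1}(p)$, and (c) $\psi=\Lambda\cdot(\varphi\circ\pi)$ on $\pi^{-1}(O)$. It is rationally continuous at $p$ if moreover, for some such $\Lambda$ and $\psi$, there is a constant $c$ with $\psi=c\Lambda$ on $\pi^{-1}(p)$. For $K$ we take $O$ to be the set of regular points in a sufficiently small neighborhood $U$ of $p$. Then: 1. $K$ is rationally bounded at $p$ if and only if $\kappa_\nu(p)=0$. 2. $K$ is rationally continuous at $p$ if and only if $\kappa_\nu(p)=0$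 and $\omega_\nu(p)=0$. 3. $K$ is bounded near $p$ (on the regular points of some neighborhood of $p$) if and only if $\kappa_\nu$ vanishes at all singular points in some neighborhood of $p$. Moreover, $p$ has arbitrarily small open neighborhoods $V$ such that $K$ is bounded on the regular points of $V$ if and only if $\kappa_\nu$ vanishes along the singular curve in $V$. -/

import Mathlib

open Set Filter Topology
open scoped Manifold ContDiff

noncomputable section

namespace FrontCurv

/-! ### Coordinate calculus for a Riemannian metric on an open subset of `ℝⁿ` -/

/-- The `i`-th standard basis vector of `ℝⁿ`, i.e. the coordinate vector `∂ᵢ`. -/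
abbrev basisVec {n : ℕ} (i : Fin n) : EuclideanSpace ℝ (Fin n) := EuclideanSpace.single i 1

/-- The partial derivative `∂ᵢ h`. -/
def partialDeriv {n : ℕ} {V : Type*} [NormedAddCommGroup V] [NormedSpace ℝ V] (i : Fin n)
    (h : EuclideanSpace ℝ (Fin n) → V) (x : EuclideanSpace ℝ (Fin n)) : V :=
  fderiv ℝ h x (basisVec i)

/-- The Christoffel symbols `Γᵏᵢⱼ` of the metric with coefficient matrix `G`:
`Γᵏᵢⱼ = ½ ∑ₗ Gᵏˡ (∂ᵢ Gⱼₗ + ∂ⱼ Gᵢₗ - ∂ₗ Gᵢⱼ)`. -/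
def christoffel {n : ℕ} (G : EuclideanSpace ℝ (Fin n) → Matrix (Fin n) (Fin n) ℝ)
    (k i j : Fin n) (x : EuclideanSpace ℝ (Fin n)) : ℝ :=
  (1 / 2) * ∑ l, (G x)⁻¹ k l *
    (partialDeriv i (fun z => G z j l) x + partialDeriv j (fun z => G z i l) x
      - partialDeriv l (fun z => G z i j) x)

/-- The components of the Riemann curvature tensor, `R(∂ᵢ, ∂ⱼ) ∂ₖ = ∑ₗ Rˡ ∂ₗ`, where
`R(X, Y) = ∇_X ∇_Y - ∇_Y ∇_X - ∇_[X, Y]`. -/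
def riemannCoeff {n : ℕ} (G : EuclideanSpace ℝ (Fin n) → Matrix (Fin n) (Fin n) ℝ)
    (l i j k : Fin n) (x : EuclideanSpace ℝ (Fin n)) : ℝ :=
  partialDeriv i (christoffel G l j k) x - partialDeriv j (christoffel G l i k) x
    + ∑ m, (christoffel G l i m x * christoffel G m j k x
      - christoffel G l j m x * christoffel G m i k x)

/-- The Gaussian curvature `⟨R(∂₁, ∂₂) ∂₂, ∂₁⟩ / det G` of a metric on a planar domain. -/
def gaussOfGram (G : EuclideanSpace ℝ (Fin 2) → Matrix (Fin 2) (Fin 2) ℝ)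
    (x : EuclideanSpace ℝ (Fin 2)) : ℝ :=
  (∑ l, G x l 0 * riemannCoeff G l 0 1 1 x) / (G x).det

/-- The inner product of two vectors with respect to a coefficient matrix. -/
def gramInner {n : ℕ} (A : Matrix (Fin n) (Fin n) ℝ) (a b : EuclideanSpace ℝ (Fin n)) : ℝ :=
  ∑ i, ∑ j, A i j * a i * b j

/-- The covariant derivative `∇_{∂ᵢ} W` of a vector field `W` along the map `F`, for the
Levi-Civita connection of the metric with coefficient matrix `G` on the target. -/
def covAlong {m n : ℕ} (G : EuclideanSpace ℝ (Fin n) → Matrix (Fin n) (Fin n) ℝ)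
    (F W : EuclideanSpace ℝ (Fin m) → EuclideanSpace ℝ (Fin n)) (i : Fin m)
    (z : EuclideanSpace ℝ (Fin m)) : EuclideanSpace ℝ (Fin n) :=
  partialDeriv i W z + WithLp.toLp 2 (fun k : Fin n =>
    ∑ a, ∑ b, christoffel G k a b (F z) * partialDeriv i F z a * W z b)

/-! ### Fronts in a Riemannian 3-manifold -/

variable {S : Type*} [TopologicalSpace S] [ChartedSpace (EuclideanSpace ℝ (Fin 2)) S]
  [IsManifold (𝓡 2) ∞ S]
  {M : Type*} [TopologicalSpace M] [ChartedSpace (EuclideanSpace ℝ (Fin 3)) M]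
  [IsManifold (𝓡 3) ∞ M]

variable (M) in
/-- A smooth Riemannian metric on the 3-manifold `M`. -/
abbrev RiemMetric : Type _ :=
  Bundle.ContMDiffRiemannianMetric (𝓡 3) ∞ (EuclideanSpace ℝ (Fin 3))
    (fun x : M => TangentSpace (𝓡 3) x)

/-- The coefficient matrix of `g` in the chart `y` of `M`. -/
def chartGram (g : RiemMetric M) (y : OpenPartialHomeomorph M (EuclideanSpace ℝ (Fin 3)))
    (x : EuclideanSpace ℝ (Fin 3)) : Matrix (Fin 3) (Fin 3) ℝ :=
  Matrix.of fun i j => g.inner (y.symm x)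
    (mfderiv (𝓡 3) (𝓡 3) y.symm x (basisVec i)) (mfderiv (𝓡 3) (𝓡 3) y.symm x (basisVec j))

/-- The point `q` is a singular point of `f`: `f` is not an immersion at `q`. -/
def IsSingularPt (f : S → M) (q : S) : Prop :=
  ¬ Function.Injective (mfderiv (𝓡 2) (𝓡 3) f q)

/-- The map `U → TM` given by a vector field `ν` along `f`. -/
def liftTM (f : S → M) (ν : ∀ q : S, TangentSpace (𝓡 3) (f q)) (q : S) :
    TangentBundle (𝓡 3) M :=
  ⟨f q, ν q⟩

/-- `ν` is, on `U`, a smooth unit vector field along `f` perpendicular to the image of `df`. -/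
structure IsUnitNormalOn (g : RiemMetric M) (f : S → M)
    (ν : ∀ q : S, TangentSpace (𝓡 3) (f q)) (U : Set S) : Prop where
  smooth : ContMDiffOn (𝓡 2) (𝓡 3).tangent ∞ (liftTM f ν) U
  unit : ∀ q ∈ U, g.inner (f q) (ν q) (ν q) = 1
  normal : ∀ q ∈ U, ∀ X : TangentSpace (𝓡 2) q,
    g.inner (f q) (mfderiv (𝓡 2) (𝓡 3) f q X) (ν q) = 0

/-- `f` is a front: it is smooth and has, locally, a unit normal field `ν` such that `ν` is an
immersion into `TM`. -/
def IsFront (g : RiemMetric M) (f : S → M) : Prop :=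
  ContMDiff (𝓡 2) (𝓡 3) ∞ f ∧
    ∀ p : S, ∃ U : Set S, IsOpen U ∧ p ∈ U ∧ ∃ ν : ∀ q : S, TangentSpace (𝓡 3) (f q),
      IsUnitNormalOn g f ν U ∧
        ∀ q ∈ U, Function.Injective (mfderiv (𝓡 2) (𝓡 3).tangent (liftTM f ν) q)

/-- The map `f` in the charts `e` and `y`. -/
def coordMap (f : S → M) (e : OpenPartialHomeomorph S (EuclideanSpace ℝ (Fin 2)))
    (y : OpenPartialHomeomorph M (EuclideanSpace ℝ (Fin 3))) :
    EuclideanSpace ℝ (Fin 2) → EuclideanSpace ℝ (Fin 3) :=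
  fun z => y (f (e.symm z))

/-- The vector field `ν` along `f` in the charts `e` and `y`. -/
def coordField (f : S → M) (ν : ∀ q : S, TangentSpace (𝓡 3) (f q))
    (e : OpenPartialHomeomorph S (EuclideanSpace ℝ (Fin 2)))
    (y : OpenPartialHomeomorph M (EuclideanSpace ℝ (Fin 3))) :
    EuclideanSpace ℝ (Fin 2) → EuclideanSpace ℝ (Fin 3) :=
  fun z => mfderiv (𝓡 3) (𝓡 3) y (f (e.symm z)) (ν (e.symm z))

/-- The signed area density `λ = det_g(f_u, f_v, ν)` as a function of the coordinates `(u, v)`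
given by `e`; the target is oriented by the chart `y`. -/
def signedArea (g : RiemMetric M) (f : S → M) (ν : ∀ q : S, TangentSpace (𝓡 3) (f q))
    (e : OpenPartialHomeomorph S (EuclideanSpace ℝ (Fin 2)))
    (y : OpenPartialHomeomorph M (EuclideanSpace ℝ (Fin 3)))
    (z : EuclideanSpace ℝ (Fin 2)) : ℝ :=
  Real.sqrt (chartGram g y (coordMap f e y z)).det *
    (Matrix.of ![fun k => partialDeriv 0 (coordMap f e y) z k,
      fun k => partialDeriv 1 (coordMap f e y) z k,
      fun k => coordField f ν e y z k]).det

/-- `p` is a non-degenerate singular point: `p` is singular and `dλ ≠ 0` at `p`. -/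
def IsNondegenerate (g : RiemMetric M) (f : S → M) (ν : ∀ q : S, TangentSpace (𝓡 3) (f q))
    (p : S) : Prop :=
  IsSingularPt f p ∧
    fderiv ℝ (signedArea g f ν (chartAt (EuclideanSpace ℝ (Fin 2)) p)
      (chartAt (EuclideanSpace ℝ (Fin 3)) (f p)))
      (chartAt (EuclideanSpace ℝ (Fin 2)) p p) ≠ 0

/-- `γ`, near `t = 0`, is a singular curve through `p`: a regular curve with `γ(0) = p` that
parametrizes the singular set near `p`. -/
def IsSingularCurve (f : S → M) (p : S) (γ : ℝ → S) : Prop :=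
  γ 0 = p ∧ ∃ ε > 0, ContMDiffOn 𝓘(ℝ, ℝ) (𝓡 2) ∞ γ (Ioo (-ε) ε) ∧
    (∀ t ∈ Ioo (-ε) ε, mfderiv 𝓘(ℝ, ℝ) (𝓡 2) γ t ≠ 0) ∧
    ∃ U ∈ 𝓝 p, γ '' Ioo (-ε) ε = {q ∈ U | IsSingularPt f q}

/-- `p` is a non-degenerate singular point of the second kind: the tangent vector `γ'(0)` of the
singular curve is a null vector (the kernel of `df` at `p` is a line, so this says that the
null vector `η(0)` is proportional to `γ'(0)`). -/
def IsSecondKind (g : RiemMetric M) (f : S → M) (ν : ∀ q : S, TangentSpace (𝓡 3) (f q))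
    (p : S) : Prop :=
  IsNondegenerate g f ν p ∧ ∃ γ : ℝ → S, IsSingularCurve f p γ ∧
    mfderiv (𝓡 2) (𝓡 3) f (γ 0) (mfderiv 𝓘(ℝ, ℝ) (𝓡 2) γ 0 (1 : ℝ)) = 0

/-- `e` is a smooth local coordinate system of `S` centered at `q`. -/
def IsCenteredChart (e : OpenPartialHomeomorph S (EuclideanSpace ℝ (Fin 2))) (q : S) : Prop :=
  e ∈ IsManifold.maximalAtlas (𝓡 2) ∞ S ∧ q ∈ e.source ∧ e q = 0

/-! ### The Gaussian curvature -/

/-- The first fundamental form `⟨f_{uᵢ}, f_{uⱼ}⟩` of `f` in the chart `e`. -/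
def firstForm (g : RiemMetric M) (f : S → M)
    (e : OpenPartialHomeomorph S (EuclideanSpace ℝ (Fin 2)))
    (z : EuclideanSpace ℝ (Fin 2)) : Matrix (Fin 2) (Fin 2) ℝ :=
  Matrix.of fun i j => g.inner ((f ∘ e.symm) z)
    (mfderiv (𝓡 2) (𝓡 3) (f ∘ e.symm) z (basisVec i))
    (mfderiv (𝓡 2) (𝓡 3) (f ∘ e.symm) z (basisVec j))

/-- The Gaussian curvature `K` of `f` (of the induced metric), meaningful at regular points. -/
def gaussCurv (g : RiemMetric M) (f : S → M) (q : S) : ℝ :=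
  gaussOfGram (firstForm g f (chartAt (EuclideanSpace ℝ (Fin 2)) q))
    (chartAt (EuclideanSpace ℝ (Fin 2)) q q)

/-! ### The limiting normal curvature -/

/-- A coordinate system `(u, v)` centered at `q` is admissible if `f_v(q) = 0`. -/
def IsAdmissible (f : S → M) (q : S)
    (e : OpenPartialHomeomorph S (EuclideanSpace ℝ (Fin 2))) : Prop :=
  IsCenteredChart e q ∧ mfderiv (𝓡 2) (𝓡 3) (f ∘ e.symm) 0 (basisVec 1) = 0

/-- `⟨f_uu, ν⟩ / |f_u|²` at `q`, with `f_uu = ∇_{∂u} f_u`, in the coordinates `(u, v)` given by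
`e`. -/
def normalCurvIn (g : RiemMetric M) (f : S → M) (ν : ∀ q : S, TangentSpace (𝓡 3) (f q))
    (q : S) (e : OpenPartialHomeomorph S (EuclideanSpace ℝ (Fin 2))) : ℝ :=
  let y := chartAt (EuclideanSpace ℝ (Fin 3)) (f q)
  let F := coordMap f e y
  let A := chartGram g y (F (e q))
  gramInner A (covAlong (chartGram g y) F (partialDeriv 0 F) 0 (e q)) (coordField f ν e y (e q)) /
    gramInner A (partialDeriv 0 F (e q)) (partialDeriv 0 F (e q))

open Classical in
/-- The limiting normal curvature `κ_ν(q)` at a rank one singular point `q`: the value of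
`⟨f_uu, ν⟩ / |f_u|²` in an admissible coordinate system at `q`. -/
def limNormalCurv (g : RiemMetric M) (f : S → M) (ν : ∀ q : S, TangentSpace (𝓡 3) (f q))
    (q : S) : ℝ :=
  if h : ∃ e, IsAdmissible f q e then normalCurvIn g f ν q h.choose else 0

/-- A coordinate system `(u, v)` centered at `p` is adapted (to a singular point of the second
kind) if `f_u(p) = 0`, the `u`-axis is the singular set and `|f_v(p)| = 1`. -/
structure IsAdapted (g : RiemMetric M) (f : S → M) (p : S)
    (e : OpenPartialHomeomorph S (EuclideanSpace ℝ (Fin 2))) : Prop where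
  centered : IsCenteredChart e p
  null : mfderiv (𝓡 2) (𝓡 3) (f ∘ e.symm) 0 (basisVec 0) = 0
  axis : ∀ q ∈ e.source, IsSingularPt f q ↔ e q 1 = 0
  unit : firstForm g f e 0 1 1 = 1

/-- The covector `ω_ν(p) = (d/du)|_{u = 0} κ_ν(u, 0) du` at `p`, in the coordinates `(u, v)` given
by `e`. -/
def omegaNu (g : RiemMetric M) (f : S → M) (ν : ∀ q : S, TangentSpace (𝓡 3) (f q))
    (e : OpenPartialHomeomorph S (EuclideanSpace ℝ (Fin 2))) (p : S) :
    TangentSpace (𝓡 2) p →L[ℝ] ℝ :=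
  deriv (fun u : ℝ => limNormalCurv g f ν (e.symm !₂[u, 0])) 0 •
    (EuclideanSpace.proj (0 : Fin 2) : EuclideanSpace ℝ (Fin 2) →L[ℝ] ℝ).comp
      (mfderiv (𝓡 2) (𝓡 2) e p)

/-! ### Rational boundedness and rational continuity

The blow-up of `S` at `p` is described in a coordinate system centered at `p`: it is the quotient
of `{(r, θ)}` by `(r, θ) ∼ (-r, θ + π)` with the projection `(r, θ) ↦ (r cos θ, r sin θ)`, so that a
smooth function on it is a smooth function of `(r, θ)` that respects this relation. -/

/-- The projection `(r, θ) ↦ (r cos θ, r sin θ)`. -/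
def polar (w : ℝ × ℝ) : EuclideanSpace ℝ (Fin 2) :=
  !₂[w.1 * Real.cos w.2, w.1 * Real.sin w.2]

/-- The pairs `(r, θ)` that project to the coordinate domain of `e`. -/
def blowUpDomain (e : OpenPartialHomeomorph S (EuclideanSpace ℝ (Fin 2))) : Set (ℝ × ℝ) :=
  {w | polar w ∈ e.target}

/-- `F` is a smooth function on the blow-up of the domain of the centered chart `e`. -/
def IsBlowUpFun (e : OpenPartialHomeomorph S (EuclideanSpace ℝ (Fin 2))) (F : ℝ × ℝ → ℝ) : Prop :=
  ContDiffOn ℝ ∞ F (blowUpDomain e) ∧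
    ∀ w ∈ blowUpDomain e, F (-w.1, w.2 + Real.pi) = F w

/-- `lam` and `psi` witness that `φ`, defined on `O`, is rationally bounded at `p`. Here the
neighborhood `U` of `p` is the domain of the chart `e`. -/
structure IsRationalWitness (O : Set S) (φ : S → ℝ) (p : S)
    (e : OpenPartialHomeomorph S (EuclideanSpace ℝ (Fin 2))) (lam psi : ℝ × ℝ → ℝ) : Prop where
  centered : IsCenteredChart e p
  isOpen : IsOpen O
  subset : O ⊆ e.source
  dense : e.source ⊆ closure O
  smooth : ContMDiffOn (𝓡 2) 𝓘(ℝ, ℝ) ∞ φ O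
  lam_smooth : IsBlowUpFun e lam
  psi_smooth : IsBlowUpFun e psi
  lam_ne_zero : ∀ w ∈ blowUpDomain e, w.1 ≠ 0 → (e.symm (polar w) ∈ O ↔ lam w ≠ 0)
  finite_zeros : {θ : ℝ | θ ∈ Ico 0 Real.pi ∧ lam (0, θ) = 0}.Finite
  psi_eq : ∀ w ∈ blowUpDomain e, e.symm (polar w) ∈ O → psi w = lam w * φ (e.symm (polar w))

/-- The function `φ`, with domain `O`, is rationally bounded at `p`. -/
def RationallyBoundedAt (O : Set S) (φ : S → ℝ) (p : S) : Prop :=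
  ∃ (e : OpenPartialHomeomorph S (EuclideanSpace ℝ (Fin 2))) (lam psi : ℝ × ℝ → ℝ),
    IsRationalWitness (O ∩ e.source) φ p e lam psi

/-- The function `φ`, with domain `O`, is rationally continuous at `p`. -/
def RationallyContinuousAt (O : Set S) (φ : S → ℝ) (p : S) : Prop :=
  ∃ (e : OpenPartialHomeomorph S (EuclideanSpace ℝ (Fin 2))) (lam psi : ℝ × ℝ → ℝ),
    IsRationalWitness (O ∩ e.source) φ p e lam psi ∧
      ∃ c : ℝ, ∀ θ : ℝ, psi (0, θ) = c * lam (0, θ)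

/-- The regular set of `f`, which is the domain of the Gaussian curvature. -/
def regularSet (f : S → M) : Set S := {q | ¬ IsSingularPt f q}

end FrontCurv

end

/-! All claims reduce to the behaviour of a quotient h/v of smooth functions of two variables. Let λ
be the determinant of f_u, f_v, ν in charts, and G the coefficient matrix of the ambient metric. At
a regular point the Gauss equation writes K as an extrinsic part plus the ambient sectional
curvature of the tangent plane. The first fundamental form has determinant λ² det G, and the second
has determinant λ det G · det(∇_uν, ∇_vν, ν). One factor λ therefore cancels, and Kλ extends to a
smooth function `curvNumer` across the singular set (`gaussOfGram_mul_areaDet`).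

At a singular point Kλ extends by det(∇_uν, ∇_vν, ν). Take a null direction N and a transversal
direction X. By symmetry of the second fundamental form, ∇_Nν is orthogonal to f_X; it is also
orthogonal to ν, and it is nonzero near p because f is a front. So the determinant is a nonzero
multiple of ⟨f_X, ∇_Xν⟩, that is, of κ_ν. The multiple is the restriction of a smooth nonvanishing
function (`normalCurv_mul_normalFactor`, `normalFactor_ne_zero`).

At a point of the second kind dλ ≠ 0 but dλ(N) = 0, so a multiple of λ can serve as the coordinate v
while ∂_u = N at p. The resulting adapted coordinates have K = h/v off the axis and h = κ_ν m on it,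
with h and m smooth and m nowhere zero (`IsSecondKind.exists_isNormalForm`).

If h(0) = 0, Hadamard's lemma gives h = ua + vb, so on the blow-up K = (a cos θ + b sin θ)/sin θ,
which is rationally bounded. Conversely, a rational witness restricted to rays through the origin
forces h(0) = 0 in the limit, and its derivative in r relates ψ and Λ on the exceptional circle to
dv and dh (`rationalWitness_relation`). Rational continuity with constant c then says dh = c dv,
hence h_u(0) = 0. When h(0) = 0 this is the vanishing of ω_ν, since κ_ν = h/m on the axis.

Finally, h/v is bounded on a small ball exactly when h vanishes on the axis: necessity is
continuity, and sufficiency is the mean value inequality on vertical segments (`bounded_iff`). -/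

noncomputable section

namespace FrontCurv

/-! ### Connections on an open subset of a normed space -/

section Connection

variable {C D E E' : Type*} [NormedAddCommGroup C] [NormedSpace ℝ C]
  [NormedAddCommGroup D] [NormedSpace ℝ D]
  [NormedAddCommGroup E] [NormedSpace ℝ E] [NormedAddCommGroup E'] [NormedSpace ℝ E']

/-- The covariant derivative in the direction `X` of the vector field `W` along the map `F`, for
the connection with Christoffel map `Γ`. -/
def covDeriv (Γ : E → E →L[ℝ] E →L[ℝ] E) (F W : D → E) (X z : D) : E :=
  fderiv ℝ W z X + Γ (F z) (fderiv ℝ F z X) (W z)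

/-- The curvature operator of the connection with Christoffel map `Γ`. -/
def curvOp (Γ : E → E →L[ℝ] E →L[ℝ] E) (x X Y W : E) : E :=
  fderiv ℝ Γ x X Y W - fderiv ℝ Γ x Y X W + Γ x X (Γ x Y W) - Γ x Y (Γ x X W)

/-- `Γ` is the Christoffel map of the Levi-Civita connection of the metric `B` on `s`. -/
structure IsLeviCivita (s : Set E) (B : E → E →L[ℝ] E →L[ℝ] ℝ) (Γ : E → E →L[ℝ] E →L[ℝ] E) :
    Prop where
  metric_smooth : ∀ x ∈ s, ContDiffAt ℝ ∞ B x
  conn_smooth : ∀ x ∈ s, ContDiffAt ℝ ∞ Γ x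
  symm : ∀ x ∈ s, ∀ a b, B x a b = B x b a
  pos : ∀ x ∈ s, ∀ a, a ≠ 0 → 0 < B x a a
  torsion_free : ∀ x ∈ s, ∀ a b, Γ x a b = Γ x b a
  compat : ∀ x ∈ s, ∀ X a b, fderiv ℝ B x X a b = B x (Γ x X a) b + B x a (Γ x X b)

lemma ContDiffAt.smooth_differentiableAt {F : D → E} {z : D} (h : ContDiffAt ℝ ∞ F z) :
    DifferentiableAt ℝ F z := h.differentiableAt (by simp)

lemma ContDiffAt.smooth_fderiv {F : D → E} {z : D} (h : ContDiffAt ℝ ∞ F z) :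
    ContDiffAt ℝ ∞ (fderiv ℝ F) z := h.fderiv_right (by simp)

lemma ContDiffAt.smooth_fderiv_apply {F : D → E} {z : D} (h : ContDiffAt ℝ ∞ F z) (X : D) :
    ContDiffAt ℝ ∞ (fun w => fderiv ℝ F w X) z :=
  (ContDiffAt.smooth_fderiv h).clm_apply contDiffAt_const

lemma ContDiffAt.smooth_fderiv_comm {F : D → E} {z : D} (h : ContDiffAt ℝ ∞ F z) (X Y : D) :
    fderiv ℝ (fun w => fderiv ℝ F w X) z Y = fderiv ℝ (fun w => fderiv ℝ F w Y) z X := by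
  have hd := ContDiffAt.smooth_differentiableAt (ContDiffAt.smooth_fderiv h)
  have key : ∀ U V : D, fderiv ℝ (fun w => fderiv ℝ F w U) z V = fderiv ℝ (fderiv ℝ F) z V U := by
    intro U V
    have := hd.hasFDerivAt.clm_apply (hasFDerivAt_const U z)
    rw [this.fderiv]; simp
  rw [key, key]
  exact (h.isSymmSndFDerivAt (by simpa using WithTop.coe_le_coe.2 (le_top : (2 : ℕ∞) ≤ ⊤))) Y X

lemma fderiv_bilin_apply {F₁ F₂ : Type*} [NormedAddCommGroup F₁] [NormedSpace ℝ F₁]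
    [NormedAddCommGroup F₂] [NormedSpace ℝ F₂]
    {b : D → E →L[ℝ] F₁ →L[ℝ] F₂} {W : D → E} {Z : D → F₁} {z : D}
    (hb : DifferentiableAt ℝ b z) (hW : DifferentiableAt ℝ W z) (hZ : DifferentiableAt ℝ Z z)
    (X : D) :
    fderiv ℝ (fun w => b w (W w) (Z w)) z X =
      fderiv ℝ b z X (W z) (Z z) + b z (fderiv ℝ W z X) (Z z) + b z (W z) (fderiv ℝ Z z X) := by
  have := (hb.hasFDerivAt.clm_apply hW.hasFDerivAt).clm_apply hZ.hasFDerivAt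
  rw [this.fderiv]
  simp
  abel

lemma smooth_smul_const {c : D → ℝ} {z : D} (hc : ContDiffAt ℝ ∞ c z) (v : E) :
    ContDiffAt ℝ ∞ (fun w => c w • v) z := hc.smul contDiffAt_const

lemma smooth_bilin_apply {F₁ F₂ : Type*} [NormedAddCommGroup F₁] [NormedSpace ℝ F₁]
    [NormedAddCommGroup F₂] [NormedSpace ℝ F₂]
    {b : D → E →L[ℝ] F₁ →L[ℝ] F₂} {W : D → E} {Z : D → F₁} {z : D}
    (hb : ContDiffAt ℝ ∞ b z) (hW : ContDiffAt ℝ ∞ W z) (hZ : ContDiffAt ℝ ∞ Z z) :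
    ContDiffAt ℝ ∞ (fun w => b w (W w) (Z w)) z :=
  (hb.clm_apply hW).clm_apply hZ

lemma smooth_covDeriv {Γ : E → E →L[ℝ] E →L[ℝ] E} {F W : D → E} {z : D}
    (hΓ : ContDiffAt ℝ ∞ Γ (F z)) (hF : ContDiffAt ℝ ∞ F z) (hW : ContDiffAt ℝ ∞ W z) (X : D) :
    ContDiffAt ℝ ∞ (covDeriv Γ F W X) z :=
  (ContDiffAt.smooth_fderiv_apply hW X).add
    (smooth_bilin_apply (hΓ.comp z hF) (ContDiffAt.smooth_fderiv_apply hF X) hW)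

lemma covDeriv_add {Γ : E → E →L[ℝ] E →L[ℝ] E} {F W W' : D → E} {z : D}
    (hW : DifferentiableAt ℝ W z) (hW' : DifferentiableAt ℝ W' z) (X : D) :
    covDeriv Γ F (fun w => W w + W' w) X z = covDeriv Γ F W X z + covDeriv Γ F W' X z := by
  simp only [covDeriv, fderiv_fun_add hW hW', map_add, add_apply]
  abel

lemma covDeriv_smul {Γ : E → E →L[ℝ] E →L[ℝ] E} {F W : D → E} {c : D → ℝ} {z : D}
    (hc : DifferentiableAt ℝ c z) (hW : DifferentiableAt ℝ W z) (X : D) :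
    covDeriv Γ F (fun w => c w • W w) X z = fderiv ℝ c z X • W z + c z • covDeriv Γ F W X z := by
  have := hc.hasFDerivAt.smul hW.hasFDerivAt
  have h2 : fderiv ℝ (fun w => c w • W w) z = c z • fderiv ℝ W z + (fderiv ℝ c z).smulRight (W z) :=
    this.fderiv
  simp only [covDeriv, h2, map_smul, add_apply, smul_apply, ContinuousLinearMap.smulRight_apply,
    smul_add]
  abel

lemma covDeriv_dir_add {Γ : E → E →L[ℝ] E →L[ℝ] E} {F W : D → E} {z : D} (X Y : D) :
    covDeriv Γ F W (X + Y) z = covDeriv Γ F W X z + covDeriv Γ F W Y z := by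
  simp only [covDeriv, map_add, add_apply]
  abel

lemma covDeriv_dir_smul {Γ : E → E →L[ℝ] E →L[ℝ] E} {F W : D → E} {z : D} (c : ℝ) (X : D) :
    covDeriv Γ F W (c • X) z = c • covDeriv Γ F W X z := by
  simp only [covDeriv, map_smul, smul_apply, smul_add]

/-- The chain rule for pulled-back fields: the Christoffel term is linear in the velocity, so it
follows the differential of σ. -/
lemma covDeriv_comp {Γ : E → E →L[ℝ] E →L[ℝ] E} {F W : D → E} {σ : C → D} {c : C}
    (hF : DifferentiableAt ℝ F (σ c)) (hW : DifferentiableAt ℝ W (σ c))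
    (hσ : DifferentiableAt ℝ σ c) (X : C) :
    covDeriv Γ (fun t => F (σ t)) (fun t => W (σ t)) X c =
      covDeriv Γ F W (fderiv ℝ σ c X) (σ c) := by
  have h1 : fderiv ℝ (fun t => F (σ t)) c = (fderiv ℝ F (σ c)).comp (fderiv ℝ σ c) :=
    fderiv_comp c hF hσ
  have h2 : fderiv ℝ (fun t => W (σ t)) c = (fderiv ℝ W (σ c)).comp (fderiv ℝ σ c) :=
    fderiv_comp c hW hσ
  simp [covDeriv, h1, h2]

/-- The commutator of covariant derivatives along a map is the curvature. -/
lemma covDeriv_commutator {Γ : E → E →L[ℝ] E →L[ℝ] E} {F W : D → E} {z : D}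
    (hΓ : ContDiffAt ℝ ∞ Γ (F z)) (hF : ContDiffAt ℝ ∞ F z) (hW : ContDiffAt ℝ ∞ W z) (X Y : D) :
    covDeriv Γ F (covDeriv Γ F W Y) X z - covDeriv Γ F (covDeriv Γ F W X) Y z =
      curvOp Γ (F z) (fderiv ℝ F z X) (fderiv ℝ F z Y) (W z) := by
  have key : ∀ U V : D, covDeriv Γ F (covDeriv Γ F W U) V z =
      fderiv ℝ (fun w => fderiv ℝ W w U) z V
      + (fderiv ℝ Γ (F z) (fderiv ℝ F z V) (fderiv ℝ F z U) (W z)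
        + Γ (F z) (fderiv ℝ (fun w => fderiv ℝ F w U) z V) (W z)
        + Γ (F z) (fderiv ℝ F z U) (fderiv ℝ W z V))
      + (Γ (F z) (fderiv ℝ F z V) (fderiv ℝ W z U)
        + Γ (F z) (fderiv ℝ F z V) (Γ (F z) (fderiv ℝ F z U) (W z))) := by
    intro U V
    have hG : DifferentiableAt ℝ (fun w => Γ (F w)) z :=
      ContDiffAt.smooth_differentiableAt (hΓ.comp z hF)
    have hFU := ContDiffAt.smooth_differentiableAt (ContDiffAt.smooth_fderiv_apply hF U)
    have hWU := ContDiffAt.smooth_differentiableAt (ContDiffAt.smooth_fderiv_apply hW U)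
    have hb := fderiv_bilin_apply hG hFU (ContDiffAt.smooth_differentiableAt hW) V
    have hGd : fderiv ℝ (fun w => Γ (F w)) z = (fderiv ℝ Γ (F z)).comp (fderiv ℝ F z) :=
      fderiv_comp z (ContDiffAt.smooth_differentiableAt hΓ) (ContDiffAt.smooth_differentiableAt hF)
    have hdiff : DifferentiableAt ℝ (fun w => Γ (F w) (fderiv ℝ F w U) (W w)) z :=
      (hG.clm_apply hFU).clm_apply (ContDiffAt.smooth_differentiableAt hW)
    conv_lhs => rw [covDeriv]
    have h1 : fderiv ℝ (covDeriv Γ F W U) z =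
        fderiv ℝ (fun w => fderiv ℝ W w U) z +
          fderiv ℝ (fun w => Γ (F w) (fderiv ℝ F w U) (W w)) z := by
      rw [← fderiv_fun_add hWU hdiff]; rfl
    rw [h1, add_apply, hb, hGd]
    simp only [covDeriv, map_add, ContinuousLinearMap.comp_apply]
  -- The second derivatives of W and F are symmetric and cancel, as do the mixed first-order terms;
  -- the derivative and the products of Γ remain.
  rw [key, key, ContDiffAt.smooth_fderiv_comm hW X Y, ContDiffAt.smooth_fderiv_comm hF X Y, curvOp]
  abel

set_option maxSynthPendingDepth 3 in
lemma smooth_curvOp {Γ : E → E →L[ℝ] E →L[ℝ] E} {F : D → E} {z : D}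
    (hΓ : ContDiffAt ℝ ∞ Γ (F z)) (hF : ContDiffAt ℝ ∞ F z) (X Y W : E) :
    ContDiffAt ℝ ∞ (fun w => curvOp Γ (F w) X Y W) z := by
  have hΓF : ContDiffAt ℝ ∞ (fun w => Γ (F w)) z := hΓ.comp z hF
  have hΓF' : ContDiffAt ℝ ∞ (fun w => fderiv ℝ Γ (F w)) z :=
    (ContDiffAt.smooth_fderiv hΓ).comp z hF
  have hc : ∀ v : E, ContDiffAt ℝ ∞ (fun _ : D => v) z := fun v => contDiffAt_const
  exact ((((hΓF'.clm_apply (hc X)).clm_apply (hc Y)).clm_apply (hc W)).sub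
    (((hΓF'.clm_apply (hc Y)).clm_apply (hc X)).clm_apply (hc W))).add
    (smooth_bilin_apply hΓF (hc X) (smooth_bilin_apply hΓF (hc Y) (hc W))) |>.sub
    (smooth_bilin_apply hΓF (hc Y) (smooth_bilin_apply hΓF (hc X) (hc W)))

lemma curvOp_swap (Γ : E → E →L[ℝ] E →L[ℝ] E) (x X Y W : E) :
    curvOp Γ x X Y W = - curvOp Γ x Y X W := by
  simp only [curvOp]; abel

/-! ### Metric compatibility, curvature symmetries and isometries. -/

namespace IsLeviCivita

variable {s : Set E} {B : E → E →L[ℝ] E →L[ℝ] ℝ} {Γ : E → E →L[ℝ] E →L[ℝ] E}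

lemma smooth_inner (h : IsLeviCivita s B Γ) {F W Z : D → E} {z : D} (hz : F z ∈ s)
    (hF : ContDiffAt ℝ ∞ F z) (hW : ContDiffAt ℝ ∞ W z) (hZ : ContDiffAt ℝ ∞ Z z) :
    ContDiffAt ℝ ∞ (fun w => B (F w) (W w) (Z w)) z :=
  smooth_bilin_apply ((h.metric_smooth _ hz).comp z hF) hW hZ

lemma fderiv_inner (h : IsLeviCivita s B Γ) {F W Z : D → E} {z : D} (hz : F z ∈ s)
    (hF : DifferentiableAt ℝ F z) (hW : DifferentiableAt ℝ W z) (hZ : DifferentiableAt ℝ Z z)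
    (X : D) :
    fderiv ℝ (fun w => B (F w) (W w) (Z w)) z X =
      B (F z) (covDeriv Γ F W X z) (Z z) + B (F z) (W z) (covDeriv Γ F Z X z) := by
  have hB := ContDiffAt.smooth_differentiableAt (h.metric_smooth _ hz)
  have hBF : fderiv ℝ (fun w => B (F w)) z = (fderiv ℝ B (F z)).comp (fderiv ℝ F z) :=
    fderiv_comp z hB hF
  have hBd : DifferentiableAt ℝ (fun w => B (F w)) z := hB.comp z hF
  rw [fderiv_bilin_apply hBd hW hZ X, hBF, ContinuousLinearMap.comp_apply, h.compat _ hz]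
  simp only [covDeriv, map_add, add_apply]
  ring

/-- Symmetry of second derivatives handles the first term, absence of torsion the Christoffel term.
-/
lemma covDeriv_symm (h : IsLeviCivita s B Γ) {F : D → E} {z : D} (hz : F z ∈ s)
    (hF : ContDiffAt ℝ ∞ F z) (X Y : D) :
    covDeriv Γ F (fun w => fderiv ℝ F w Y) X z = covDeriv Γ F (fun w => fderiv ℝ F w X) Y z := by
  simp only [covDeriv]
  rw [ContDiffAt.smooth_fderiv_comm hF Y X, h.torsion_free _ hz]

/-- The Koszul formula along a map. -/
lemma koszul (h : IsLeviCivita s B Γ) {F : D → E} {z : D} (hz : F z ∈ s)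
    (hF : ContDiffAt ℝ ∞ F z) (X Y Z : D) :
    B (F z) (covDeriv Γ F (fun w => fderiv ℝ F w Y) X z) (fderiv ℝ F z Z) = (1 / 2) *
      (fderiv ℝ (fun w => B (F w) (fderiv ℝ F w Y) (fderiv ℝ F w Z)) z X
        + fderiv ℝ (fun w => B (F w) (fderiv ℝ F w X) (fderiv ℝ F w Z)) z Y
        - fderiv ℝ (fun w => B (F w) (fderiv ℝ F w X) (fderiv ℝ F w Y)) z Z) := by
  have hd := fun U => ContDiffAt.smooth_differentiableAt (ContDiffAt.smooth_fderiv_apply hF U)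
  have hF' := ContDiffAt.smooth_differentiableAt hF
  rw [h.fderiv_inner hz hF' (hd Y) (hd Z), h.fderiv_inner hz hF' (hd X) (hd Z),
    h.fderiv_inner hz hF' (hd X) (hd Y), h.covDeriv_symm hz hF Y X, h.covDeriv_symm hz hF Z X,
    h.covDeriv_symm hz hF Z Y]
  have := h.symm _ hz (fderiv ℝ F z Y) (covDeriv Γ F (fun w => fderiv ℝ F w Z) X z)
  have h2 := h.symm _ hz (fderiv ℝ F z X) (covDeriv Γ F (fun w => fderiv ℝ F w Z) Y z)
  linarith

/-- The lowered curvature tensor is skew-symmetric in its last two arguments. -/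
lemma curvOp_inner_skew (h : IsLeviCivita s B Γ) (hs : IsOpen s) {x : E} (hx : x ∈ s)
    (X Y W Z : E) : B x (curvOp Γ x X Y W) Z = - B x (curvOp Γ x X Y Z) W := by
  have hc : ∀ V : E, ContDiffAt ℝ ∞ (fun _ : E => V) x := fun V => contDiffAt_const
  have hid : ContDiffAt ℝ ∞ (fun w : E => w) x := contDiffAt_id
  have hΓ := h.conn_smooth x hx
  have comm := fun V => covDeriv_commutator (F := fun w : E => w) (W := fun _ => V) (z := x)
    hΓ hid (hc V) X Y
  have hfid : fderiv ℝ (fun w : E => w) x = ContinuousLinearMap.id ℝ E := fderiv_fun_id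
  simp only [hfid, ContinuousLinearMap.id_apply] at comm
  have hsm : ∀ V U : E, DifferentiableAt ℝ (covDeriv Γ (fun w : E => w) (fun _ => V) U) x :=
    fun V U => ContDiffAt.smooth_differentiableAt (smooth_covDeriv hΓ hid (hc V) U)
  have first : ∀ U : E, (fun w => fderiv ℝ (fun w : E => B w W Z) w U) =ᶠ[𝓝 x] fun w =>
      B w (covDeriv Γ (fun w : E => w) (fun _ => W) U w) Z
        + B w W (covDeriv Γ (fun w : E => w) (fun _ => Z) U w) := by
    intro U
    filter_upwards [hs.mem_nhds hx] with w hw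
    exact h.fderiv_inner (F := fun w : E => w) (W := fun _ => W) (Z := fun _ => Z) hw
      differentiableAt_id (differentiableAt_const _) (differentiableAt_const _) U
  have second : ∀ U V : E, fderiv ℝ (fun w => fderiv ℝ (fun w : E => B w W Z) w U) x V =
      (B x (covDeriv Γ (fun w : E => w) (covDeriv Γ (fun w : E => w) (fun _ => W) U) V x) Z
      + B x (covDeriv Γ (fun w : E => w) (fun _ => W) U x)
          (covDeriv Γ (fun w : E => w) (fun _ => Z) V x))
      + (B x (covDeriv Γ (fun w : E => w) (fun _ => W) V x)
          (covDeriv Γ (fun w : E => w) (fun _ => Z) U x)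
      + B x W (covDeriv Γ (fun w : E => w) (covDeriv Γ (fun w : E => w) (fun _ => Z) U) V x)) := by
    intro U V
    have hB := ContDiffAt.smooth_differentiableAt (h.metric_smooth x hx)
    rw [(first U).fderiv_eq, fderiv_fun_add
      ((hB.clm_apply (hsm W U)).clm_apply (differentiableAt_const _))
      ((hB.clm_apply (differentiableAt_const _)).clm_apply (hsm Z U)), add_apply,
      h.fderiv_inner (F := fun w : E => w) (Z := fun _ => Z) hx differentiableAt_id (hsm W U)
        (differentiableAt_const _) V,
      h.fderiv_inner (F := fun w : E => w) (W := fun _ => W) hx differentiableAt_id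
        (differentiableAt_const _) (hsm Z U) V]
  -- For constant fields W, Z the second derivatives of ⟨W, Z⟩ commute. Expanding both orders by
  -- compatibility, the mixed products cancel and ⟨RW, Z⟩ + ⟨W, RZ⟩ = 0 is left.
  have hsym := ContDiffAt.smooth_fderiv_comm
    (F := fun w : E => B w W Z) (z := x) (smooth_bilin_apply (h.metric_smooth x hx) (hc W) (hc Z)) Y X
  rw [second, second] at hsym
  rw [← comm W, ← comm Z, h.symm x hx _ W]
  simp only [map_sub, sub_apply] at *
  rw [h.symm x hx _ Z, h.symm x hx _ Z] at *
  have e1 := h.symm x hx Z (covDeriv Γ (fun w ↦ w) (covDeriv Γ (fun w ↦ w) (fun x ↦ W) Y) X x)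
  have e2 := h.symm x hx Z (covDeriv Γ (fun w ↦ w) (covDeriv Γ (fun w ↦ w) (fun x ↦ W) X) Y x)
  linarith

/-- A local isometry is an affine map for the Levi-Civita connections. -/
lemma covDeriv_fderiv_isometry {s' : Set E'} {B' : E' → E' →L[ℝ] E' →L[ℝ] ℝ}
    {Γ' : E' → E' →L[ℝ] E' →L[ℝ] E'} (h : IsLeviCivita s B Γ) (h' : IsLeviCivita s' B' Γ')
    (hs : IsOpen s) {τ : E → E'} (hτ : ∀ x ∈ s, ContDiffAt ℝ ∞ τ x) (hmaps : MapsTo τ s s')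
    (hiso : ∀ x ∈ s, ∀ a b, B' (τ x) (fderiv ℝ τ x a) (fderiv ℝ τ x b) = B x a b)
    {x : E} (hx : x ∈ s) (hsurj : Function.Surjective (fderiv ℝ τ x)) (X Y : E) :
    covDeriv Γ' τ (fun w => fderiv ℝ τ w Y) X x = fderiv ℝ τ x (Γ x X Y) := by
  have hid : ContDiffAt ℝ ∞ (fun w : E => w) x := contDiffAt_id
  have hpull : ∀ U V : E, (fun w => B' (τ w) (fderiv ℝ τ w U) (fderiv ℝ τ w V)) =ᶠ[𝓝 x]
      fun w => B w U V := by
    intro U V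
    filter_upwards [hs.mem_nhds hx] with w hw using hiso w hw U V
  -- The Koszul formula computes both vectors from the same pulled-back metric, so their difference
  -- is orthogonal to the image of dτ, which is the whole space.
  have key : ∀ Z, B' (τ x) (covDeriv Γ' τ (fun w => fderiv ℝ τ w Y) X x - fderiv ℝ τ x (Γ x X Y))
      (fderiv ℝ τ x Z) = 0 := by
    intro Z
    have k1 := h'.koszul (hmaps hx) (hτ x hx) X Y Z
    have k2 := h.koszul (F := fun w : E => w) hx hid X Y Z
    have hfid : ∀ w : E, fderiv ℝ (fun w : E => w) w = ContinuousLinearMap.id ℝ E :=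
      fun w => fderiv_fun_id
    simp only [hfid, ContinuousLinearMap.id_apply, covDeriv, fderiv_fun_const, Pi.zero_apply,
      zero_apply, zero_add] at k2
    rw [(hpull _ _).fderiv_eq, (hpull _ _).fderiv_eq, (hpull _ _).fderiv_eq, ← k2] at k1
    rw [map_sub, sub_apply, k1, hiso x hx, sub_self]
  obtain ⟨Z, hZ⟩ := hsurj (covDeriv Γ' τ (fun w => fderiv ℝ τ w Y) X x - fderiv ℝ τ x (Γ x X Y))
  by_contra hne
  have h0 := h'.pos _ (hmaps hx) _ (sub_ne_zero.2 hne)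
  have := key Z
  rw [hZ] at this
  exact h0.ne' this

lemma covDeriv_isometry {s' : Set E'} {B' : E' → E' →L[ℝ] E' →L[ℝ] ℝ}
    {Γ' : E' → E' →L[ℝ] E' →L[ℝ] E'} (h : IsLeviCivita s B Γ) (h' : IsLeviCivita s' B' Γ')
    (hs : IsOpen s) {τ : E → E'} (hτ : ∀ x ∈ s, ContDiffAt ℝ ∞ τ x) (hmaps : MapsTo τ s s')
    (hiso : ∀ x ∈ s, ∀ a b, B' (τ x) (fderiv ℝ τ x a) (fderiv ℝ τ x b) = B x a b)
    {F W : D → E} {z : D} (hz : F z ∈ s) (hsurj : Function.Surjective (fderiv ℝ τ (F z)))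
    (hF : DifferentiableAt ℝ F z) (hW : DifferentiableAt ℝ W z) (X : D) :
    covDeriv Γ' (fun w => τ (F w)) (fun w => fderiv ℝ τ (F w) (W w)) X z =
      fderiv ℝ τ (F z) (covDeriv Γ F W X z) := by
  have hτz := hτ _ hz
  have hdτ := ContDiffAt.smooth_differentiableAt (ContDiffAt.smooth_fderiv hτz)
  have h1 : fderiv ℝ (fun w => τ (F w)) z = (fderiv ℝ τ (F z)).comp (fderiv ℝ F z) :=
    fderiv_comp z (ContDiffAt.smooth_differentiableAt hτz) hF
  have h2 : fderiv ℝ (fun w => fderiv ℝ τ (F w)) z =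
      (fderiv ℝ (fderiv ℝ τ) (F z)).comp (fderiv ℝ F z) :=
    fderiv_comp z hdτ hF
  have h3 : fderiv ℝ (fun w => fderiv ℝ τ (F w) (W w)) z X =
      fderiv ℝ (fderiv ℝ τ) (F z) (fderiv ℝ F z X) (W z) + fderiv ℝ τ (F z) (fderiv ℝ W z X) := by
    have hd : DifferentiableAt ℝ (fun w => fderiv ℝ τ (F w)) z := hdτ.comp z hF
    rw [(hd.hasFDerivAt.clm_apply hW.hasFDerivAt).fderiv, h2]
    simp [add_comm]
  have h4 := covDeriv_fderiv_isometry h h' hs hτ hmaps hiso hz hsurj (fderiv ℝ F z X) (W z)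
  have h5 : fderiv ℝ (fun w => fderiv ℝ τ w (W z)) (F z) (fderiv ℝ F z X) =
      fderiv ℝ (fderiv ℝ τ) (F z) (fderiv ℝ F z X) (W z) := by
    rw [(hdτ.hasFDerivAt.clm_apply (hasFDerivAt_const (W z) (F z))).fderiv]
    simp
  rw [covDeriv, h5] at h4
  rw [covDeriv, h1, h3, ContinuousLinearMap.comp_apply, covDeriv, map_add, ← h4]
  abel

end IsLeviCivita

end Connection

/-! ### Metrics given by coefficient matrices -/

section Matrices

variable {n : ℕ} {D : Type*} [NormedAddCommGroup D] [NormedSpace ℝ D]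

/-- The bilinear form with a given coefficient matrix. -/
def gramForm (A : Matrix (Fin n) (Fin n) ℝ) :
    EuclideanSpace ℝ (Fin n) →L[ℝ] EuclideanSpace ℝ (Fin n) →L[ℝ] ℝ :=
  ∑ i, ∑ j, A i j • (EuclideanSpace.proj i : EuclideanSpace ℝ (Fin n) →L[ℝ] ℝ).smulRight
    (EuclideanSpace.proj j : EuclideanSpace ℝ (Fin n) →L[ℝ] ℝ)

lemma gramForm_apply (A : Matrix (Fin n) (Fin n) ℝ) (a b : EuclideanSpace ℝ (Fin n)) :
    gramForm A a b = gramInner A a b := by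
  simp [gramForm, gramInner, mul_assoc]

/-- The Christoffel symbols of a metric as a bilinear map. -/
def chrisForm (G : EuclideanSpace ℝ (Fin n) → Matrix (Fin n) (Fin n) ℝ)
    (x : EuclideanSpace ℝ (Fin n)) :
    EuclideanSpace ℝ (Fin n) →L[ℝ] EuclideanSpace ℝ (Fin n) →L[ℝ] EuclideanSpace ℝ (Fin n) :=
  ∑ k, ∑ a, ∑ b, christoffel G k a b x •
    (EuclideanSpace.proj a : EuclideanSpace ℝ (Fin n) →L[ℝ] ℝ).smulRight
      ((EuclideanSpace.proj b : EuclideanSpace ℝ (Fin n) →L[ℝ] ℝ).smulRight (basisVec k))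

lemma chrisForm_apply (G : EuclideanSpace ℝ (Fin n) → Matrix (Fin n) (Fin n) ℝ)
    (x X Y : EuclideanSpace ℝ (Fin n)) :
    chrisForm G x X Y =
      WithLp.toLp 2 (fun k : Fin n => ∑ a, ∑ b, christoffel G k a b x * X a * Y b) := by
  ext k
  simp [chrisForm, mul_assoc, Finset.sum_apply, Pi.single_apply]

lemma covAlong_eq_covDeriv {m : ℕ} (G : EuclideanSpace ℝ (Fin n) → Matrix (Fin n) (Fin n) ℝ)
    (F W : EuclideanSpace ℝ (Fin m) → EuclideanSpace ℝ (Fin n)) (i : Fin m)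
    (z : EuclideanSpace ℝ (Fin m)) :
    covAlong G F W i z = covDeriv (chrisForm G) F W (basisVec i) z := by
  rw [covAlong, covDeriv, chrisForm_apply]; rfl

lemma smooth_det {A : D → Matrix (Fin n) (Fin n) ℝ} {z : D}
    (h : ∀ i j, ContDiffAt ℝ ∞ (fun w => A w i j) z) : ContDiffAt ℝ ∞ (fun w => (A w).det) z := by
  simp only [Matrix.det_apply]
  refine ContDiffAt.sum fun σ _ => ?_
  exact (contDiffAt_prod fun i _ => h (σ i) i).const_smul _

lemma smooth_inv_entry {A : D → Matrix (Fin n) (Fin n) ℝ} {z : D}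
    (h : ∀ i j, ContDiffAt ℝ ∞ (fun w => A w i j) z) (hz : (A z).det ≠ 0) (k l : Fin n) :
    ContDiffAt ℝ ∞ (fun w => (A w)⁻¹ k l) z := by
  simp only [Matrix.inv_def, Ring.inverse_eq_inv', Matrix.smul_apply, Matrix.adjugate_apply,
    smul_eq_mul]
  refine ((smooth_det h).inv hz).mul (smooth_det fun i j => ?_)
  by_cases hi : i = l
  · subst hi
    simpa using contDiffAt_const
  · simpa [Matrix.updateRow_ne hi] using h i j

lemma smooth_christoffel {G : EuclideanSpace ℝ (Fin n) → Matrix (Fin n) (Fin n) ℝ}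
    {x : EuclideanSpace ℝ (Fin n)} (h : ∀ i j, ContDiffAt ℝ ∞ (fun w => G w i j) x)
    (hx : (G x).det ≠ 0) (k i j : Fin n) : ContDiffAt ℝ ∞ (christoffel G k i j) x := by
  have hp : ∀ a b c, ContDiffAt ℝ ∞ (partialDeriv a fun w => G w b c) x :=
    fun a b c => ContDiffAt.smooth_fderiv_apply (h b c) _
  refine contDiffAt_const.mul (ContDiffAt.sum fun l _ => ?_)
  exact (smooth_inv_entry h hx k l).mul (((hp i j l).add (hp j i l)).sub (hp l i j))

lemma smooth_chrisForm {G : EuclideanSpace ℝ (Fin n) → Matrix (Fin n) (Fin n) ℝ}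
    {x : EuclideanSpace ℝ (Fin n)} (h : ∀ i j, ContDiffAt ℝ ∞ (fun w => G w i j) x)
    (hx : (G x).det ≠ 0) : ContDiffAt ℝ ∞ (chrisForm G) x := by
  refine ContDiffAt.sum fun k _ => ContDiffAt.sum fun a _ => ContDiffAt.sum fun b _ => ?_
  exact smooth_smul_const (smooth_christoffel h hx k a b) _

lemma smooth_gramForm {A : D → Matrix (Fin n) (Fin n) ℝ} {z : D}
    (h : ∀ i j, ContDiffAt ℝ ∞ (fun w => A w i j) z) :
    ContDiffAt ℝ ∞ (fun w => gramForm (A w)) z :=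
  ContDiffAt.sum fun i _ => ContDiffAt.sum fun j _ => smooth_smul_const (h i j) _

/-- The Koszul formula for the Christoffel symbols. -/
lemma sum_mul_christoffel {G : EuclideanSpace ℝ (Fin n) → Matrix (Fin n) (Fin n) ℝ}
    {x : EuclideanSpace ℝ (Fin n)} (hx : (G x).det ≠ 0) (m i j : Fin n) :
    ∑ k, G x m k * christoffel G k i j x = (1 / 2) *
      (partialDeriv i (fun z => G z j m) x + partialDeriv j (fun z => G z i m) x
      - partialDeriv m (fun z => G z i j) x) := by
  set c : Fin n → ℝ := fun l => partialDeriv i (fun z => G z j l) x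
    + partialDeriv j (fun z => G z i l) x - partialDeriv l (fun z => G z i j) x with hc
  have h1 : ∀ k, christoffel G k i j x = (1 / 2) * ((G x)⁻¹.mulVec c) k := fun k => rfl
  have h2 : (G x).mulVec ((G x)⁻¹.mulVec c) = c := by
    rw [Matrix.mulVec_mulVec, Matrix.mul_nonsing_inv _ (Ne.isUnit hx), Matrix.one_mulVec]
  have h3 : ∑ k, G x m k * ((G x)⁻¹.mulVec c) k = c m := congrFun h2 m
  simp only [h1]
  change _ = (1 / 2) * c m
  rw [← h3, Finset.mul_sum]
  exact Finset.sum_congr rfl fun k _ => by ring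

/-- Reduces an identity linear in a vector to the basis; applied slot by slot to multilinear
identities. -/
lemma basisVec_induction {P : EuclideanSpace ℝ (Fin n) → Prop} (zero : P 0)
    (add : ∀ a b, P a → P b → P (a + b)) (smul : ∀ (c : ℝ) a, P a → P (c • a))
    (basis : ∀ i, P (basisVec i)) (v : EuclideanSpace ℝ (Fin n)) : P v := by
  have hv : v = ∑ i, v i • basisVec i := by
    ext j
    simp [Finset.sum_apply, Pi.single_apply]
  rw [hv]
  exact Finset.sum_induction _ P add zero fun i _ => smul _ _ (basis i)

lemma gramInner_basisVec_right (A : Matrix (Fin n) (Fin n) ℝ) (a : EuclideanSpace ℝ (Fin n))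
    (m : Fin n) : gramInner A a (basisVec m) = ∑ k, A k m * a k := by
  simp [gramInner]

lemma gramInner_basisVec (A : Matrix (Fin n) (Fin n) ℝ) (i j : Fin n) :
    gramInner A (basisVec i) (basisVec j) = A i j := by
  simp [gramInner]

lemma gramInner_comm {A : Matrix (Fin n) (Fin n) ℝ} (hA : ∀ i j, A i j = A j i)
    (a b : EuclideanSpace ℝ (Fin n)) : gramInner A a b = gramInner A b a := by
  rw [gramInner, gramInner, Finset.sum_comm]
  refine Finset.sum_congr rfl fun i _ => Finset.sum_congr rfl fun j _ => ?_
  rw [hA]; ring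

lemma det_ne_zero_of_pos {A : Matrix (Fin n) (Fin n) ℝ}
    (hpos : ∀ a, a ≠ 0 → 0 < gramInner A a a) : A.det ≠ 0 := by
  intro h0
  obtain ⟨v, hv, hAv⟩ := Matrix.exists_mulVec_eq_zero_iff.2 h0
  have hne : (WithLp.toLp 2 v : EuclideanSpace ℝ (Fin n)) ≠ 0 := fun h => hv (by
    simpa using congrArg WithLp.ofLp h)
  refine (hpos _ hne).ne' ?_
  have : gramInner A (WithLp.toLp 2 v) (WithLp.toLp 2 v) = ∑ i, v i * (A.mulVec v) i := by
    simp only [gramInner, Matrix.mulVec, dotProduct, Finset.mul_sum]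
    exact Finset.sum_congr rfl fun i _ => Finset.sum_congr rfl fun j _ => by ring
  rw [this, hAv]; simp

/-- The symbols contain derivatives of the entries, so symmetry of the matrix is required near the
point. -/
lemma christoffel_comm {G : EuclideanSpace ℝ (Fin n) → Matrix (Fin n) (Fin n) ℝ}
    {x : EuclideanSpace ℝ (Fin n)} (hsymm : ∀ᶠ w in 𝓝 x, ∀ i j, G w i j = G w j i)
    (k i j : Fin n) : christoffel G k i j x = christoffel G k j i x := by
  have h : ∀ l, partialDeriv l (fun z => G z i j) x = partialDeriv l (fun z => G z j i) x := by
    intro l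
    have : (fun z => G z i j) =ᶠ[𝓝 x] fun z => G z j i := by
      filter_upwards [hsymm] with w hw using hw i j
    rw [partialDeriv, this.fderiv_eq]; rfl
  simp only [christoffel]
  congr 1
  refine Finset.sum_congr rfl fun l _ => ?_
  rw [h l]; ring

/-- The connection defined by the Christoffel symbols is the Levi-Civita connection. -/
theorem isLeviCivita_chrisForm {s : Set (EuclideanSpace ℝ (Fin n))} (hs : IsOpen s)
    {G : EuclideanSpace ℝ (Fin n) → Matrix (Fin n) (Fin n) ℝ}
    (hG : ∀ x ∈ s, ∀ i j, ContDiffAt ℝ ∞ (fun w => G w i j) x)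
    (hsymm : ∀ x ∈ s, ∀ i j, G x i j = G x j i)
    (hpos : ∀ x ∈ s, ∀ a, a ≠ 0 → 0 < gramInner (G x) a a) :
    IsLeviCivita s (fun x => gramForm (G x)) (chrisForm G) := by
  have hdet : ∀ x ∈ s, (G x).det ≠ 0 := fun x hx => det_ne_zero_of_pos (hpos x hx)
  refine ⟨fun x hx => smooth_gramForm (hG x hx), fun x hx => smooth_chrisForm (hG x hx) (hdet x hx),
    fun x hx a b => ?_, fun x hx a ha => ?_, fun x hx a b => ?_, fun x hx X a b => ?_⟩
  · rw [gramForm_apply, gramForm_apply, gramInner_comm (hsymm x hx)]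
  · rw [gramForm_apply]; exact hpos x hx a ha
  · rw [chrisForm_apply, chrisForm_apply]
    have hev : ∀ᶠ w in 𝓝 x, ∀ i j, G w i j = G w j i := by
      filter_upwards [hs.mem_nhds hx] with w hw using hsymm w hw
    congr 1; funext k
    rw [Finset.sum_comm]
    refine Finset.sum_congr rfl fun i _ => Finset.sum_congr rfl fun j _ => ?_
    rw [christoffel_comm hev]; ring
  · have hd := ContDiffAt.smooth_differentiableAt (smooth_gramForm (hG x hx))
    have hentry : ∀ c i j, fderiv ℝ (fun w => gramForm (G w)) x (basisVec c) (basisVec i)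
        (basisVec j) = partialDeriv c (fun z => G z i j) x := by
      intro c i j
      have h1 := fderiv_bilin_apply hd (differentiableAt_const (basisVec i) (x := x))
        (differentiableAt_const (basisVec j) (x := x)) (basisVec c)
      simp only [gramForm_apply, gramInner_basisVec, fderiv_fun_const, Pi.zero_apply, zero_apply,
        map_zero, add_zero] at h1
      rw [partialDeriv, h1]
    have hkos : ∀ c i j, gramForm (G x) (chrisForm G x (basisVec c) (basisVec i)) (basisVec j) =
        (1 / 2) * (partialDeriv c (fun z => G z i j) x + partialDeriv i (fun z => G z c j) x
          - partialDeriv j (fun z => G z c i) x) := by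
      intro c i j
      rw [← sum_mul_christoffel (hdet x hx), gramForm_apply, gramInner_basisVec_right]
      refine Finset.sum_congr rfl fun k _ => ?_
      rw [hsymm x hx k j, chrisForm_apply]
      simp
    have hpd : ∀ c i j, partialDeriv c (fun z => G z i j) x
        = partialDeriv c (fun z => G z j i) x := by
      intro c i j
      have : (fun z => G z i j) =ᶠ[𝓝 x] fun z => G z j i := by
        filter_upwards [hs.mem_nhds hx] with w hw using hsymm w hw i j
      rw [partialDeriv, this.fderiv_eq]; rfl
    have hBs : ∀ a b, gramForm (G x) a b = gramForm (G x) b a := fun a b => by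
      rw [gramForm_apply, gramForm_apply, gramInner_comm (hsymm x hx)]
    induction X using basisVec_induction with
    | zero => simp
    | add X Y hX hY => simp only [map_add, add_apply, hX, hY]; ring
    | smul c X hX => simp only [map_smul, smul_apply, hX, smul_eq_mul]; ring
    | basis c =>
    induction a using basisVec_induction with
    | zero => simp
    | add X Y hX hY => simp only [map_add, add_apply, hX, hY]; ring
    | smul c X hX => simp only [map_smul, smul_apply, hX, smul_eq_mul]; ring
    | basis i =>
    induction b using basisVec_induction with
    | zero => simp
    | add X Y hX hY => simp only [map_add, hX, hY]; ring
    | smul c X hX => simp only [map_smul, hX, smul_eq_mul]; ring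
    | basis j =>
    rw [hentry, hBs (basisVec i), hkos, hkos, hpd c j i]
    ring

lemma christoffel_congr {G G' : EuclideanSpace ℝ (Fin n) → Matrix (Fin n) (Fin n) ℝ}
    {x : EuclideanSpace ℝ (Fin n)} (h : G =ᶠ[𝓝 x] G') (k i j : Fin n) :
    christoffel G k i j =ᶠ[𝓝 x] christoffel G' k i j := by
  filter_upwards [h.eventuallyEq_nhds] with w hw
  have hp : ∀ a b c, partialDeriv a (fun z => G z b c) w = partialDeriv a (fun z => G' z b c) w := by
    intro a b c
    have : (fun z => G z b c) =ᶠ[𝓝 w] fun z => G' z b c := hw.mono fun z hz => by simp only [hz]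
    rw [partialDeriv, this.fderiv_eq]; rfl
  simp only [christoffel, hp, hw.eq_of_nhds]

/-- The curvature depends only on the germ of the matrix. This matters because the first fundamental
form and its expression in a target chart agree only locally. -/
lemma gaussOfGram_congr {G G' : EuclideanSpace ℝ (Fin 2) → Matrix (Fin 2) (Fin 2) ℝ}
    {x : EuclideanSpace ℝ (Fin 2)} (h : G =ᶠ[𝓝 x] G') : gaussOfGram G x = gaussOfGram G' x := by
  have hp : ∀ a k i j, partialDeriv a (christoffel G k i j) x
      = partialDeriv a (christoffel G' k i j) x := by
    intro a k i j
    rw [partialDeriv, (christoffel_congr h k i j).fderiv_eq]; rfl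
  simp only [gaussOfGram, riemannCoeff, hp, h.eq_of_nhds,
    fun k i j => (christoffel_congr h k i j).eq_of_nhds]

end Matrices

/-! ### The Gauss equation -/

section Gauss

variable {n : ℕ} {E : Type*} [NormedAddCommGroup E] [NormedSpace ℝ E]
  {s : Set E} {B : E → E →L[ℝ] E →L[ℝ] ℝ} {Γ : E → E →L[ℝ] E →L[ℝ] E}

/-- The coefficient matrix of the pull-back of the metric `B` by `F`. -/
def pullGram (B : E → E →L[ℝ] E →L[ℝ] ℝ) (F : EuclideanSpace ℝ (Fin n) → E)
    (w : EuclideanSpace ℝ (Fin n)) : Matrix (Fin n) (Fin n) ℝ :=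
  Matrix.of fun i j => B (F w) (partialDeriv i F w) (partialDeriv j F w)

/-- The vector-valued second fundamental form `∇ᵢFⱼ - ∑ₖ ΓᵏᵢⱼFₖ` of `F`. -/
def secondForm (B : E → E →L[ℝ] E →L[ℝ] ℝ) (Γ : E → E →L[ℝ] E →L[ℝ] E)
    (F : EuclideanSpace ℝ (Fin n) → E) (i j : Fin n) (w : EuclideanSpace ℝ (Fin n)) : E :=
  covDeriv Γ F (partialDeriv j F) (basisVec i) w
    - ∑ k, christoffel (pullGram B F) k i j w • partialDeriv k F w

namespace IsLeviCivita

lemma smooth_pullGram (h : IsLeviCivita s B Γ) {F : EuclideanSpace ℝ (Fin n) → E}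
    {z : EuclideanSpace ℝ (Fin n)} (hz : F z ∈ s) (hF : ContDiffAt ℝ ∞ F z) (i j : Fin n) :
    ContDiffAt ℝ ∞ (fun w => pullGram B F w i j) z :=
  h.smooth_inner hz hF (ContDiffAt.smooth_fderiv_apply hF _) (ContDiffAt.smooth_fderiv_apply hF _)

/-- The Koszul formula along F and the one for the Christoffel symbols of the pulled-back metric
have the same right-hand side, so subtracting the induced connection leaves a normal vector. -/
lemma inner_secondForm (h : IsLeviCivita s B Γ) {F : EuclideanSpace ℝ (Fin n) → E}
    {z : EuclideanSpace ℝ (Fin n)} (hz : F z ∈ s) (hF : ContDiffAt ℝ ∞ F z)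
    (hdet : (pullGram B F z).det ≠ 0) (i j l : Fin n) :
    B (F z) (secondForm B Γ F i j z) (partialDeriv l F z) = 0 := by
  have h1 := h.koszul hz hF (basisVec i) (basisVec j) (basisVec l)
  have h2 := sum_mul_christoffel hdet l i j
  have h3 : ∑ k, pullGram B F z l k * christoffel (pullGram B F) k i j z =
      B (F z) (∑ k, christoffel (pullGram B F) k i j z • partialDeriv k F z)
        (partialDeriv l F z) := by
    simp only [map_sum, map_smul, FunLike.coe_sum, Finset.sum_apply, smul_apply, smul_eq_mul]
    refine Finset.sum_congr rfl fun k _ => ?_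
    rw [pullGram, Matrix.of_apply, h.symm _ hz]
    ring
  rw [secondForm, map_sub, sub_apply, ← h3, h2]
  exact sub_eq_zero.2 h1

lemma secondForm_comm (h : IsLeviCivita s B Γ) {F : EuclideanSpace ℝ (Fin n) → E}
    {z : EuclideanSpace ℝ (Fin n)} (hs : IsOpen s) (hz : F z ∈ s) (hF : ContDiffAt ℝ ∞ F z)
    (i j : Fin n) : secondForm B Γ F i j z = secondForm B Γ F j i z := by
  have hev : ∀ᶠ w in 𝓝 z, ∀ i j, pullGram B F w i j = pullGram B F w j i := by
    filter_upwards [hF.continuousAt.preimage_mem_nhds (hs.mem_nhds hz)] with w hw i j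
    exact h.symm _ hw _ _
  rw [secondForm, secondForm]
  congr 1
  · exact h.covDeriv_symm hz hF _ _
  · exact Finset.sum_congr rfl fun k _ => by rw [christoffel_comm hev]

/-- The field ∇_jF_k is the normal vector II_jk plus the tangential sum Γᵐ_jk F_m. Since II_jk stays
orthogonal to F_l, its derivative contributes −⟨II_jk, II_il⟩; the tangential sum contributes the
Christoffel terms of the intrinsic curvature. -/
lemma inner_covDeriv_covDeriv (h : IsLeviCivita s B Γ) (hs : IsOpen s)
    {F : EuclideanSpace ℝ (Fin n) → E}
    {z : EuclideanSpace ℝ (Fin n)} (hz : F z ∈ s) (hF : ∀ᶠ w in 𝓝 z, ContDiffAt ℝ ∞ F w)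
    (hdet : (pullGram B F z).det ≠ 0) (i j k l : Fin n) :
    B (F z) (covDeriv Γ F (covDeriv Γ F (partialDeriv k F) (basisVec j)) (basisVec i) z)
      (partialDeriv l F z) =
    - B (F z) (secondForm B Γ F j k z) (secondForm B Γ F i l z)
      + ∑ m, (partialDeriv i (christoffel (pullGram B F) m j k) z * pullGram B F z m l
        + christoffel (pullGram B F) m j k z *
          ∑ r, christoffel (pullGram B F) r i m z * pullGram B F z r l) := by
  have hFz := hF.self_of_nhds
  have hpd : ∀ m, ContDiffAt ℝ ∞ (partialDeriv m F) z :=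
    fun m => ContDiffAt.smooth_fderiv_apply hFz _
  have hchr : ∀ a b c, ContDiffAt ℝ ∞ (christoffel (pullGram B F) a b c) z :=
    fun a b c => smooth_christoffel (h.smooth_pullGram hz hFz) hdet a b c
  have hSs : ContDiffAt ℝ ∞ (secondForm B Γ F j k) z :=
    (smooth_covDeriv (h.conn_smooth _ hz) hFz (hpd k) _).sub
      (ContDiffAt.sum fun m _ => (hchr m j k).smul (hpd m))
  have horth : (fun w => B (F w) (secondForm B Γ F j k w) (partialDeriv l F w)) =ᶠ[𝓝 z]
      fun _ => 0 := by
    have hdc : ContinuousAt (fun w => (pullGram B F w).det) z :=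
      (smooth_det (h.smooth_pullGram hz hFz)).continuousAt
    filter_upwards [hF, hFz.continuousAt.preimage_mem_nhds (hs.mem_nhds hz),
      hdc.eventually_ne hdet] with w h1 h2 h3
    exact h.inner_secondForm h2 h1 h3 j k l
  have hS : B (F z) (covDeriv Γ F (secondForm B Γ F j k) (basisVec i) z) (partialDeriv l F z) =
      - B (F z) (secondForm B Γ F j k z) (secondForm B Γ F i l z) := by
    have h1 := h.fderiv_inner hz (ContDiffAt.smooth_differentiableAt hFz)
      (ContDiffAt.smooth_differentiableAt hSs)
      (ContDiffAt.smooth_differentiableAt (hpd l)) (basisVec i)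
    rw [horth.fderiv_eq] at h1
    simp only [fderiv_fun_const, Pi.zero_apply, zero_apply] at h1
    have h2 : B (F z) (secondForm B Γ F j k z)
        (covDeriv Γ F (partialDeriv l F) (basisVec i) z) =
        B (F z) (secondForm B Γ F j k z) (secondForm B Γ F i l z) := by
      have h3 : covDeriv Γ F (partialDeriv l F) (basisVec i) z = secondForm B Γ F i l z
          + ∑ m, christoffel (pullGram B F) m i l z • partialDeriv m F z := by
        rw [secondForm]; abel
      rw [h3, map_add, map_sum, add_eq_left]
      refine Finset.sum_eq_zero fun m _ => ?_
      rw [map_smul, h.inner_secondForm hz hFz hdet, smul_zero]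
    linarith
  have hterm : ∀ m, B (F z) (covDeriv Γ F (fun w => christoffel (pullGram B F) m j k w •
      partialDeriv m F w) (basisVec i) z) (partialDeriv l F z) =
      partialDeriv i (christoffel (pullGram B F) m j k) z * pullGram B F z m l
        + christoffel (pullGram B F) m j k z *
          ∑ r, christoffel (pullGram B F) r i m z * pullGram B F z r l := by
    intro m
    rw [covDeriv_smul (ContDiffAt.smooth_differentiableAt (hchr m j k))
      (ContDiffAt.smooth_differentiableAt (hpd m))]
    have h3 : covDeriv Γ F (partialDeriv m F) (basisVec i) z = secondForm B Γ F i m z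
        + ∑ r, christoffel (pullGram B F) r i m z • partialDeriv r F z := by
      rw [secondForm]; abel
    rw [h3]
    simp only [map_add, map_smul, map_sum, add_apply, smul_apply, smul_eq_mul, FunLike.coe_sum,
      Finset.sum_apply, h.inner_secondForm hz hFz hdet, zero_add]
    rfl
  have hsplit : covDeriv Γ F (covDeriv Γ F (partialDeriv k F) (basisVec j)) (basisVec i) z =
      covDeriv Γ F (secondForm B Γ F j k) (basisVec i) z
      + ∑ m, covDeriv Γ F (fun w => christoffel (pullGram B F) m j k w • partialDeriv m F w)
          (basisVec i) z := by
    have hd : ∀ m, DifferentiableAt ℝ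
        (fun w => christoffel (pullGram B F) m j k w • partialDeriv m F w) z :=
      fun m => ContDiffAt.smooth_differentiableAt ((hchr m j k).smul (hpd m))
    have h1 : covDeriv Γ F (partialDeriv k F) (basisVec j) = fun w => secondForm B Γ F j k w
        + ∑ m, christoffel (pullGram B F) m j k w • partialDeriv m F w := by
      funext w; rw [secondForm]; abel
    have h2 : covDeriv Γ F (fun w => ∑ m, christoffel (pullGram B F) m j k w • partialDeriv m F w)
        (basisVec i) z = ∑ m, covDeriv Γ F
          (fun w => christoffel (pullGram B F) m j k w • partialDeriv m F w) (basisVec i) z := by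
      simp only [covDeriv]
      rw [fderiv_fun_sum fun m _ => hd m]
      simp only [FunLike.coe_sum, Finset.sum_apply, map_sum, Finset.sum_add_distrib]
    rw [h1, covDeriv_add (ContDiffAt.smooth_differentiableAt hSs)
      (DifferentiableAt.fun_sum fun m _ => hd m), h2]
  rw [hsplit, map_add, add_apply, hS, map_sum]
  simp only [FunLike.coe_sum, Finset.sum_apply, hterm]

/-- The Gauss equation for a surface. -/
theorem gauss_equation (h : IsLeviCivita s B Γ) (hs : IsOpen s)
    {F : EuclideanSpace ℝ (Fin 2) → E} {z : EuclideanSpace ℝ (Fin 2)} (hz : F z ∈ s)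
    (hF : ∀ᶠ w in 𝓝 z, ContDiffAt ℝ ∞ F w) (hdet : (pullGram B F z).det ≠ 0) :
    gaussOfGram (pullGram B F) z * (pullGram B F z).det =
      B (F z) (curvOp Γ (F z) (partialDeriv 0 F z) (partialDeriv 1 F z) (partialDeriv 1 F z))
        (partialDeriv 0 F z)
      + B (F z) (secondForm B Γ F 0 0 z) (secondForm B Γ F 1 1 z)
      - B (F z) (secondForm B Γ F 0 1 z) (secondForm B Γ F 0 1 z) := by
  have hFz := hF.self_of_nhds
  have hcomm := covDeriv_commutator (h.conn_smooth _ hz) hFz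
    (ContDiffAt.smooth_fderiv_apply hFz (basisVec 1)) (basisVec 0) (basisVec 1)
  have hin := congrArg (fun v => B (F z) v (partialDeriv 0 F z)) hcomm
  simp only [map_sub, sub_apply] at hin
  -- Antisymmetrising in the first two indices turns the left side into the ambient curvature and
  -- the Christoffel terms into the intrinsic one.
  have e1 := h.inner_covDeriv_covDeriv hs hz hF hdet 0 1 1 0
  have e2 := h.inner_covDeriv_covDeriv hs hz hF hdet 1 0 1 0
  have hS := h.secondForm_comm hs hz hFz 1 0
  have hSs := h.symm _ hz (secondForm B Γ F 1 1 z) (secondForm B Γ F 0 0 z)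
  have hIs : pullGram B F z 1 0 = pullGram B F z 0 1 := h.symm _ hz _ _
  have hin' := (congrArg₂ (· - ·) e1 e2).symm.trans hin
  rw [gaussOfGram, div_mul_cancel₀ _ hdet]
  rw [hS, hSs] at hin'
  simp only [riemannCoeff, Fin.sum_univ_two, hIs] at hin' ⊢
  change _ = B (F z) (curvOp Γ (F z) (partialDeriv 0 F z) (partialDeriv 1 F z)
    (partialDeriv 1 F z)) (partialDeriv 0 F z) at hin'
  linear_combination hin'

end IsLeviCivita

end Gauss

/-! ### Surfaces with a unit normal field in a three-dimensional metric -/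

abbrev Plane := EuclideanSpace ℝ (Fin 2)

abbrev Space := EuclideanSpace ℝ (Fin 3)

/-- The determinant of three vectors. -/
def tripleDet (a b c : Space) : ℝ :=
  (Matrix.of ![fun k => a k, fun k => b k, fun k => c k]).det

lemma tripleDet_eq (a b c : Space) : tripleDet a b c =
    a 0 * b 1 * c 2 - a 0 * b 2 * c 1 - a 1 * b 0 * c 2 + a 1 * b 2 * c 0 + a 2 * b 0 * c 1
      - a 2 * b 1 * c 0 := by
  simp [tripleDet, Matrix.det_fin_three]

/-- The determinant of a product of three matrices whose entries are the inner products. The later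
determinant computations rest on it, with orthogonality relations in place of coordinates. -/
lemma tripleDet_mul_gram (A : Matrix (Fin 3) (Fin 3) ℝ) (a b c a' b' c' : Space) :
    tripleDet a b c * A.det * tripleDet a' b' c' =
      gramInner A a a' *
        (gramInner A b b' * gramInner A c c' - gramInner A b c' * gramInner A c b')
      - gramInner A a b' *
        (gramInner A b a' * gramInner A c c' - gramInner A b c' * gramInner A c a')
      + gramInner A a c' *
        (gramInner A b a' * gramInner A c b' - gramInner A b b' * gramInner A c a') := by
  have h : (Matrix.of ![fun k => a k, fun k => b k, fun k => c k]) * A *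
      (Matrix.of ![fun k => a' k, fun k => b' k, fun k => c' k]).transpose =
      !![gramInner A a a', gramInner A a b', gramInner A a c';
        gramInner A b a', gramInner A b b', gramInner A b c';
        gramInner A c a', gramInner A c b', gramInner A c c'] := by
    ext i j
    fin_cases i <;> fin_cases j <;>
      simp [Matrix.mul_apply, Matrix.vecMul, dotProduct, gramInner, Fin.sum_univ_three] <;> ring
  rw [tripleDet, tripleDet, ← Matrix.det_transpose (Matrix.of ![fun k => a' k, _, _]),
    ← Matrix.det_mul, ← Matrix.det_mul, h, Matrix.det_fin_three]
  simp only [Matrix.of_apply, Matrix.cons_val', Matrix.cons_val_zero, Matrix.cons_val_one,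
      Matrix.cons_val]
  ring

lemma tripleDet_eq_zero_iff (a b c : Space) :
    tripleDet a b c = 0 ↔ ∃ x : Fin 3 → ℝ, x ≠ 0 ∧ x 0 • a + x 1 • b + x 2 • c = 0 := by
  rw [tripleDet, ← Matrix.exists_vecMul_eq_zero_iff]
  refine exists_congr fun x => and_congr_right fun _ => ?_
  rw [funext_iff, PiLp.ext_iff]
  refine forall_congr' fun k => ?_
  simp [Matrix.vecMul, dotProduct, Fin.sum_univ_three]

lemma smooth_coord {D : Type*} [NormedAddCommGroup D] [NormedSpace ℝ D] {m : ℕ}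
    {a : D → EuclideanSpace ℝ (Fin m)} {z : D}
    (ha : ContDiffAt ℝ ∞ a z) (i : Fin m) : ContDiffAt ℝ ∞ (fun w => a w i) z :=
  (EuclideanSpace.proj i : EuclideanSpace ℝ (Fin m) →L[ℝ] ℝ).contDiff.contDiffAt.comp z ha

lemma smooth_tripleDet {D : Type*} [NormedAddCommGroup D] [NormedSpace ℝ D] {a b c : D → Space}
    {z : D} (ha : ContDiffAt ℝ ∞ a z) (hb : ContDiffAt ℝ ∞ b z) (hc : ContDiffAt ℝ ∞ c z) :
    ContDiffAt ℝ ∞ (fun w => tripleDet (a w) (b w) (c w)) z := by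
  refine smooth_det fun i j => ?_
  fin_cases i
  · exact smooth_coord ha j
  · exact smooth_coord hb j
  · exact smooth_coord hc j

/-- The cross product in coordinates. -/
def crossVec (a b : Space) : Fin 3 → ℝ :=
  ![a 1 * b 2 - a 2 * b 1, a 2 * b 0 - a 0 * b 2, a 0 * b 1 - a 1 * b 0]

/-- In dimension three a skew form depends only on X × Y. Linearity in the second slot follows from
skewness, so only the first is assumed; indices are modulo 3. -/
lemma skew_eq_crossVec {b : Space → Space → ℝ} (hadd : ∀ X X' Y, b (X + X') Y = b X Y + b X' Y)
    (hsmul : ∀ (c : ℝ) X Y, b (c • X) Y = c * b X Y) (hskew : ∀ X Y, b X Y = - b Y X)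
    (X Y : Space) :
    b X Y = ∑ k, crossVec X Y k * b (basisVec (k + 1)) (basisVec (k + 2)) := by
  have expand : ∀ v : Space, v = v 0 • basisVec 0 + v 1 • basisVec 1 + v 2 • basisVec 2 := by
    intro v
    ext k
    fin_cases k <;> simp
  have hdiag : ∀ X, b X X = 0 := fun X => by linarith [hskew X X]
  have hR : ∀ Z, b X Z = X 0 * b (basisVec 0) Z + X 1 * b (basisVec 1) Z
      + X 2 * b (basisVec 2) Z := by
    intro Z
    conv_lhs => rw [expand X]
    simp only [hadd, hsmul]
  have hL : ∀ Z, b Y Z = Y 0 * b (basisVec 0) Z + Y 1 * b (basisVec 1) Z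
      + Y 2 * b (basisVec 2) Z := by
    intro Z
    conv_lhs => rw [expand Y]
    simp only [hadd, hsmul]
  rw [hR Y, hskew _ Y, hskew _ Y, hskew _ Y, hL, hL, hL, hdiag, hdiag, hdiag,
    hskew (basisVec 1) (basisVec 0), hskew (basisVec 2) (basisVec 1),
    hskew (basisVec 0) (basisVec 2), Fin.sum_univ_three]
  simp only [crossVec]
  change _ = (X 1 * Y 2 - X 2 * Y 1) * b (basisVec 1) (basisVec 2)
    + (X 2 * Y 0 - X 0 * Y 2) * b (basisVec 2) (basisVec 0)
    + (X 0 * Y 1 - X 1 * Y 0) * b (basisVec 0) (basisVec 1)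
  ring

/-- The curvature tensor is skew in each pair of arguments, so this expression is quadratic in X ×
Y. At a regular point F_u × F_v carries a factor λ, so the ambient term of the Gauss equation is
divisible by λ². The sign comes from exchanging the last two arguments. -/
lemma curvOp_inner_eq_crossVec {s : Set Space} {B : Space → Space →L[ℝ] Space →L[ℝ] ℝ}
    {Γ : Space → Space →L[ℝ] Space →L[ℝ] Space} (h : IsLeviCivita s B Γ) (hs : IsOpen s)
    {x : Space} (hx : x ∈ s) (X Y : Space) :
    B x (curvOp Γ x X Y Y) X = - ∑ k, ∑ l, crossVec X Y k * crossVec X Y l *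
      B x (curvOp Γ x (basisVec (k + 1)) (basisVec (k + 2)) (basisVec (l + 1)))
        (basisVec (l + 2)) := by
  have h1 := fun W Z : Space => skew_eq_crossVec (b := fun X Y => B x (curvOp Γ x X Y W) Z)
    (fun X X' Y => by simp only [curvOp, map_add, map_sub, add_apply, sub_apply]; ring)
    (fun c X Y => by
      simp only [curvOp, map_add, map_sub, map_smul, smul_apply, add_apply, sub_apply, smul_eq_mul]
      ring)
    (fun X Y => by rw [curvOp_swap]; simp) X Y
  have h2 := fun X Y : Space => skew_eq_crossVec (b := fun W Z => B x (curvOp Γ x X Y W) Z)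
    (fun W W' Z => by simp only [curvOp, map_add, map_sub, add_apply, sub_apply]; ring)
    (fun c W Z => by
      simp only [curvOp, map_add, map_sub, map_smul, smul_apply, add_apply, sub_apply, smul_eq_mul]
      ring)
    (fun W Z => h.curvOp_inner_skew hs hx X Y W Z)
  rw [h.curvOp_inner_skew hs hx, h1]
  simp only [h2 _ _ X Y, Finset.mul_sum, mul_assoc]

/-- A smooth map `F` with a smooth unit normal field `n`, in a domain of `ℝ³` with the metric with
coefficient matrix `G`. -/
structure IsNormalPair (s : Set Space) (G : Space → Matrix (Fin 3) (Fin 3) ℝ) (Ω : Set Plane)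
    (F n : Plane → Space) : Prop where
  isOpen_target : IsOpen s
  gram_smooth : ∀ x ∈ s, ∀ i j, ContDiffAt ℝ ∞ (fun w => G w i j) x
  leviCivita : IsLeviCivita s (fun x => gramForm (G x)) (chrisForm G)
  isOpen_source : IsOpen Ω
  map_smooth : ∀ z ∈ Ω, ContDiffAt ℝ ∞ F z
  field_smooth : ∀ z ∈ Ω, ContDiffAt ℝ ∞ n z
  mapsTo : MapsTo F Ω s
  unit : ∀ z ∈ Ω, gramForm (G (F z)) (n z) (n z) = 1
  normal : ∀ z ∈ Ω, ∀ X, gramForm (G (F z)) (fderiv ℝ F z X) (n z) = 0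

/-- The determinant of `F_u`, `F_v` and `n`. -/
def areaDet (F n : Plane → Space) (z : Plane) : ℝ :=
  tripleDet (partialDeriv 0 F z) (partialDeriv 1 F z) (n z)

/-- The covariant derivative of the normal field. -/
def shape (G : Space → Matrix (Fin 3) (Fin 3) ℝ) (F n : Plane → Space) (X z : Plane) : Space :=
  covDeriv (chrisForm G) F n X z

/-- The sectional curvature of the orthogonal complement of `n`, up to the factor `det G`. -/
def ambientTerm (G : Space → Matrix (Fin 3) (Fin 3) ℝ) (F n : Plane → Space) (z : Plane) : ℝ :=
  - ∑ k, ∑ l, gramInner (G (F z)) (n z) (basisVec k) * gramInner (G (F z)) (n z) (basisVec l) *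
      gramForm (G (F z)) (curvOp (chrisForm G) (F z) (basisVec (k + 1)) (basisVec (k + 2))
        (basisVec (l + 1))) (basisVec (l + 2))

/-- The product of the Gaussian curvature and the area density, as a smooth function. -/
def curvNumer (G : Space → Matrix (Fin 3) (Fin 3) ℝ) (F n : Plane → Space) (z : Plane) : ℝ :=
  tripleDet (shape G F n (basisVec 0) z) (shape G F n (basisVec 1) z) (n z)
    + areaDet F n z * (ambientTerm G F n z / (G (F z)).det)

/-- The normal curvature of `F` in the direction `X`. -/
def normalCurv (G : Space → Matrix (Fin 3) (Fin 3) ℝ) (F n : Plane → Space) (X z : Plane) : ℝ :=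
  - gramForm (G (F z)) (fderiv ℝ F z X) (shape G F n X z) /
    gramForm (G (F z)) (fderiv ℝ F z X) (fderiv ℝ F z X)

/-! ### The curvature times the area density as a smooth function. -/

namespace IsNormalPair

variable {s : Set Space} {G : Space → Matrix (Fin 3) (Fin 3) ℝ} {Ω : Set Plane}
  {F n : Plane → Space} {z : Plane}

lemma gram_det_ne_zero (h : IsNormalPair s G Ω F n) (hz : z ∈ Ω) : (G (F z)).det ≠ 0 :=
  det_ne_zero_of_pos fun a ha => by
    rw [← gramForm_apply]; exact h.leviCivita.pos _ (h.mapsTo hz) a ha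

lemma smooth_shape (h : IsNormalPair s G Ω F n) (hz : z ∈ Ω) (X : Plane) :
    ContDiffAt ℝ ∞ (shape G F n X) z :=
  smooth_covDeriv (h.leviCivita.conn_smooth _ (h.mapsTo hz)) (h.map_smooth z hz)
    (h.field_smooth z hz) X

lemma smooth_areaDet (h : IsNormalPair s G Ω F n) (hz : z ∈ Ω) :
    ContDiffAt ℝ ∞ (areaDet F n) z :=
  smooth_tripleDet (ContDiffAt.smooth_fderiv_apply (h.map_smooth z hz) _)
    (ContDiffAt.smooth_fderiv_apply (h.map_smooth z hz) _) (h.field_smooth z hz)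

lemma smooth_gram_comp (h : IsNormalPair s G Ω F n) (hz : z ∈ Ω) (i j : Fin 3) :
    ContDiffAt ℝ ∞ (fun w => G (F w) i j) z :=
  (h.gram_smooth _ (h.mapsTo hz) i j).comp z (h.map_smooth z hz)

/-- The only denominator is det G, which never vanishes, so singular points do no harm. -/
lemma smooth_curvNumer (h : IsNormalPair s G Ω F n) (hz : z ∈ Ω) :
    ContDiffAt ℝ ∞ (curvNumer G F n) z := by
  have hF := h.map_smooth z hz
  have hΓ := h.leviCivita.conn_smooth _ (h.mapsTo hz)
  have hB : ContDiffAt ℝ ∞ (fun w => gramForm (G (F w))) z :=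
    smooth_gramForm (h.smooth_gram_comp hz)
  have hc : ∀ v : Space, ContDiffAt ℝ ∞ (fun _ : Plane => v) z := fun v => contDiffAt_const
  have hn : ∀ k, ContDiffAt ℝ ∞ (fun w => gramInner (G (F w)) (n w) (basisVec k)) z := by
    intro k
    simp only [← gramForm_apply]
    exact smooth_bilin_apply hB (h.field_smooth z hz) (hc _)
  refine (smooth_tripleDet (h.smooth_shape hz _) (h.smooth_shape hz _) (h.field_smooth z hz)).add
    ((h.smooth_areaDet hz).mul (ContDiffAt.div ?_ (smooth_det (h.smooth_gram_comp hz))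
      (h.gram_det_ne_zero hz)))
  refine ContDiffAt.neg (ContDiffAt.sum fun k _ => ContDiffAt.sum fun l _ => ?_)
  exact ((hn k).mul (hn l)).mul (smooth_bilin_apply hB (smooth_curvOp hΓ hF _ _ _) (hc _))

lemma symm (h : IsNormalPair s G Ω F n) (hz : z ∈ Ω) (a b : Space) :
    gramForm (G (F z)) a b = gramForm (G (F z)) b a := h.leviCivita.symm _ (h.mapsTo hz) a b

lemma inner_shape_field (h : IsNormalPair s G Ω F n) (hz : z ∈ Ω) (X : Plane) :
    gramForm (G (F z)) (shape G F n X z) (n z) = 0 := by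
  have h1 := h.leviCivita.fderiv_inner (h.mapsTo hz)
    (ContDiffAt.smooth_differentiableAt (h.map_smooth z hz))
    (ContDiffAt.smooth_differentiableAt (h.field_smooth z hz))
    (ContDiffAt.smooth_differentiableAt (h.field_smooth z hz)) X
  have hev : (fun w => gramForm (G (F w)) (n w) (n w)) =ᶠ[𝓝 z] fun _ => 1 := by
    filter_upwards [h.isOpen_source.mem_nhds hz] with w hw using h.unit w hw
  rw [hev.fderiv_eq, h.symm hz (n z)] at h1
  simp only [fderiv_fun_const, Pi.zero_apply, zero_apply] at h1
  rw [shape]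
  linarith

/-- Differentiate ⟨F_Y, n⟩ = 0. This trades second derivatives of F for first derivatives of the
normal. -/
lemma inner_covDeriv_field (h : IsNormalPair s G Ω F n) (hz : z ∈ Ω) (X Y : Plane) :
    gramForm (G (F z)) (covDeriv (chrisForm G) F (fun w => fderiv ℝ F w Y) X z) (n z) =
      - gramForm (G (F z)) (fderiv ℝ F z Y) (shape G F n X z) := by
  have h1 := h.leviCivita.fderiv_inner (h.mapsTo hz)
    (ContDiffAt.smooth_differentiableAt (h.map_smooth z hz))
    (ContDiffAt.smooth_differentiableAt (ContDiffAt.smooth_fderiv_apply (h.map_smooth z hz) Y))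
    (ContDiffAt.smooth_differentiableAt (h.field_smooth z hz)) X
  have hev : (fun w => gramForm (G (F w)) (fderiv ℝ F w Y) (n w)) =ᶠ[𝓝 z] fun _ => 0 := by
    filter_upwards [h.isOpen_source.mem_nhds hz] with w hw using h.normal w hw Y
  rw [hev.fderiv_eq] at h1
  simp only [fderiv_fun_const, Pi.zero_apply, zero_apply] at h1
  rw [shape]
  linarith

/-- Symmetry of the second fundamental form; regularity plays no role, so it is available at
singular points, where it matters most. -/
lemma inner_shape_comm (h : IsNormalPair s G Ω F n) (hz : z ∈ Ω) (X Y : Plane) :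
    gramForm (G (F z)) (fderiv ℝ F z Y) (shape G F n X z) =
      gramForm (G (F z)) (fderiv ℝ F z X) (shape G F n Y z) := by
  have h1 := h.inner_covDeriv_field hz X Y
  rw [h.leviCivita.covDeriv_symm (h.mapsTo hz) (h.map_smooth z hz) X Y,
    h.inner_covDeriv_field hz Y X] at h1
  linarith

/-- With v in the third slot, `tripleDet_mul_gram` shows that det(x, y, v) = 0 for all x, y; basis
vectors then give each coordinate of v. -/
lemma eq_zero_of_orthogonal (h : IsNormalPair s G Ω F n) (hz : z ∈ Ω) {a b c v : Space}
    (hdet : tripleDet a b c ≠ 0) (ha : gramForm (G (F z)) v a = 0)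
    (hb : gramForm (G (F z)) v b = 0) (hc : gramForm (G (F z)) v c = 0) : v = 0 := by
  by_contra hv
  have h1 : tripleDet a b c * (G (F z)).det ≠ 0 := mul_ne_zero hdet (h.gram_det_ne_zero hz)
  have h2 := fun x y : Space => tripleDet_mul_gram (G (F z)) x y v a b c
  simp only [← gramForm_apply, ha, hb, hc] at h2
  have h3 : ∀ x y, tripleDet x y v = 0 := by
    intro x y
    have := h2 x y
    have h4 : tripleDet x y v * ((G (F z)).det * tripleDet a b c) = 0 := by linarith
    exact (mul_eq_zero.1 h4).resolve_right (by rwa [mul_comm])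
  apply hv
  have e0 := h3 (basisVec 1) (basisVec 2)
  have e1 := h3 (basisVec 0) (basisVec 2)
  have e2 := h3 (basisVec 0) (basisVec 1)
  simp [tripleDet_eq] at e0 e1 e2
  ext k
  fin_cases k
  · exact e0
  · simpa using e1
  · exact e2

lemma det_pullGram (h : IsNormalPair s G Ω F n) (hz : z ∈ Ω) :
    (pullGram (fun x => gramForm (G x)) F z).det = areaDet F n z ^ 2 * (G (F z)).det := by
  have h1 := tripleDet_mul_gram (G (F z)) (partialDeriv 0 F z) (partialDeriv 1 F z) (n z)
    (partialDeriv 0 F z) (partialDeriv 1 F z) (n z)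
  have h0 := fun i : Fin 2 => h.normal z hz (basisVec i)
  have h0' := fun i : Fin 2 => (h.symm hz (n z) (fderiv ℝ F z (basisVec i))).trans (h0 i)
  simp only [← gramForm_apply, h.unit z hz] at h1
  simp only [partialDeriv, h0, h0'] at h1
  rw [Matrix.det_fin_two]
  simp only [pullGram, Matrix.of_apply, areaDet, partialDeriv]
  linarith

/-- The Gram identity for the mixed triples (F_u, F_v, n) and (∇_un, ∇_vn, n). The second
fundamental form thus contributes one factor λ, against λ² in `det_pullGram`; this is why K has at
most a simple pole in λ. -/
lemma area_mul_shape (h : IsNormalPair s G Ω F n) (hz : z ∈ Ω) :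
    areaDet F n z * (G (F z)).det *
      tripleDet (shape G F n (basisVec 0) z) (shape G F n (basisVec 1) z) (n z) =
    gramForm (G (F z)) (partialDeriv 0 F z) (shape G F n (basisVec 0) z) *
      gramForm (G (F z)) (partialDeriv 1 F z) (shape G F n (basisVec 1) z) -
    gramForm (G (F z)) (partialDeriv 0 F z) (shape G F n (basisVec 1) z) *
      gramForm (G (F z)) (partialDeriv 1 F z) (shape G F n (basisVec 0) z) := by
  have h1 := tripleDet_mul_gram (G (F z)) (partialDeriv 0 F z) (partialDeriv 1 F z) (n z)
    (shape G F n (basisVec 0) z) (shape G F n (basisVec 1) z) (n z)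
  have h0 := fun i : Fin 2 => h.normal z hz (basisVec i)
  have h2 := fun i : Fin 2 => (h.symm hz (n z) _).trans (h.inner_shape_field hz (basisVec i))
  simp only [← gramForm_apply, h.unit z hz] at h1
  simp only [partialDeriv, h0, h2] at h1
  simp only [areaDet, partialDeriv]
  linarith

/-- Both sides, as covectors, vanish on F_u and F_v and take the value λ on n; at a regular point
these three vectors span. -/
lemma gramInner_field_mul_area (h : IsNormalPair s G Ω F n) (hz : z ∈ Ω)
    (hreg : areaDet F n z ≠ 0) (k : Fin 3) :
    crossVec (partialDeriv 0 F z) (partialDeriv 1 F z) k =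
      areaDet F n z * gramInner (G (F z)) (n z) (basisVec k) := by
  set a := partialDeriv 0 F z with ha
  set b := partialDeriv 1 F z with hb
  set c := n z with hc
  set w : Fin 3 → ℝ := fun k => crossVec a b k - areaDet F n z * gramInner (G (F z)) c (basisVec k)
    with hw
  have hdual : ∀ v : Space, ∑ k, v k * gramInner (G (F z)) c (basisVec k) =
      gramForm (G (F z)) v c := by
    intro v
    rw [h.symm hz, gramForm_apply]
    simp only [gramInner, Fin.sum_univ_three]
    simp
    ring
  have h1 : (Matrix.of ![fun k => a k, fun k => b k, fun k => c k]).mulVec w = 0 := by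
    have e1 := hdual a
    have e2 := hdual b
    have e3 := hdual c
    rw [ha, partialDeriv, h.normal z hz] at e1
    rw [hb, partialDeriv, h.normal z hz] at e2
    rw [hc, h.unit z hz] at e3
    have earea : areaDet F n z = tripleDet a b c := rfl
    rw [tripleDet_eq] at earea
    change ∑ k, a k * _ = _ at e1
    change ∑ k, b k * _ = _ at e2
    change ∑ k, c k * _ = _ at e3
    simp only [Fin.sum_univ_three] at e1 e2 e3
    funext i
    fin_cases i
    · simp [Matrix.mulVec, dotProduct, Fin.sum_univ_three, hw, crossVec]
      linear_combination (- areaDet F n z) * e1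
    · simp [Matrix.mulVec, dotProduct, Fin.sum_univ_three, hw, crossVec]
      linear_combination (- areaDet F n z) * e2
    · simp [Matrix.mulVec, dotProduct, Fin.sum_univ_three, hw, crossVec]
      linear_combination (- areaDet F n z) * e3 - earea
  have h2 : w = 0 := by
    by_contra hne
    exact hreg (Matrix.exists_mulVec_eq_zero_iff.1 ⟨w, hne, h1⟩)
  have := congrFun h2 k
  simp only [hw, Pi.zero_apply] at this
  linarith

/-- The product of the Gaussian curvature and the area density extends smoothly across the
singular set. -/
theorem gaussOfGram_mul_areaDet (h : IsNormalPair s G Ω F n) (hz : z ∈ Ω)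
    (hreg : areaDet F n z ≠ 0) :
    gaussOfGram (pullGram (fun x => gramForm (G x)) F) z * areaDet F n z = curvNumer G F n z := by
  have hdet0 := h.gram_det_ne_zero hz
  have hdet : (pullGram (fun x => gramForm (G x)) F z).det ≠ 0 := by
    rw [h.det_pullGram hz]; positivity
  have hFs : ∀ᶠ w in 𝓝 z, ContDiffAt ℝ ∞ F w := by
    filter_upwards [h.isOpen_source.mem_nhds hz] with w hw using h.map_smooth w hw
  have hG := h.leviCivita.gauss_equation h.isOpen_target (h.mapsTo hz) hFs hdet
  have hperp : ∀ k, gramForm (G (F z)) (n z) (partialDeriv k F z) = 0 := fun k => by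
    rw [h.symm hz]; exact h.normal z hz _
  -- The second fundamental form is normal, and differentiating ⟨F_j, n⟩ = 0 identifies its
  -- n-component as −⟨F_j, ∇_in⟩.
  have hpar : ∀ i j, secondForm (fun x => gramForm (G x)) (chrisForm G) F i j z =
      (- gramForm (G (F z)) (partialDeriv j F z) (shape G F n (basisVec i) z)) • n z := by
    intro i j
    have horth := h.leviCivita.inner_secondForm (h.mapsTo hz) (h.map_smooth z hz) hdet i j
    have hnorm : gramForm (G (F z)) (secondForm (fun x => gramForm (G x)) (chrisForm G) F i j z)
        (n z) = - gramForm (G (F z)) (partialDeriv j F z) (shape G F n (basisVec i) z) := by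
      have h1 := h.inner_covDeriv_field hz (basisVec i) (basisVec j)
      rw [secondForm, map_sub, sub_apply]
      refine Eq.trans ?_ h1
      change _ - _ = gramForm (G (F z))
        (covDeriv (chrisForm G) F (partialDeriv j F) (basisVec i) z) (n z)
      rw [sub_eq_self]
      simp only [map_sum, FunLike.coe_sum, Finset.sum_apply, map_smul, smul_apply]
      refine Finset.sum_eq_zero fun k _ => ?_
      rw [partialDeriv, h.normal z hz, smul_zero]
    rw [← sub_eq_zero]
    refine h.eq_zero_of_orthogonal hz hreg ?_ ?_ ?_
    · rw [map_sub, map_smul, sub_apply, smul_apply, horth, hperp,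
        smul_zero, sub_zero]
    · rw [map_sub, map_smul, sub_apply, smul_apply, horth, hperp,
        smul_zero, sub_zero]
    · rw [map_sub, map_smul, sub_apply, smul_apply, hnorm, h.unit z hz, smul_eq_mul, mul_one,
        sub_self]
  have hR := curvOp_inner_eq_crossVec h.leviCivita h.isOpen_target (h.mapsTo hz)
    (partialDeriv 0 F z) (partialDeriv 1 F z)
  simp only [h.gramInner_field_mul_area hz hreg] at hR
  have hR2 : gramForm (G (F z)) (curvOp (chrisForm G) (F z) (partialDeriv 0 F z)
      (partialDeriv 1 F z) (partialDeriv 1 F z)) (partialDeriv 0 F z) =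
      areaDet F n z ^ 2 * ambientTerm G F n z := by
    rw [hR, ambientTerm, mul_neg, Finset.mul_sum]
    congr 1
    refine Finset.sum_congr rfl fun k _ => ?_
    rw [Finset.mul_sum]
    exact Finset.sum_congr rfl fun l _ => by ring
  simp only [hpar, hR2, map_smul, smul_apply, smul_eq_mul, h.unit z hz, h.det_pullGram hz] at hG
  have hsym := h.inner_shape_comm hz (basisVec 0) (basisVec 1)
  have hA := h.area_mul_shape hz
  simp only [partialDeriv] at hG hA hsym
  rw [curvNumer]
  -- The Gauss equation is about K λ² det G, so the claim is multiplied by λ det G before the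
  -- comparison.
  refine mul_right_cancel₀ (mul_ne_zero hreg hdet0) ?_
  have hq : ambientTerm G F n z / (G (F z)).det * (G (F z)).det = ambientTerm G F n z :=
    div_mul_cancel₀ _ hdet0
  simp only [hsym] at hA hG
  linear_combination hG - hA - areaDet F n z ^ 2 * hq

end IsNormalPair

/-! ### The normal curvature at singular points -/

lemma plane_eq (X : Plane) : X = X 0 • basisVec 0 + X 1 • basisVec 1 := by
  ext k
  fin_cases k <;> simp

/-- The determinant of two plane vectors. -/
def planeDet (N X : Plane) : ℝ := N 0 * X 1 - N 1 * X 0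

/-- Cramer's rule with denominators cleared: Y in terms of N and X. -/
lemma planeDet_smul_eq (N X Y : Plane) :
    planeDet N X • Y = planeDet Y X • N + planeDet N Y • X := by
  ext k
  fin_cases k <;> simp [planeDet] <;> ring

lemma planeDet_self (X : Plane) : planeDet X X = 0 := by
  simp [planeDet, mul_comm]

lemma exists_planeDet_ne_zero {N : Plane} (hN : N ≠ 0) : ∃ X, planeDet N X ≠ 0 := by
  by_contra! hcon
  have h0 := hcon (basisVec 0)
  have h1 := hcon (basisVec 1)
  simp [planeDet] at h0 h1
  apply hN
  ext k
  fin_cases k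
  · exact h1
  · exact h0

lemma hasFDerivAt_mul_mul_zero {D : Type*} [NormedAddCommGroup D] [NormedSpace ℝ D]
    {a b c : D → ℝ} {z : D} (ha : DifferentiableAt ℝ a z) (hb : DifferentiableAt ℝ b z)
    (hc : DifferentiableAt ℝ c z) (ha0 : a z = 0) (hb0 : b z = 0) :
    HasFDerivAt (fun w => a w * b w * c w) (0 : D →L[ℝ] ℝ) z := by
  exact ((ha.hasFDerivAt.fun_mul hb.hasFDerivAt).fun_mul hc.hasFDerivAt).congr_fderiv
    (by simp [ha0, hb0])

namespace IsNormalPair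

variable {s : Set Space} {G : Space → Matrix (Fin 3) (Fin 3) ℝ} {Ω : Set Plane}
  {F n : Plane → Space} {z : Plane}

/-- As n is a unit vector orthogonal to the image of dF, pairing with n shows that a linear relation
between F_u, F_v, n cannot involve n. -/
lemma areaDet_eq_zero_iff (h : IsNormalPair s G Ω F n) (hz : z ∈ Ω) :
    areaDet F n z = 0 ↔ ∃ N, N ≠ 0 ∧ fderiv ℝ F z N = 0 := by
  rw [areaDet, tripleDet_eq_zero_iff]
  constructor
  · rintro ⟨x, hx, hsum⟩
    have h2 : x 2 = 0 := by
      have h1 := congrArg (fun v => gramForm (G (F z)) v (n z)) hsum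
      simpa only [map_add, add_apply, map_smul, smul_apply, partialDeriv, h.normal z hz,
        h.unit z hz, smul_eq_mul, mul_zero, zero_add, mul_one, map_zero, zero_apply] using h1
    refine ⟨x 0 • basisVec 0 + x 1 • basisVec 1, fun h0 => hx ?_, ?_⟩
    · have e0 := congrArg (fun v : Plane => v 0) h0
      have e1 := congrArg (fun v : Plane => v 1) h0
      simp at e0 e1
      funext i
      fin_cases i
      · exact e0
      · exact e1
      · exact h2
    · rw [h2, zero_smul, add_zero] at hsum
      rw [map_add, map_smul, map_smul]
      exact hsum
  · rintro ⟨N, hN, hFN⟩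
    refine ⟨![N 0, N 1, 0], fun h0 => hN ?_, ?_⟩
    · ext k
      fin_cases k
      · exact congrFun h0 0
      · exact congrFun h0 1
    · rw [plane_eq N, map_add, map_smul, map_smul] at hFN
      simpa [partialDeriv] using hFN

/-- Each monomial of the determinant then has two vanishing factors. Consequently dF has rank one at
a nondegenerate singular point. -/
lemma fderiv_areaDet_eq_zero (h : IsNormalPair s G Ω F n) (hz : z ∈ Ω) (h0 : fderiv ℝ F z = 0) :
    fderiv ℝ (areaDet F n) z = 0 := by
  have hF := h.map_smooth z hz
  have hn := h.field_smooth z hz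
  have hd : ∀ i k, DifferentiableAt ℝ (fun w => partialDeriv i F w k) z := fun i k =>
    ContDiffAt.smooth_differentiableAt (smooth_coord (ContDiffAt.smooth_fderiv_apply hF _) k)
  have hdn : ∀ k, DifferentiableAt ℝ (fun w => n w k) z := fun k =>
    ContDiffAt.smooth_differentiableAt (smooth_coord hn k)
  have hv : ∀ i k, partialDeriv i F z k = 0 := fun i k => by simp [partialDeriv, h0]
  have ht := fun i j k => hasFDerivAt_mul_mul_zero (hd 0 i) (hd 1 j) (hdn k) (hv 0 i) (hv 1 j)
  have : areaDet F n = fun w => _ := funext fun w => tripleDet_eq _ _ _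
  rw [this]
  refine HasFDerivAt.fderiv ?_
  exact ((((((ht 0 1 2).fun_sub (ht 0 2 1)).fun_sub (ht 1 0 2)).fun_add (ht 1 2 0)).fun_add
    (ht 2 0 1)).fun_sub (ht 2 1 0)).congr_fderiv (by simp)

lemma shape_add (X Y : Plane) :
    shape G F n (X + Y) z = shape G F n X z + shape G F n Y z := covDeriv_dir_add X Y

lemma shape_smul (c : ℝ) (X : Plane) :
    shape G F n (c • X) z = c • shape G F n X z := covDeriv_dir_smul c X

lemma tripleDet_shape (X Y : Plane) (c : Space) :
    tripleDet (shape G F n X z) (shape G F n Y z) c = planeDet X Y *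
      tripleDet (shape G F n (basisVec 0) z) (shape G F n (basisVec 1) z) c := by
  have e := fun X => congrArg (fun v => shape G F n v z) (plane_eq X)
  simp only [shape_add, shape_smul] at e
  rw [e X, e Y]
  simp only [tripleDet_eq, planeDet, PiLp.add_apply, PiLp.smul_apply, smul_eq_mul]
  ring

end IsNormalPair

/-- The ratio between `curvNumer` and the normal curvature at a singular point, computed with
a basis `N, X` of the plane. -/
def normalFactor (G : Space → Matrix (Fin 3) (Fin 3) ℝ) (F n : Plane → Space) (N X z : Plane) : ℝ :=
  - tripleDet (shape G F n N z - (gramForm (G (F z)) (fderiv ℝ F z N) (fderiv ℝ F z X) /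
      gramForm (G (F z)) (fderiv ℝ F z X) (fderiv ℝ F z X)) • shape G F n X z)
    (fderiv ℝ F z X) (n z) / planeDet N X

namespace IsNormalPair

variable {s : Set Space} {G : Space → Matrix (Fin 3) (Fin 3) ℝ} {Ω : Set Plane}
  {F n : Plane → Space} {z : Plane}

lemma inner_self_ne_zero (h : IsNormalPair s G Ω F n) (hz : z ∈ Ω) {v : Space} (hv : v ≠ 0) :
    gramForm (G (F z)) v v ≠ 0 := (h.leviCivita.pos _ (h.mapsTo hz) v hv).ne'

lemma smooth_normalFactor (h : IsNormalPair s G Ω F n) (hz : z ∈ Ω) (N : Plane) {X : Plane}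
    (hX : fderiv ℝ F z X ≠ 0) : ContDiffAt ℝ ∞ (normalFactor G F n N X) z := by
  have hB : ContDiffAt ℝ ∞ (fun w => gramForm (G (F w))) z :=
    smooth_gramForm (h.smooth_gram_comp hz)
  have hF := fun U => ContDiffAt.smooth_fderiv_apply (h.map_smooth z hz) U
  have hdiv := (smooth_bilin_apply hB (hF N) (hF X)).div (smooth_bilin_apply hB (hF X) (hF X))
    (h.inner_self_ne_zero hz hX)
  exact (smooth_tripleDet ((h.smooth_shape hz N).sub (hdiv.smul (h.smooth_shape hz X))) (hF X)
    (h.field_smooth z hz)).neg.div_const _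

/-- By symmetry of the second fundamental form ∇_Nn is orthogonal to F_X, so the Gram matrix of
∇_Nn, F_X, n is diagonal. -/
lemma tripleDet_sq_of_null (h : IsNormalPair s G Ω F n) (hz : z ∈ Ω) {N : Plane} (X : Plane)
    (hN : fderiv ℝ F z N = 0) :
    tripleDet (shape G F n N z) (fderiv ℝ F z X) (n z) ^ 2 * (G (F z)).det =
      gramForm (G (F z)) (shape G F n N z) (shape G F n N z) *
        gramForm (G (F z)) (fderiv ℝ F z X) (fderiv ℝ F z X) := by
  have h1 := tripleDet_mul_gram (G (F z)) (shape G F n N z) (fderiv ℝ F z X) (n z)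
    (shape G F n N z) (fderiv ℝ F z X) (n z)
  have h2 : gramForm (G (F z)) (fderiv ℝ F z X) (shape G F n N z) = 0 := by
    rw [h.inner_shape_comm hz, hN, map_zero, zero_apply]
  have h3 := (h.symm hz (shape G F n N z) (fderiv ℝ F z X)).trans h2
  simp only [← gramForm_apply, h2, h3, h.inner_shape_field hz, h.normal z hz, h.unit z hz] at h1
  linarith

/-- The same orthogonality leaves one product in the Gram identity. It converts the determinant in
`curvNumer` into the normal curvature in the direction X. -/
lemma tripleDet_mul_of_null (h : IsNormalPair s G Ω F n) (hz : z ∈ Ω) {N : Plane} (X : Plane)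
    (hN : fderiv ℝ F z N = 0) :
    tripleDet (shape G F n N z) (shape G F n X z) (n z) * (G (F z)).det *
      tripleDet (shape G F n N z) (fderiv ℝ F z X) (n z) =
      gramForm (G (F z)) (shape G F n N z) (shape G F n N z) *
        gramForm (G (F z)) (fderiv ℝ F z X) (shape G F n X z) := by
  have h1 := tripleDet_mul_gram (G (F z)) (shape G F n N z) (shape G F n X z) (n z)
    (shape G F n N z) (fderiv ℝ F z X) (n z)
  have h2 : gramForm (G (F z)) (fderiv ℝ F z X) (shape G F n N z) = 0 := by
    rw [h.inner_shape_comm hz, hN, map_zero, zero_apply]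
  have h3 := (h.symm hz (shape G F n N z) (fderiv ℝ F z X)).trans h2
  have h4 := h.symm hz (shape G F n X z) (fderiv ℝ F z X)
  have h5 := (h.symm hz (n z) (shape G F n N z)).trans (h.inner_shape_field hz N)
  simp only [← gramForm_apply, h3, h4, h5, h.inner_shape_field hz, h.unit z hz] at h1
  linarith

/-- At a singular point the normal curvature is a nonzero multiple of `curvNumer`. -/
theorem normalCurv_mul_normalFactor (h : IsNormalPair s G Ω F n) (hz : z ∈ Ω)
    (hsing : areaDet F n z = 0) {N X Y : Plane} (hNX : planeDet N X ≠ 0)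
    (hX : fderiv ℝ F z X ≠ 0) (hfac : normalFactor G F n N X z ≠ 0) (hY : fderiv ℝ F z Y ≠ 0) :
    normalCurv G F n Y z * normalFactor G F n N X z = curvNumer G F n z := by
  set A := fderiv ℝ F z X with hA
  have hAA := h.inner_self_ne_zero hz hX
  obtain ⟨P, hP0, hP⟩ := (h.areaDet_eq_zero_iff hz).1 hsing
  have hPX : planeDet P X ≠ 0 := by
    intro h0
    obtain ⟨Q, hQ⟩ := exists_planeDet_ne_zero hP0
    have h1 := planeDet_smul_eq P Q X
    have h2 : planeDet X Q ≠ 0 := by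
      intro h3
      rw [h3, h0, zero_smul, zero_smul, add_zero] at h1
      exact hX (by rw [hA, (smul_eq_zero.1 h1).resolve_left hQ, map_zero])
    rw [h0, zero_smul, add_zero] at h1
    have h3 := congrArg (fderiv ℝ F z) h1
    rw [map_smul, map_smul, hP, smul_zero] at h3
    exact hX ((smul_eq_zero.1 h3).resolve_left hQ)
  have hpar : ∀ U, ∃ c : ℝ, fderiv ℝ F z U = c • A := by
    intro U
    have h1 := congrArg (fderiv ℝ F z) (planeDet_smul_eq P X U)
    rw [map_add, map_smul, map_smul, map_smul, hP, smul_zero, zero_add] at h1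
    refine ⟨(planeDet P X)⁻¹ * planeDet P U, ?_⟩
    rw [mul_smul, hA, ← h1, smul_smul, inv_mul_cancel₀ hPX, one_smul]
  obtain ⟨a, ha⟩ := hpar N
  have ha' : gramForm (G (F z)) (fderiv ℝ F z N) A / gramForm (G (F z)) A A = a := by
    rw [ha, map_smul, smul_apply, smul_eq_mul, mul_div_assoc, div_self hAA, mul_one]
  -- N need not be null at z, since in the application it is null only at the centre. The null
  -- vector at z congruent to N modulo X is M; this explains the projection inside `normalFactor`.
  set M := N - a • X with hM
  have hMnull : fderiv ℝ F z M = 0 := by rw [hM, map_sub, map_smul, ha, sub_self]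
  have hMshape : shape G F n N z - a • shape G F n X z = shape G F n M z := by
    rw [hM, sub_eq_add_neg N, ← neg_smul, shape_add, shape_smul, neg_smul, ← sub_eq_add_neg]
  have hMX : planeDet M X = planeDet N X := by
    simp only [planeDet, hM, PiLp.sub_apply, PiLp.smul_apply, smul_eq_mul]; ring
  have hfacM : normalFactor G F n N X z =
      - tripleDet (shape G F n M z) A (n z) / planeDet N X := by
    rw [normalFactor, ← hA, ha', hMshape]
  have ht : tripleDet (shape G F n M z) A (n z) ≠ 0 := by
    intro h0; rw [hfacM, h0] at hfac; simp at hfac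
  have hinner : gramForm (G (F z)) A (shape G F n M z) = 0 := by
    rw [hA, h.inner_shape_comm hz, hMnull, map_zero, zero_apply]
  -- The direction Y is a multiple of X plus a null vector. Null vectors change neither F_Y nor ⟨A,
  -- ∇_Yn⟩, and the multiple cancels in the quotient.
  have hcurv : normalCurv G F n Y z =
      - gramForm (G (F z)) A (shape G F n X z) / gramForm (G (F z)) A A := by
    obtain ⟨y, hy⟩ := hpar Y
    have hy0 : y ≠ 0 := by rintro rfl; rw [zero_smul] at hy; exact hY hy
    have hd := planeDet_smul_eq M X Y
    have h1 : planeDet M X • shape G F n Y z =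
        planeDet Y X • shape G F n M z + planeDet M Y • shape G F n X z := by
      rw [← shape_smul, hd, shape_add, shape_smul, shape_smul]
    have h2 := congrArg (fun v => gramForm (G (F z)) A v) h1
    have h3 := congrArg (fderiv ℝ F z) hd
    rw [map_add, map_smul, map_smul, map_smul, hMnull, smul_zero, zero_add, hy, smul_smul] at h3
    have h4 : planeDet M X * y = planeDet M Y := by
      have := congrArg (fun v => gramForm (G (F z)) v A) h3
      simp only [map_smul, smul_apply, smul_eq_mul] at this
      exact mul_right_cancel₀ hAA this
    simp only [map_add, map_smul, smul_eq_mul, hinner, mul_zero, zero_add] at h2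
    have hMX' : planeDet M X ≠ 0 := by rwa [hMX]
    have h5 : gramForm (G (F z)) A (shape G F n Y z) =
        y * gramForm (G (F z)) A (shape G F n X z) := by
      refine mul_left_cancel₀ hMX' ?_
      rw [h2, ← h4]; ring
    rw [normalCurv, hy]
    simp only [map_smul, smul_apply, smul_eq_mul, h5]
    field_simp
  have e1 := h.tripleDet_sq_of_null hz X hMnull
  have e2 := h.tripleDet_mul_of_null hz X hMnull
  rw [tripleDet_shape, hMX] at e2
  rw [← hA] at e1 e2
  rw [curvNumer, hsing, zero_mul, add_zero, hcurv, hfacM]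
  have hdet := h.gram_det_ne_zero hz
  field_simp
  refine mul_left_cancel₀ (mul_ne_zero ht hdet) ?_
  linear_combination gramForm (G (F z)) A (shape G F n X z) * e1
    - gramForm (G (F z)) A A * e2

/-- For a null N the Christoffel term vanishes and ∇_Nn = dn(N). The squared determinant is, up to
det G, a product of two positive squared lengths. This is where the front condition enters. -/
lemma normalFactor_ne_zero (h : IsNormalPair s G Ω F n) (hz : z ∈ Ω) {N X : Plane}
    (hNX : planeDet N X ≠ 0) (hX : fderiv ℝ F z X ≠ 0) (hN : fderiv ℝ F z N = 0)
    (hn : fderiv ℝ n z N ≠ 0) : normalFactor G F n N X z ≠ 0 := by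
  have hs : shape G F n N z ≠ 0 := by
    rw [shape, covDeriv, hN, map_zero, zero_apply, add_zero]; exact hn
  have h1 := h.tripleDet_sq_of_null hz X hN
  rw [normalFactor, hN, map_zero, zero_apply, zero_div, zero_smul, sub_zero]
  refine div_ne_zero (neg_ne_zero.2 fun h0 => ?_) hNX
  rw [h0] at h1
  have := mul_ne_zero (h.inner_self_ne_zero hz hs) (h.inner_self_ne_zero hz hX)
  rw [← h1] at this
  simp at this

end IsNormalPair

/-! ### Fronts in charts -/

section Charts

set_option linter.unusedSectionVars false

variable {S : Type*} [TopologicalSpace S] [ChartedSpace (EuclideanSpace ℝ (Fin 2)) S]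
  [IsManifold (𝓡 2) ∞ S]
  {M : Type*} [TopologicalSpace M] [ChartedSpace (EuclideanSpace ℝ (Fin 3)) M]
  [IsManifold (𝓡 3) ∞ M]

lemma chart_mdifferentiable {m : ℕ} {N : Type*} [TopologicalSpace N]
    [ChartedSpace (EuclideanSpace ℝ (Fin m)) N] [IsManifold (𝓡 m) ∞ N]
    {y : OpenPartialHomeomorph N (EuclideanSpace ℝ (Fin m))}
    (hy : y ∈ IsManifold.maximalAtlas (𝓡 m) ∞ N) : y.MDifferentiable (𝓡 m) (𝓡 m) :=
  ⟨(contMDiffOn_of_mem_maximalAtlas hy).mdifferentiableOn (by simp),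
    (contMDiffOn_symm_of_mem_maximalAtlas hy).mdifferentiableOn (by simp)⟩

/-- The transition map between two charts is smooth. -/
lemma smooth_transition {m : ℕ} {N : Type*} [TopologicalSpace N]
    [ChartedSpace (EuclideanSpace ℝ (Fin m)) N] [IsManifold (𝓡 m) ∞ N]
    {y y' : OpenPartialHomeomorph N (EuclideanSpace ℝ (Fin m))}
    (hy : y ∈ IsManifold.maximalAtlas (𝓡 m) ∞ N) (hy' : y' ∈ IsManifold.maximalAtlas (𝓡 m) ∞ N)
    {x : EuclideanSpace ℝ (Fin m)} (hx : x ∈ y.target) (hx' : y.symm x ∈ y'.source) :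
    ContDiffAt ℝ ∞ (fun w => y' (y.symm w)) x :=
  ((contMDiffAt_of_mem_maximalAtlas hy' hx').comp x
    (contMDiffAt_symm_of_mem_maximalAtlas hy hx)).contDiffAt

lemma transition_fderiv_comp {m : ℕ} {N : Type*} [TopologicalSpace N]
    [ChartedSpace (EuclideanSpace ℝ (Fin m)) N] [IsManifold (𝓡 m) ∞ N]
    {y y' : OpenPartialHomeomorph N (EuclideanSpace ℝ (Fin m))}
    (hy : y ∈ IsManifold.maximalAtlas (𝓡 m) ∞ N) (hy' : y' ∈ IsManifold.maximalAtlas (𝓡 m) ∞ N)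
    {x : EuclideanSpace ℝ (Fin m)} (hx : x ∈ y.target) (hx' : y.symm x ∈ y'.source)
    (X : EuclideanSpace ℝ (Fin m)) :
    fderiv ℝ (fun w => y (y'.symm w)) (y' (y.symm x)) (fderiv ℝ (fun w => y' (y.symm w)) x X)
      = X := by
  have hx2 : y'.symm (y' (y.symm x)) = y.symm x := y'.left_inv hx'
  have h1 := (smooth_transition hy hy' hx hx').differentiableAt (by simp)
  have h2 : DifferentiableAt ℝ (fun w => y (y'.symm w)) (y' (y.symm x)) :=
    (smooth_transition hy' hy (y'.map_source hx') (by rw [hx2]; exact y.map_target hx)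
      ).differentiableAt (by simp)
  have h3 : (fun w => y (y'.symm (y' (y.symm w)))) =ᶠ[𝓝 x] fun w => w := by
    have ho : IsOpen (y.target ∩ y.symm ⁻¹' y'.source) :=
      y.symm.isOpen_inter_preimage y'.open_source
    filter_upwards [ho.mem_nhds ⟨hx, hx'⟩] with w hw
    rw [y'.left_inv hw.2, y.right_inv hw.1]
  have h4 : fderiv ℝ (fun w => y (y'.symm (y' (y.symm w)))) x =
      (fderiv ℝ (fun w => y (y'.symm w)) (y' (y.symm x))).comp
        (fderiv ℝ (fun w => y' (y.symm w)) x) :=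
    (HasFDerivAt.comp x (g := fun w => y (y'.symm w)) h2.hasFDerivAt h1.hasFDerivAt).fderiv
  rw [h3.fderiv_eq, fderiv_fun_id] at h4
  exact (DFunLike.congr_fun h4 X).symm

variable {g : RiemMetric M} {f : S → M} {y : OpenPartialHomeomorph M (EuclideanSpace ℝ (Fin 3))}
  {e : OpenPartialHomeomorph S (EuclideanSpace ℝ (Fin 2))}

lemma gramInner_eq_of_basisVec {n : ℕ} {E : Type*} [NormedAddCommGroup E] [NormedSpace ℝ E]
    (T : EuclideanSpace ℝ (Fin n) →L[ℝ] E) (B : E →L[ℝ] E →L[ℝ] ℝ) {A : Matrix (Fin n) (Fin n) ℝ}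
    (hA : ∀ i j, A i j = B (T (basisVec i)) (T (basisVec j))) (a b : EuclideanSpace ℝ (Fin n)) :
    gramInner A a b = B (T a) (T b) := by
  rw [← gramForm_apply]
  induction a using basisVec_induction with
  | zero => simp
  | add a a' h h' => simp only [map_add, add_apply, h, h']
  | smul c a h => simp only [map_smul, smul_apply, h]
  | basis i =>
  induction b using basisVec_induction with
  | zero => simp
  | add a a' h h' => simp only [map_add, h, h']
  | smul c a h => simp only [map_smul, h]
  | basis j => rw [gramForm_apply, gramInner_basisVec, hA]

lemma gramInner_chartGram (g : RiemMetric M)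
    (y : OpenPartialHomeomorph M (EuclideanSpace ℝ (Fin 3))) (x a b : Space) :
    gramInner (chartGram g y x) a b = g.inner (y.symm x)
      (mfderiv (𝓡 3) (𝓡 3) y.symm x a) (mfderiv (𝓡 3) (𝓡 3) y.symm x b) :=
  gramInner_eq_of_basisVec (E := Space) (mfderiv (𝓡 3) (𝓡 3) y.symm x) (g.inner (y.symm x))
    (fun _ _ => rfl) a b

lemma smooth_chartGram (g : RiemMetric M) (hy : y ∈ IsManifold.maximalAtlas (𝓡 3) ∞ M)
    {x : Space} (hx : x ∈ y.target) (i j : Fin 3) :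
    ContDiffAt ℝ ∞ (fun w => chartGram g y w i j) x := by
  -- The coordinate fields are images of constant sections under the tangent map of the inverse
  -- chart, hence smooth sections of TM to which the metric can be applied.
  have hsec : ∀ b : Space, ContMDiffAt (𝓡 3) (𝓡 3).tangent ∞
      (fun w => (⟨y.symm w, mfderiv (𝓡 3) (𝓡 3) y.symm w b⟩ : TangentBundle (𝓡 3) M)) x := by
    intro b
    have h1 := (contMDiffOn_symm_of_mem_maximalAtlas hy).contMDiffOn_tangentMapWithin
      (m := ∞) (by simp) y.open_target.uniqueMDiffOn
    have h2 : ContMDiffAt (𝓡 3) (𝓡 3).tangent ∞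
        (fun w : Space => (⟨w, b⟩ : TangentBundle (𝓡 3) Space)) x :=
      contMDiffAt_vectorSpace_iff_contDiffAt.2 contDiffAt_const
    have h3 : ContMDiffOn (𝓡 3) (𝓡 3).tangent ∞
        (fun w : Space => (⟨w, b⟩ : TangentBundle (𝓡 3) Space)) y.target := fun w hw =>
      (contMDiffAt_vectorSpace_iff_contDiffAt.2 contDiffAt_const).contMDiffWithinAt
    have h4 := (h1.comp h3 (fun w hw => hw)).contMDiffAt (y.open_target.mem_nhds hx)
    refine h4.congr_of_eventuallyEq ?_
    filter_upwards [y.open_target.mem_nhds hx] with w hw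
    simp only [Function.comp_apply, tangentMapWithin, mfderivWithin_of_isOpen y.open_target hw]
  have hg := (g.contMDiff (y.symm x)).comp x (contMDiffAt_symm_of_mem_maximalAtlas hy hx)
  have h := ContMDiffAt.clm_bundle_apply₂ (F₁ := Space) (F₂ := Space) (F₃ := ℝ)
    (E₃ := Bundle.Trivial M ℝ) hg (hsec (basisVec i)) (hsec (basisVec j))
  have h' := (Bundle.contMDiffAt_totalSpace.1 h).2
  exact ContMDiffAt.contDiffAt h'

lemma chartGram_isLeviCivita (g : RiemMetric M) (hy : y ∈ IsManifold.maximalAtlas (𝓡 3) ∞ M) :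
    IsLeviCivita y.target (fun x => gramForm (chartGram g y x)) (chrisForm (chartGram g y)) := by
  refine isLeviCivita_chrisForm y.open_target (fun x hx => smooth_chartGram g hy hx)
    (fun x hx i j => g.symm _ _ _) (fun x hx a ha => ?_)
  rw [gramInner_chartGram]
  refine g.pos _ _ fun h0 => ha ?_
  exact (chart_mdifferentiable hy).symm.mfderiv_injective hx (h0.trans (map_zero _).symm)

/-- Every tangent space is the model space by definition, so a vector can be moved between fibres
over points that are only propositionally equal, such as `y.symm (y x)` and `x`. -/
lemma inner_base_congr (g : RiemMetric M) {x x' : M} (h : x = x') (v w : Space) :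
    g.inner x (v : TangentSpace (𝓡 3) x) (w : TangentSpace (𝓡 3) x) =
      g.inner x' (v : TangentSpace (𝓡 3) x') (w : TangentSpace (𝓡 3) x') := by
  subst h; rfl

lemma mfderiv_symm_mfderiv (hy : y ∈ IsManifold.maximalAtlas (𝓡 3) ∞ M) {x : M}
    (hx : x ∈ y.source) (v : TangentSpace (𝓡 3) x) :
    (mfderiv (𝓡 3) (𝓡 3) y.symm (y x) (mfderiv (𝓡 3) (𝓡 3) y x v) : Space) = v :=
  DFunLike.congr_fun ((chart_mdifferentiable hy).symm_comp_deriv hx) v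

/-- The metric of `M` in a chart. -/
lemma gramForm_chartGram (g : RiemMetric M) (hy : y ∈ IsManifold.maximalAtlas (𝓡 3) ∞ M) {x : M}
    (hx : x ∈ y.source) (v w : TangentSpace (𝓡 3) x) :
    gramForm (chartGram g y (y x)) (mfderiv (𝓡 3) (𝓡 3) y x v) (mfderiv (𝓡 3) (𝓡 3) y x w) =
      g.inner x v w := by
  refine ((gramForm_apply _ _ _).trans (gramInner_chartGram g y _ _ _)).trans ?_
  have h1 := mfderiv_symm_mfderiv hy hx v
  have h2 := mfderiv_symm_mfderiv hy hx w
  refine Eq.trans ?_ (inner_base_congr g (y.left_inv hx) v w)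
  exact congrArg₂ (fun a b : Space => g.inner (y.symm (y x)) (a : TangentSpace (𝓡 3) (y.symm (y x)))
    (b : TangentSpace (𝓡 3) (y.symm (y x)))) h1 h2

lemma mdifferentiableAt_comp_symm (hf : ContMDiff (𝓡 2) (𝓡 3) ∞ f)
    (he : e ∈ IsManifold.maximalAtlas (𝓡 2) ∞ S) {z : Plane} (hz : z ∈ e.target) :
    MDifferentiableAt (𝓡 2) (𝓡 3) (f ∘ e.symm) z :=
  (hf.contMDiffAt.comp z (contMDiffAt_symm_of_mem_maximalAtlas he hz)).mdifferentiableAt (by simp)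

lemma smooth_coordMap (hf : ContMDiff (𝓡 2) (𝓡 3) ∞ f)
    (he : e ∈ IsManifold.maximalAtlas (𝓡 2) ∞ S) (hy : y ∈ IsManifold.maximalAtlas (𝓡 3) ∞ M)
    {z : Plane} (hz : z ∈ e.target) (hfz : f (e.symm z) ∈ y.source) :
    ContDiffAt ℝ ∞ (coordMap f e y) z := by
  refine ContMDiffAt.contDiffAt (ContMDiffAt.comp z (contMDiffAt_of_mem_maximalAtlas hy ?_)
    (hf.contMDiffAt.comp z (contMDiffAt_symm_of_mem_maximalAtlas he hz)))
  exact hfz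

lemma fderiv_coordMap (hf : ContMDiff (𝓡 2) (𝓡 3) ∞ f)
    (he : e ∈ IsManifold.maximalAtlas (𝓡 2) ∞ S) (hy : y ∈ IsManifold.maximalAtlas (𝓡 3) ∞ M)
    {z : Plane} (hz : z ∈ e.target) (hfz : f (e.symm z) ∈ y.source) (X : Plane) :
    fderiv ℝ (coordMap f e y) z X =
      mfderiv (𝓡 3) (𝓡 3) y (f (e.symm z)) (mfderiv (𝓡 2) (𝓡 3) (f ∘ e.symm) z X) := by
  have h := mfderiv_comp z ((chart_mdifferentiable hy).mdifferentiableAt hfz)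
    (mdifferentiableAt_comp_symm hf he hz)
  rw [mfderiv_eq_fderiv] at h
  exact DFunLike.congr_fun h X

lemma fderiv_coordMap_eq_zero_iff (hf : ContMDiff (𝓡 2) (𝓡 3) ∞ f)
    (he : e ∈ IsManifold.maximalAtlas (𝓡 2) ∞ S) (hy : y ∈ IsManifold.maximalAtlas (𝓡 3) ∞ M)
    {z : Plane} (hz : z ∈ e.target) (hfz : f (e.symm z) ∈ y.source) (X : Plane) :
    fderiv ℝ (coordMap f e y) z X = 0 ↔ mfderiv (𝓡 2) (𝓡 3) (f ∘ e.symm) z X = 0 := by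
  rw [fderiv_coordMap hf he hy hz hfz]
  constructor
  · intro h
    exact (chart_mdifferentiable hy).mfderiv_injective hfz (h.trans (map_zero _).symm)
  · intro h
    rw [h]; exact map_zero _

/-- The first fundamental form in a chart of the target. -/
lemma firstForm_eq_pullGram (hf : ContMDiff (𝓡 2) (𝓡 3) ∞ f)
    (he : e ∈ IsManifold.maximalAtlas (𝓡 2) ∞ S) (hy : y ∈ IsManifold.maximalAtlas (𝓡 3) ∞ M)
    {z : Plane} (hz : z ∈ e.target) (hfz : f (e.symm z) ∈ y.source) :
    firstForm g f e z = pullGram (fun x => gramForm (chartGram g y x)) (coordMap f e y) z := by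
  ext i j
  simp only [firstForm, pullGram, Matrix.of_apply, partialDeriv, fderiv_coordMap hf he hy hz hfz]
  exact (gramForm_chartGram g hy hfz _ _).symm

lemma mfderiv_comp_symm (hf : ContMDiff (𝓡 2) (𝓡 3) ∞ f)
    (he : e ∈ IsManifold.maximalAtlas (𝓡 2) ∞ S) {z : Plane} (hz : z ∈ e.target) (X : Plane) :
    mfderiv (𝓡 2) (𝓡 3) (f ∘ e.symm) z X =
      mfderiv (𝓡 2) (𝓡 3) f (e.symm z) (mfderiv (𝓡 2) (𝓡 2) e.symm z X) := by
  have h := mfderiv_comp z ((hf (e.symm z)).mdifferentiableAt (by simp))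
    ((chart_mdifferentiable he).mdifferentiableAt_symm hz)
  exact DFunLike.congr_fun h X

lemma isSingularPt_iff (hf : ContMDiff (𝓡 2) (𝓡 3) ∞ f)
    (he : e ∈ IsManifold.maximalAtlas (𝓡 2) ∞ S) (hy : y ∈ IsManifold.maximalAtlas (𝓡 3) ∞ M)
    {z : Plane} (hz : z ∈ e.target) (hfz : f (e.symm z) ∈ y.source) :
    IsSingularPt f (e.symm z) ↔ ∃ N, N ≠ 0 ∧ fderiv ℝ (coordMap f e y) z N = 0 := by
  simp only [fderiv_coordMap_eq_zero_iff hf he hy hz hfz, mfderiv_comp_symm hf he hz]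
  have hinj := (chart_mdifferentiable he).symm.mfderiv_injective hz
  have hsurj := (chart_mdifferentiable he).symm.mfderiv_surjective hz
  rw [IsSingularPt, injective_iff_map_eq_zero]
  push Not
  constructor
  · rintro ⟨v, hv, hv0⟩
    obtain ⟨N, rfl⟩ := hsurj v
    exact ⟨N, fun h => hv0 (by rw [h]; exact map_zero _), hv⟩
  · rintro ⟨N, hN, h⟩
    exact ⟨_, h, fun h0 => hN (hinj (h0.trans (map_zero _).symm))⟩

variable {ν : ∀ q : S, TangentSpace (𝓡 3) (f q)} {U : Set S}

lemma smooth_coordField (hν : IsUnitNormalOn g f ν U) (hU : IsOpen U)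
    (he : e ∈ IsManifold.maximalAtlas (𝓡 2) ∞ S) (hy : y ∈ IsManifold.maximalAtlas (𝓡 3) ∞ M)
    {z : Plane} (hz : z ∈ e.target) (hzU : e.symm z ∈ U) (hfz : f (e.symm z) ∈ y.source) :
    ContDiffAt ℝ ∞ (coordField f ν e y) z := by
  have h1 := (contMDiffOn_of_mem_maximalAtlas hy).contMDiffOn_tangentMapWithin
      (m := ∞) (by simp) y.open_source.uniqueMDiffOn
  have h2 : ContMDiffAt (𝓡 2) (𝓡 3).tangent ∞ (fun w => liftTM f ν (e.symm w)) z :=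
    (hν.smooth.contMDiffAt (hU.mem_nhds hzU)).comp z (contMDiffAt_symm_of_mem_maximalAtlas he hz)
  have hopen : IsOpen ((Bundle.TotalSpace.proj : TangentBundle (𝓡 3) M → M) ⁻¹' y.source) :=
    y.open_source.preimage (FiberBundle.continuous_proj _ _)
  have h3 := (h1.contMDiffAt (hopen.mem_nhds (x := liftTM f ν (e.symm z)) hfz)).comp z h2
  have h4 := ((contMDiff_snd_tangentBundle_modelSpace Space (𝓡 3)).contMDiffAt).comp z h3
  refine (ContMDiffAt.contDiffAt h4).congr_of_eventuallyEq ?_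
  have hc : ContinuousAt (fun w => liftTM f ν (e.symm w)) z := h2.continuousAt
  filter_upwards [hc.preimage_mem_nhds (hopen.mem_nhds hfz)] with w hw
  have hw' : f (e.symm w) ∈ y.source := hw
  have h := mfderivWithin_of_isOpen (I := 𝓡 3) (I' := 𝓡 3) (f := y) y.open_source hw'
  exact (DFunLike.congr_fun h (ν (e.symm w))).symm

lemma isOpen_coordDomain (hf : ContMDiff (𝓡 2) (𝓡 3) ∞ f) (hU : IsOpen U) :
    IsOpen {z : Plane | z ∈ e.target ∧ e.symm z ∈ U ∧ f (e.symm z) ∈ y.source} := by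
  have h := e.symm.isOpen_inter_preimage (hU.inter (y.open_source.preimage hf.continuous))
  exact h

/-- In charts, `f` and its unit normal field form a normal pair. -/
lemma isNormalPair_coord (hf : ContMDiff (𝓡 2) (𝓡 3) ∞ f) (hν : IsUnitNormalOn g f ν U)
    (hU : IsOpen U)
    (he : e ∈ IsManifold.maximalAtlas (𝓡 2) ∞ S) (hy : y ∈ IsManifold.maximalAtlas (𝓡 3) ∞ M) :
    IsNormalPair y.target (chartGram g y)
      {z : Plane | z ∈ e.target ∧ e.symm z ∈ U ∧ f (e.symm z) ∈ y.source}
      (coordMap f e y) (coordField f ν e y) where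
  isOpen_target := y.open_target
  gram_smooth x hx := smooth_chartGram g hy hx
  leviCivita := chartGram_isLeviCivita g hy
  isOpen_source := isOpen_coordDomain hf hU
  map_smooth z hz := smooth_coordMap hf he hy hz.1 hz.2.2
  field_smooth z hz := smooth_coordField hν hU he hy hz.1 hz.2.1 hz.2.2
  mapsTo z hz := y.map_source hz.2.2
  unit z hz := (gramForm_chartGram g hy hz.2.2 _ _).trans (hν.unit _ hz.2.1)
  normal z hz X := by
    rw [fderiv_coordMap hf he hy hz.1 hz.2.2]
    refine (gramForm_chartGram g hy hz.2.2 _ _).trans ?_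
    rw [mfderiv_comp_symm hf he hz.1]
    exact hν.normal _ hz.2.1 _

end Charts

/-! ### Changes of coordinates -/

section Reparametrization

variable {s s' : Set Space} {G G' : Space → Matrix (Fin 3) (Fin 3) ℝ} {Ω Ω' : Set Plane}
  {F n F' n' : Plane → Space} {z : Plane}

lemma covDeriv_congr' {D E : Type*} [NormedAddCommGroup D] [NormedSpace ℝ D]
    [NormedAddCommGroup E] [NormedSpace ℝ E] {Γ : E → E →L[ℝ] E →L[ℝ] E} {F F' W W' : D → E} {z : D}
    (hF : F =ᶠ[𝓝 z] F') (hW : W =ᶠ[𝓝 z] W') (X : D) :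
    covDeriv Γ F W X z = covDeriv Γ F' W' X z := by
  simp only [covDeriv, hF.fderiv_eq, hW.fderiv_eq, hF.eq_of_nhds, hW.eq_of_nhds]

lemma tripleDet_map (T : Plane →L[ℝ] Space) (X Y : Plane) (c : Space) :
    tripleDet (T X) (T Y) c = planeDet X Y * tripleDet (T (basisVec 0)) (T (basisVec 1)) c := by
  have e := fun X => congrArg T (plane_eq X)
  simp only [map_add, map_smul] at e
  rw [e X, e Y]
  simp only [tripleDet_eq, planeDet, PiLp.add_apply, PiLp.smul_apply, smul_eq_mul]
  ring

namespace IsNormalPair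

lemma fderiv_reparam (h : IsNormalPair s G Ω F n) {σ : Plane → Plane}
    (hσ : DifferentiableAt ℝ σ z) (hz : σ z ∈ Ω) (hF : F' =ᶠ[𝓝 z] fun w => F (σ w)) (X : Plane) :
    fderiv ℝ F' z X = fderiv ℝ F (σ z) (fderiv ℝ σ z X) := by
  rw [hF.fderiv_eq]
  exact DFunLike.congr_fun (HasFDerivAt.comp z
    (ContDiffAt.smooth_differentiableAt (h.map_smooth _ hz)).hasFDerivAt hσ.hasFDerivAt).fderiv X

lemma shape_reparam (h : IsNormalPair s G Ω F n) {σ : Plane → Plane}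
    (hσ : DifferentiableAt ℝ σ z) (hz : σ z ∈ Ω) (hF : F' =ᶠ[𝓝 z] fun w => F (σ w))
    (hn : n' =ᶠ[𝓝 z] fun w => n (σ w)) (X : Plane) :
    shape G F' n' X z = shape G F n (fderiv ℝ σ z X) (σ z) := by
  rw [shape, covDeriv_congr' hF hn,
    covDeriv_comp (ContDiffAt.smooth_differentiableAt (h.map_smooth _ hz))
    (ContDiffAt.smooth_differentiableAt (h.field_smooth _ hz)) hσ, shape]

lemma areaDet_reparam (h : IsNormalPair s G Ω F n) {σ : Plane → Plane}
    (hσ : DifferentiableAt ℝ σ z) (hz : σ z ∈ Ω) (hF : F' =ᶠ[𝓝 z] fun w => F (σ w))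
    (hn : n' =ᶠ[𝓝 z] fun w => n (σ w)) :
    areaDet F' n' z = planeDet (fderiv ℝ σ z (basisVec 0)) (fderiv ℝ σ z (basisVec 1)) *
      areaDet F n (σ z) := by
  simp only [areaDet, partialDeriv, h.fderiv_reparam hσ hz hF, hn.eq_of_nhds]
  rw [tripleDet_map]

/-- It picks up the same Jacobian factor as `areaDet`, so their quotient is invariant. -/
lemma curvNumer_reparam (h : IsNormalPair s G Ω F n) {σ : Plane → Plane}
    (hσ : DifferentiableAt ℝ σ z) (hz : σ z ∈ Ω) (hF : F' =ᶠ[𝓝 z] fun w => F (σ w))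
    (hn : n' =ᶠ[𝓝 z] fun w => n (σ w)) :
    curvNumer G F' n' z = planeDet (fderiv ℝ σ z (basisVec 0)) (fderiv ℝ σ z (basisVec 1)) *
      curvNumer G F n (σ z) := by
  have ha : ambientTerm G F' n' z = ambientTerm G F n (σ z) := by
    simp only [ambientTerm, hF.eq_of_nhds, hn.eq_of_nhds]
  rw [curvNumer, h.areaDet_reparam hσ hz hF hn, ha, h.shape_reparam hσ hz hF hn,
    h.shape_reparam hσ hz hF hn, hn.eq_of_nhds, hF.eq_of_nhds, tripleDet_shape, curvNumer]
  ring

/-- Invariance comes from the quotient of two densities, which avoids the transformation law of the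
Christoffel symbols; the price is that the point must be regular. -/
lemma gaussOfGram_reparam (h : IsNormalPair s G Ω F n) (h' : IsNormalPair s G Ω' F' n')
    {σ : Plane → Plane} (hσ : DifferentiableAt ℝ σ z) (hz : σ z ∈ Ω) (hz' : z ∈ Ω')
    (hF : F' =ᶠ[𝓝 z] fun w => F (σ w)) (hn : n' =ᶠ[𝓝 z] fun w => n (σ w))
    (hreg : areaDet F' n' z ≠ 0) :
    gaussOfGram (pullGram (fun x => gramForm (G x)) F') z =
      gaussOfGram (pullGram (fun x => gramForm (G x)) F) (σ z) := by
  have h1 := h'.gaussOfGram_mul_areaDet hz' hreg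
  have hJ := h.areaDet_reparam hσ hz hF hn
  rw [hJ] at hreg
  have h2 := h.gaussOfGram_mul_areaDet hz (right_ne_zero_of_mul hreg)
  rw [h.curvNumer_reparam hσ hz hF hn, hJ, ← h2] at h1
  refine mul_right_cancel₀ hreg (h1.trans ?_)
  ring

lemma normalCurv_reparam (h : IsNormalPair s G Ω F n) {σ : Plane → Plane}
    (hσ : DifferentiableAt ℝ σ z) (hz : σ z ∈ Ω) (hF : F' =ᶠ[𝓝 z] fun w => F (σ w))
    (hn : n' =ᶠ[𝓝 z] fun w => n (σ w)) (X : Plane) :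
    normalCurv G F' n' X z = normalCurv G F n (fderiv ℝ σ z X) (σ z) := by
  simp only [normalCurv, h.fderiv_reparam hσ hz hF, h.shape_reparam hσ hz hF hn, hF.eq_of_nhds]

/-- Serves for changes of the target chart: τ is the transition map and t the overlap on which it is
defined. -/
lemma normalCurv_isometry (h : IsNormalPair s G Ω F n)
    (h' : IsLeviCivita s' (fun x => gramForm (G' x)) (chrisForm G')) {t : Set Space}
    (ht : IsOpen t) (hts : t ⊆ s) {τ : Space → Space} (hτ : ∀ x ∈ t, ContDiffAt ℝ ∞ τ x)
    (hmaps : MapsTo τ t s')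
    (hiso : ∀ x ∈ t, ∀ a b, gramForm (G' (τ x)) (fderiv ℝ τ x a) (fderiv ℝ τ x b)
      = gramForm (G x) a b)
    (hz : z ∈ Ω) (hzt : F z ∈ t) (hsurj : Function.Surjective (fderiv ℝ τ (F z)))
    (hF : F' =ᶠ[𝓝 z] fun w => τ (F w)) (hn : n' =ᶠ[𝓝 z] fun w => fderiv ℝ τ (F w) (n w))
    (X : Plane) : normalCurv G' F' n' X z = normalCurv G F n X z := by
  have hLC : IsLeviCivita t (fun x => gramForm (G x)) (chrisForm G) :=
    ⟨fun x hx => h.leviCivita.metric_smooth x (hts hx),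
      fun x hx => h.leviCivita.conn_smooth x (hts hx),
      fun x hx => h.leviCivita.symm x (hts hx), fun x hx => h.leviCivita.pos x (hts hx),
      fun x hx => h.leviCivita.torsion_free x (hts hx), fun x hx => h.leviCivita.compat x (hts hx)⟩
  have hFd := ContDiffAt.smooth_differentiableAt (h.map_smooth z hz)
  have h1 : fderiv ℝ F' z X = fderiv ℝ τ (F z) (fderiv ℝ F z X) := by
    rw [hF.fderiv_eq]
    exact DFunLike.congr_fun (HasFDerivAt.comp z
      (ContDiffAt.smooth_differentiableAt (hτ _ hzt)).hasFDerivAt hFd.hasFDerivAt).fderiv X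
  have h2 : shape G' F' n' X z = fderiv ℝ τ (F z) (shape G F n X z) := by
    rw [shape, covDeriv_congr' hF hn]
    exact hLC.covDeriv_isometry h' ht hτ hmaps hiso hzt hsurj hFd
      (ContDiffAt.smooth_differentiableAt (h.field_smooth z hz)) X
  simp only [normalCurv, h1, h2, hF.eq_of_nhds, hiso _ hzt]

end IsNormalPair

end Reparametrization

/-! ### Independence of the charts of source and target. -/

section Charts

set_option linter.unusedSectionVars false

variable {S : Type*} [TopologicalSpace S] [ChartedSpace (EuclideanSpace ℝ (Fin 2)) S]
  [IsManifold (𝓡 2) ∞ S]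
  {M : Type*} [TopologicalSpace M] [ChartedSpace (EuclideanSpace ℝ (Fin 3)) M]
  [IsManifold (𝓡 3) ∞ M]
  {g : RiemMetric M} {f : S → M} {y y' : OpenPartialHomeomorph M (EuclideanSpace ℝ (Fin 3))}
  {e e' : OpenPartialHomeomorph S (EuclideanSpace ℝ (Fin 2))}
  {ν : ∀ q : S, TangentSpace (𝓡 3) (f q)} {U : Set S}

lemma mfderiv_base_congr {F : M → Space} {x x' : M} (h : x = x') (v : Space) :
    (mfderiv (𝓡 3) (𝓡 3) F x (v : TangentSpace (𝓡 3) x) : Space) =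
      (mfderiv (𝓡 3) (𝓡 3) F x' (v : TangentSpace (𝓡 3) x') : Space) := by
  subst h; rfl

lemma fderiv_transition_mfderiv (hy : y ∈ IsManifold.maximalAtlas (𝓡 3) ∞ M)
    (hy' : y' ∈ IsManifold.maximalAtlas (𝓡 3) ∞ M) {x : M} (hx : x ∈ y.source)
    (hx' : x ∈ y'.source) (v : TangentSpace (𝓡 3) x) :
    fderiv ℝ (fun w => y' (y.symm w)) (y x) (mfderiv (𝓡 3) (𝓡 3) y x v) =
      mfderiv (𝓡 3) (𝓡 3) y' x v := by
  have hx2 : y.symm (y x) ∈ y'.source := by rwa [y.left_inv hx]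
  have h := mfderiv_comp (y x) ((chart_mdifferentiable hy').mdifferentiableAt hx2)
    ((chart_mdifferentiable hy).mdifferentiableAt_symm (y.map_source hx))
  rw [mfderiv_eq_fderiv] at h
  refine (DFunLike.congr_fun h _).trans ?_
  refine Eq.trans ?_ (mfderiv_base_congr (F := y') (y.left_inv hx) v)
  exact congrArg (fun a : Space => (mfderiv (𝓡 3) (𝓡 3) y' (y.symm (y x))
    (a : TangentSpace (𝓡 3) (y.symm (y x))) : Space)) (mfderiv_symm_mfderiv hy hx v)

lemma gramForm_chartGram_transition (g : RiemMetric M)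
    (hy : y ∈ IsManifold.maximalAtlas (𝓡 3) ∞ M)
    (hy' : y' ∈ IsManifold.maximalAtlas (𝓡 3) ∞ M) {x : Space} (hx : x ∈ y.target)
    (hx' : y.symm x ∈ y'.source) (a b : Space) :
    gramForm (chartGram g y' (y' (y.symm x))) (fderiv ℝ (fun w => y' (y.symm w)) x a)
      (fderiv ℝ (fun w => y' (y.symm w)) x b) = gramForm (chartGram g y x) a b := by
  obtain ⟨q, hq, rfl⟩ : ∃ q ∈ y.source, x = y q :=
    ⟨y.symm x, y.map_target hx, (y.right_inv hx).symm⟩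
  rw [y.left_inv hq] at hx' ⊢
  obtain ⟨v, rfl⟩ := (chart_mdifferentiable hy).mfderiv_surjective hq a
  obtain ⟨w, rfl⟩ := (chart_mdifferentiable hy).mfderiv_surjective hq b
  rw [gramForm_chartGram g hy hq, fderiv_transition_mfderiv hy hy' hq hx',
    fderiv_transition_mfderiv hy hy' hq hx', gramForm_chartGram g hy' hx']

lemma chart_symm_transition_eventuallyEq {q : S}
    (hq : q ∈ e.source) (hq' : q ∈ e'.source) :
    ∀ᶠ w in 𝓝 (e' q), e.symm (e (e'.symm w)) = e'.symm w := by
  have ho := e'.symm.isOpen_inter_preimage e.open_source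
  filter_upwards [ho.mem_nhds ⟨e'.map_source hq', by rwa [mem_preimage, e'.left_inv hq']⟩] with w hw
  exact e.left_inv hw.2

/-- The Gaussian curvature can be computed in any chart. -/
lemma gaussCurv_eq (hf : ContMDiff (𝓡 2) (𝓡 3) ∞ f) (hν : IsUnitNormalOn g f ν U)
    (hU : IsOpen U) (he : e ∈ IsManifold.maximalAtlas (𝓡 2) ∞ S)
    (hy : y ∈ IsManifold.maximalAtlas (𝓡 3) ∞ M) {q : S} (hq : q ∈ e.source) (hqU : q ∈ U)
    (hqy : f q ∈ y.source) (hreg : ¬ IsSingularPt f q) :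
    gaussCurv g f q = gaussOfGram (pullGram (fun x => gramForm (chartGram g y x))
      (coordMap f e y)) (e q) := by
  set e' := chartAt (EuclideanSpace ℝ (Fin 2)) q
  have hq' : q ∈ e'.source := mem_chart_source _ q
  have hea : e' ∈ IsManifold.maximalAtlas (𝓡 2) ∞ S := IsManifold.chart_mem_maximalAtlas q
  have h := isNormalPair_coord hf hν hU he hy
  have h' := isNormalPair_coord hf hν hU hea hy
  have hz' : e' q ∈ {z : Plane | z ∈ e'.target ∧ e'.symm z ∈ U ∧ f (e'.symm z) ∈ y.source} := by
    refine ⟨e'.map_source hq', ?_, ?_⟩ <;> rwa [e'.left_inv hq']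
  have hσq : e (e'.symm (e' q)) = e q := by rw [e'.left_inv hq']
  have hz : e (e'.symm (e' q)) ∈
      {z : Plane | z ∈ e.target ∧ e.symm z ∈ U ∧ f (e.symm z) ∈ y.source} := by
    rw [hσq]
    refine ⟨e.map_source hq, ?_, ?_⟩ <;> rwa [e.left_inv hq]
  have hev := chart_symm_transition_eventuallyEq hq hq'
  have hreg' : areaDet (coordMap f e' y) (coordField f ν e' y) (e' q) ≠ 0 := by
    rw [Ne, h'.areaDet_eq_zero_iff hz', ← isSingularPt_iff hf hea hy hz'.1 hz'.2.2,
      e'.left_inv hq']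
    exact hreg
  have key := h.gaussOfGram_reparam h' (σ := fun w => e (e'.symm w))
    ((smooth_transition hea he (e'.map_source hq') (by rwa [e'.left_inv hq'])).differentiableAt
      (by simp)) hz hz' (hev.mono fun w hw => by simp only [coordMap, hw])
    (hev.mono fun w hw => by simp only [coordField]; rw [hw]) hreg'
  rw [hσq] at key
  rw [← key]
  change gaussOfGram (firstForm g f e') (e' q) = _
  refine gaussOfGram_congr ?_
  filter_upwards [h'.isOpen_source.mem_nhds hz'] with w hw
  exact firstForm_eq_pullGram hf hea hy hw.1 hw.2.2

/-- The normal curvature in an admissible chart, computed in another chart. -/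
lemma normalCurvIn_eq (hf : ContMDiff (𝓡 2) (𝓡 3) ∞ f) (hν : IsUnitNormalOn g f ν U)
    (hU : IsOpen U) (he : e ∈ IsManifold.maximalAtlas (𝓡 2) ∞ S)
    (hy : y ∈ IsManifold.maximalAtlas (𝓡 3) ∞ M) {q : S} (hq : q ∈ e.source) (hqU : q ∈ U)
    (hqy : f q ∈ y.source) (hea : e' ∈ IsManifold.maximalAtlas (𝓡 2) ∞ S) (hq' : q ∈ e'.source) :
    normalCurvIn g f ν q e' = normalCurv (chartGram g y) (coordMap f e y) (coordField f ν e y)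
      (fderiv ℝ (fun w => e (e'.symm w)) (e' q) (basisVec 0)) (e q) := by
  set y' := chartAt (EuclideanSpace ℝ (Fin 3)) (f q) with hy'
  have hya : y' ∈ IsManifold.maximalAtlas (𝓡 3) ∞ M := IsManifold.chart_mem_maximalAtlas (f q)
  have hqy' : f q ∈ y'.source := mem_chart_source _ (f q)
  have hmem : ∀ (c : OpenPartialHomeomorph S (EuclideanSpace ℝ (Fin 2)))
      (d : OpenPartialHomeomorph M (EuclideanSpace ℝ (Fin 3))), q ∈ c.source → f q ∈ d.source →
      c q ∈ {z : Plane | z ∈ c.target ∧ c.symm z ∈ U ∧ f (c.symm z) ∈ d.source} := by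
    intro c d hc hd
    refine ⟨c.map_source hc, ?_, ?_⟩ <;> rwa [c.left_inv hc]
  have h := isNormalPair_coord hf hν hU he hy
  have h1 := isNormalPair_coord hf hν hU hea hy
  have h2 := isNormalPair_coord hf hν hU hea hya
  have hz2 := hmem e' y' hq' hqy'
  have hz1 := hmem e' y hq' hqy
  -- ⟨f_uu, ν⟩ = −⟨f_u, ∇_uν⟩ passes from the definition to the form that transforms well.
  have h_target_chart : normalCurvIn g f ν q e' = normalCurv (chartGram g y') (coordMap f e' y')
      (coordField f ν e' y') (basisVec 0) (e' q) := by
    have := h2.inner_covDeriv_field hz2 (basisVec 0) (basisVec 0)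
    simp only [normalCurvIn, ← hy', ← gramForm_apply, covAlong_eq_covDeriv]
    rw [normalCurv, ← this]
    rfl
  have hσq : e (e'.symm (e' q)) = e q := by rw [e'.left_inv hq']
  have hev := chart_symm_transition_eventuallyEq hq hq'
  have hz : e (e'.symm (e' q)) ∈
      {z : Plane | z ∈ e.target ∧ e.symm z ∈ U ∧ f (e.symm z) ∈ y.source} := by
    rw [hσq]; exact hmem e y hq hqy
  have h_reparam := h.normalCurv_reparam (σ := fun w => e (e'.symm w))
    (F' := coordMap f e' y) (n' := coordField f ν e' y)
    ((smooth_transition hea he (e'.map_source hq') (by rwa [e'.left_inv hq'])).differentiableAt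
      (by simp)) hz (hev.mono fun w hw => by simp only [coordMap, hw])
    (hev.mono fun w hw => by simp only [coordField]; rw [hw]) (basisVec 0)
  rw [hσq] at h_reparam
  rw [h_target_chart, ← h_reparam]
  have hFq : coordMap f e' y (e' q) = y (f q) := by rw [coordMap, e'.left_inv hq']
  have hev2 : ∀ᶠ w in 𝓝 (e' q), f (e'.symm w) ∈ y.source ∧ f (e'.symm w) ∈ y'.source := by
    filter_upwards [h1.isOpen_source.mem_nhds hz1, h2.isOpen_source.mem_nhds hz2] with w hw hw'
    exact ⟨hw.2.2, hw'.2.2⟩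
  have hinv : y.symm (y (f q)) = f q := y.left_inv hqy
  -- The source chart has been changed; what remains is the change of target chart, an isometry of
  -- coefficient metrics.
  refine h1.normalCurv_isometry (t := y.target ∩ y.symm ⁻¹' y'.source)
    (τ := fun w => y' (y.symm w)) h2.leviCivita
    (y.symm.isOpen_inter_preimage y'.open_source) inter_subset_left
    (fun x hx => smooth_transition hy hya hx.1 hx.2) (fun x hx => y'.map_source hx.2)
    (fun x hx a b => gramForm_chartGram_transition g hy hya hx.1 hx.2 a b) hz1
    ?_ ?_ ?_ ?_ (basisVec 0)
  · rw [hFq]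
    exact ⟨y.map_source hqy, by rwa [mem_preimage, hinv]⟩
  · rw [hFq]
    intro v
    obtain ⟨w, rfl⟩ := (chart_mdifferentiable hya).mfderiv_surjective hqy' v
    exact ⟨_, fderiv_transition_mfderiv hy hya hqy hqy' w⟩
  · filter_upwards [hev2] with w hw
    simp only [coordMap, y.left_inv hw.1]
  · filter_upwards [hev2] with w hw
    exact (fderiv_transition_mfderiv hy hya hw.1 hw.2 _).symm

end Charts

/-! ### The limiting normal curvature -/

section LimitingNormalCurvature

set_option linter.unusedSectionVars false

variable {S : Type*} [TopologicalSpace S] [ChartedSpace (EuclideanSpace ℝ (Fin 2)) S]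
  [IsManifold (𝓡 2) ∞ S]
  {M : Type*} [TopologicalSpace M] [ChartedSpace (EuclideanSpace ℝ (Fin 3)) M]
  [IsManifold (𝓡 3) ∞ M]
  {g : RiemMetric M} {f : S → M} {y : OpenPartialHomeomorph M (EuclideanSpace ℝ (Fin 3))}
  {e e' : OpenPartialHomeomorph S (EuclideanSpace ℝ (Fin 2))}
  {ν : ∀ q : S, TangentSpace (𝓡 3) (f q)} {U : Set S}

/-- Composing a chart with a smooth local diffeomorphism gives a chart. -/
lemma trans_mem_maximalAtlas (he : e ∈ IsManifold.maximalAtlas (𝓡 2) ∞ S)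
    {ρ : OpenPartialHomeomorph Plane Plane} (hρ : ContDiffOn ℝ ∞ ρ ρ.source)
    (hρ' : ContDiffOn ℝ ∞ ρ.symm ρ.target) :
    e.trans ρ ∈ IsManifold.maximalAtlas (𝓡 2) ∞ S := by
  refine OpenPartialHomeomorph.mem_maximalAtlas_of_contMDiffOn _ ?_ ?_
  · refine ContMDiffOn.comp (t := ρ.source) hρ.contMDiffOn
      ((contMDiffOn_of_mem_maximalAtlas he).mono ?_) ?_
    · intro x hx
      rw [OpenPartialHomeomorph.trans_source] at hx
      exact hx.1
    · intro x hx
      rw [OpenPartialHomeomorph.trans_source] at hx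
      exact hx.2
  · rw [OpenPartialHomeomorph.coe_trans_symm]
    refine ContMDiffOn.comp (t := e.target) (contMDiffOn_symm_of_mem_maximalAtlas he)
      (hρ'.contMDiffOn.mono ?_) ?_
    · intro x hx
      rw [OpenPartialHomeomorph.trans_target] at hx
      exact hx.1
    · intro x hx
      rw [OpenPartialHomeomorph.trans_target] at hx
      exact hx.2

/-- Ensures that `limNormalCurv` does not take its default value at a singular point. The preferred
chart is followed by an affine map that sends a null vector to `basisVec 1`. -/
lemma exists_isAdmissible (hf : ContMDiff (𝓡 2) (𝓡 3) ∞ f) {q : S} (hq : IsSingularPt f q) :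
    ∃ e, IsAdmissible f q e := by
  set e := chartAt (EuclideanSpace ℝ (Fin 2)) q
  have he : e ∈ IsManifold.maximalAtlas (𝓡 2) ∞ S := IsManifold.chart_mem_maximalAtlas q
  have hqe : q ∈ e.source := mem_chart_source _ q
  set y := chartAt (EuclideanSpace ℝ (Fin 3)) (f q)
  have hy : y ∈ IsManifold.maximalAtlas (𝓡 3) ∞ M := IsManifold.chart_mem_maximalAtlas (f q)
  have hqy : f q ∈ y.source := mem_chart_source _ (f q)
  have hq' : f (e.symm (e q)) ∈ y.source := by rwa [e.left_inv hqe]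
  have hs := isSingularPt_iff hf he hy (e.map_source hqe) hq'
  rw [e.left_inv hqe] at hs
  obtain ⟨N, hN, hFN⟩ := hs.1 hq
  have hb : (basisVec 1 : Plane) ≠ 0 := by
    intro h
    have := congrArg (fun v : Plane => v 1) h
    simp at this
  obtain ⟨A, hA⟩ := SeparatingDual.exists_continuousLinearEquiv_apply_eq (R := ℝ) hN hb
  set ρ : OpenPartialHomeomorph Plane Plane :=
    ((Homeomorph.addRight (-(e q))).trans A.toHomeomorph).toOpenPartialHomeomorph with hρ
  have hρ1 : ∀ w, ρ w = A (w + -(e q)) := fun w => rfl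
  have hρ2 : ∀ w, ρ.symm w = A.symm w + e q := by
    intro w
    change A.symm w + - -(e q) = _
    rw [neg_neg]
  have hmem : e.trans ρ ∈ IsManifold.maximalAtlas (𝓡 2) ∞ S := by
    refine trans_mem_maximalAtlas he ?_ ?_
    · exact (A.contDiff.comp (contDiff_id.add contDiff_const)).contDiffOn
    · have : (ρ.symm : Plane → Plane) = fun w => A.symm w + e q := funext hρ2
      rw [this]
      exact (A.symm.contDiff.add contDiff_const).contDiffOn
  have hsrc : q ∈ (e.trans ρ).source := by
    rw [OpenPartialHomeomorph.trans_source]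
    exact ⟨hqe, mem_univ _⟩
  have hval : (e.trans ρ) q = 0 := by
    change ρ (e q) = 0
    rw [hρ1, add_neg_cancel, map_zero]
  refine ⟨e.trans ρ, ⟨hmem, hsrc, hval⟩, ?_⟩
  have htgt : (0 : Plane) ∈ (e.trans ρ).target := hval ▸ (e.trans ρ).map_source hsrc
  have hfz : f ((e.trans ρ).symm 0) ∈ y.source := by
    rw [← hval, (e.trans ρ).left_inv hsrc]; exact hqy
  rw [← fderiv_coordMap_eq_zero_iff hf hmem hy htgt hfz]
  have hcomp : coordMap f (e.trans ρ) y = fun w => coordMap f e y (A.symm w + e q) := by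
    funext w
    change y (f (e.symm (ρ.symm w))) = _
    rw [hρ2]; rfl
  have h0 : A.symm 0 + e q = e q := by rw [map_zero, zero_add]
  have hd : HasFDerivAt (fun w : Plane => A.symm w + e q) (A.symm : Plane →L[ℝ] Plane) 0 :=
    A.symm.hasFDerivAt.add_const _
  have hFd : HasFDerivAt (coordMap f e y) (fderiv ℝ (coordMap f e y) (e q)) (A.symm 0 + e q) := by
    rw [h0]
    exact (ContDiffAt.smooth_differentiableAt
      (smooth_coordMap hf he hy (e.map_source hqe) hq')).hasFDerivAt
  have hc := (HasFDerivAt.comp (0 : Plane) hFd hd).fderiv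
  rw [hcomp]
  refine (DFunLike.congr_fun hc (basisVec 1)).trans ?_
  change fderiv ℝ (coordMap f e y) (e q) (A.symm (basisVec 1)) = 0
  rw [← hA, A.symm_apply_apply, hFN]

/-- At a singular point, the limiting normal curvature times a nonzero factor is `curvNumer`. -/
lemma limNormalCurv_mul_normalFactor (hf : ContMDiff (𝓡 2) (𝓡 3) ∞ f)
    (hν : IsUnitNormalOn g f ν U) (hU : IsOpen U)
    (he : e ∈ IsManifold.maximalAtlas (𝓡 2) ∞ S) (hy : y ∈ IsManifold.maximalAtlas (𝓡 3) ∞ M)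
    {q : S} (hq : q ∈ e.source) (hqU : q ∈ U) (hqy : f q ∈ y.source)
    (hsing : IsSingularPt f q) {N X : Plane} (hNX : planeDet N X ≠ 0)
    (hX : fderiv ℝ (coordMap f e y) (e q) X ≠ 0)
    (hfac : normalFactor (chartGram g y) (coordMap f e y) (coordField f ν e y) N X (e q) ≠ 0) :
    limNormalCurv g f ν q *
        normalFactor (chartGram g y) (coordMap f e y) (coordField f ν e y) N X (e q) =
      curvNumer (chartGram g y) (coordMap f e y) (coordField f ν e y) (e q) := by
  have hex := exists_isAdmissible hf hsing
  rw [limNormalCurv, dif_pos hex]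
  obtain ⟨⟨hea, hq', h0⟩, hadm⟩ := hex.choose_spec
  set e' := hex.choose
  have h := isNormalPair_coord hf hν hU he hy
  have hz : e q ∈ {z : Plane | z ∈ e.target ∧ e.symm z ∈ U ∧ f (e.symm z) ∈ y.source} := by
    refine ⟨e.map_source hq, ?_, ?_⟩ <;> rwa [e.left_inv hq]
  rw [normalCurvIn_eq hf hν hU he hy hq hqU hqy hea hq']
  have hsz : areaDet (coordMap f e y) (coordField f ν e y) (e q) = 0 := by
    rw [h.areaDet_eq_zero_iff hz, ← isSingularPt_iff hf he hy hz.1 hz.2.2, e.left_inv hq]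
    exact hsing
  refine h.normalCurv_mul_normalFactor hz hsz hNX hX hfac ?_
  set σ : Plane → Plane := fun w => e (e'.symm w) with hσ
  have htgt : e' q ∈ e'.target := e'.map_source hq'
  have hqs : e'.symm (e' q) ∈ e.source := by rwa [e'.left_inv hq']
  have hσd : DifferentiableAt ℝ σ (e' q) :=
    (smooth_transition hea he htgt hqs).differentiableAt (by simp)
  have hσq : σ (e' q) = e q := by rw [hσ]; simp only; rw [e'.left_inv hq']
  have hev := chart_symm_transition_eventuallyEq hq hq'
  have hre := fun X => h.fderiv_reparam (F' := coordMap f e' y) hσd (by rwa [hσq])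
    (hev.mono fun w hw => by simp only [coordMap, hσ, hw]) X
  rw [hσq] at hre
  have h1 : fderiv ℝ (coordMap f e y) (e q) (fderiv ℝ σ (e' q) (basisVec 1)) = 0 := by
    rw [← hre, fderiv_coordMap_eq_zero_iff hf hea hy htgt (by rwa [e'.left_inv hq']), h0]
    exact hadm
  -- If the first coordinate vector of the admissible chart were null as well, dF would vanish
  -- altogether, against `hX`.
  intro h2
  apply hX
  have hsurj : ∃ V, fderiv ℝ σ (e' q) V = X := by
    refine ⟨fderiv ℝ (fun w => e' (e.symm w)) (e q) X, ?_⟩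
    have := transition_fderiv_comp he hea (e.map_source hq) (by rwa [e.left_inv hq]) X
    rwa [e.left_inv hq] at this
  obtain ⟨V, rfl⟩ := hsurj
  rw [plane_eq V, map_add, map_smul, map_smul, map_add, map_smul, map_smul, h1]
  rw [h2, smul_zero, smul_zero, add_zero]

end LimitingNormalCurvature

/-! ### The front condition in charts. -/

section Immersion
set_option linter.unusedSectionVars false

variable {S : Type*} [TopologicalSpace S] [ChartedSpace (EuclideanSpace ℝ (Fin 2)) S]
  [IsManifold (𝓡 2) ∞ S]
  {M : Type*} [TopologicalSpace M] [ChartedSpace (EuclideanSpace ℝ (Fin 3)) M]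
  [IsManifold (𝓡 3) ∞ M]
  {g : RiemMetric M} {f : S → M}
  {ν : ∀ q : S, TangentSpace (𝓡 3) (f q)} {U : Set S}

/-- In the induced chart of TM the lift is the pair of coordinate representations, so the immersion
condition can be tested on them. -/
lemma written_liftTM {p : S} {z : Plane}
    (hfz : f ((chartAt (EuclideanSpace ℝ (Fin 2)) p).symm z) ∈
      (chartAt (EuclideanSpace ℝ (Fin 3)) (f p)).source) :
    (writtenInExtChartAt (𝓡 2) (𝓡 3).tangent p (liftTM f ν) z : Space × Space) =
      (coordMap f (chartAt (EuclideanSpace ℝ (Fin 2)) p)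
          (chartAt (EuclideanSpace ℝ (Fin 3)) (f p)) z,
        coordField f ν (chartAt (EuclideanSpace ℝ (Fin 2)) p)
          (chartAt (EuclideanSpace ℝ (Fin 3)) (f p)) z) := by
  have h1 := TangentBundle.continuousLinearMapAt_trivializationAt (I := 𝓡 3) hfz
  have h2 := DFunLike.congr_fun h1 (ν ((chartAt (EuclideanSpace ℝ (Fin 2)) p).symm z))
  have hb : f ((chartAt (EuclideanSpace ℝ (Fin 2)) p).symm z) ∈
    (trivializationAt Space (TangentSpace (𝓡 3)) (f p)).baseSet := hfz
  rw [Bundle.Trivialization.continuousLinearMapAt_apply,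
    Bundle.Trivialization.linearMapAt_apply, if_pos hb] at h2
  have h3 : ((extChartAt (𝓡 3) (f p)) : M → Space) = chartAt (EuclideanSpace ℝ (Fin 3)) (f p) := by
    simp [mfld_simps]
  rw [h3] at h2
  refine Prod.ext ?_ ?_
  · simp [writtenInExtChartAt, liftTM, coordMap]
  · refine Eq.trans ?_ h2
    simp only [writtenInExtChartAt, liftTM, TangentBundle.chartAt, mfld_simps]
    rfl

lemma mfderiv_liftTM_eq_zero (hf : ContMDiff (𝓡 2) (𝓡 3) ∞ f) {p : S} {N : Plane}
    (hν : DifferentiableAt ℝ (coordField f ν (chartAt (EuclideanSpace ℝ (Fin 2)) p)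
          (chartAt (EuclideanSpace ℝ (Fin 3)) (f p))) (chartAt (EuclideanSpace ℝ (Fin 2)) p p))
    (hFN : fderiv ℝ (coordMap f (chartAt (EuclideanSpace ℝ (Fin 2)) p)
          (chartAt (EuclideanSpace ℝ (Fin 3)) (f p)))
          (chartAt (EuclideanSpace ℝ (Fin 2)) p p) N = 0)
    (hnN : fderiv ℝ (coordField f ν (chartAt (EuclideanSpace ℝ (Fin 2)) p)
          (chartAt (EuclideanSpace ℝ (Fin 3)) (f p)))
          (chartAt (EuclideanSpace ℝ (Fin 2)) p p) N = 0) :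
    mfderiv (𝓡 2) (𝓡 3).tangent (liftTM f ν) p (N : TangentSpace (𝓡 2) p) = 0 := by
  set e := chartAt (EuclideanSpace ℝ (Fin 2)) p with he
  set y := chartAt (EuclideanSpace ℝ (Fin 3)) (f p) with hy
  have hea : e ∈ IsManifold.maximalAtlas (𝓡 2) ∞ S := IsManifold.chart_mem_maximalAtlas p
  have hya : y ∈ IsManifold.maximalAtlas (𝓡 3) ∞ M := IsManifold.chart_mem_maximalAtlas (f p)
  have hpe : p ∈ e.source := mem_chart_source _ p
  have hfp : f p ∈ y.source := mem_chart_source _ (f p)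
  have hev : (writtenInExtChartAt (𝓡 2) (𝓡 3).tangent p (liftTM f ν) : Plane → Space × Space)
      =ᶠ[𝓝 (e p)] fun z => (coordMap f e y z, coordField f ν e y z) := by
    have hc : ContinuousAt (fun z => f (e.symm z)) (e p) :=
      hf.continuous.continuousAt.comp (e.continuousAt_symm (e.map_source hpe))
    have := hc.preimage_mem_nhds (y.open_source.mem_nhds (by simpa only [e.left_inv hpe] using hfp))
    filter_upwards [this] with z hz using written_liftTM hz
  have hF : DifferentiableAt ℝ (coordMap f e y) (e p) := ContDiffAt.smooth_differentiableAt
    (smooth_coordMap hf hea hya (e.map_source hpe) (by rwa [e.left_inv hpe]))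
  have hder : fderiv ℝ (writtenInExtChartAt (𝓡 2) (𝓡 3).tangent p (liftTM f ν) :
      Plane → Space × Space) (e p) N = 0 := by
    rw [hev.fderiv_eq, (hF.hasFDerivAt.prodMk hν.hasFDerivAt).fderiv]
    exact Prod.ext hFN hnN
  by_cases hmd : MDifferentiableAt (𝓡 2) (𝓡 3).tangent (liftTM f ν) p
  · refine (DFunLike.congr_fun hmd.mfderiv N).trans ?_
    rw [ModelWithCorners.Boundaryless.range_eq_univ, fderivWithin_univ]
    exact hder
  -- Without differentiability the derivative is zero by convention, so the conclusion holds anyway.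
  · rw [mfderiv_zero_of_not_mdifferentiableAt hmd]
    rfl

end Immersion

/-! ### Uniqueness of the unit normal field up to sign. -/

namespace IsNormalPair

variable {s : Set Space} {G : Space → Matrix (Fin 3) (Fin 3) ℝ} {Ω : Set Plane}
  {F n n' : Plane → Space} {z : Plane}

/-- Near a nondegenerate point, a unit normal field is unique up to a factor. -/
lemma eventually_eq_smul (h : IsNormalPair s G Ω F n) (h' : IsNormalPair s G Ω F n')
    (hz : z ∈ Ω) (hd : fderiv ℝ (areaDet F n) z ≠ 0) :
    ∀ᶠ w in 𝓝 z, n' w = gramForm (G (F w)) (n' w) (n w) • n w := by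
  have hcont : ∀ᶠ w in 𝓝 z, w ∈ Ω ∧ fderiv ℝ (areaDet F n) w ≠ 0 :=
    (h.isOpen_source.eventually_mem hz).and
      ((ContDiffAt.smooth_fderiv (h.smooth_areaDet hz)).continuousAt.eventually_ne hd)
  filter_upwards [hcont] with w hw
  obtain ⟨hw, hdw⟩ := hw
  by_contra hne
  have hB : ContDiffAt ℝ ∞ (fun w => gramForm (G (F w))) w :=
    smooth_gramForm (h.smooth_gram_comp hw)
  have hD : ContinuousAt (fun w => n' w - gramForm (G (F w)) (n' w) (n w) • n w) w :=
    ((h'.field_smooth w hw).sub ((smooth_bilin_apply hB (h'.field_smooth w hw)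
      (h.field_smooth w hw)).smul (h.field_smooth w hw))).continuousAt
  -- The defect stays nonzero near w, but it vanishes at regular points, where the normal line is
  -- determined by dF. So λ vanishes near w, which dλ ≠ 0 forbids.
  have hzero : areaDet F n =ᶠ[𝓝 w] fun _ => 0 := by
    filter_upwards [hD.eventually_ne (sub_ne_zero.2 hne), h.isOpen_source.mem_nhds hw] with x hx hxΩ
    by_contra hreg
    refine hx (h.eq_zero_of_orthogonal hxΩ hreg ?_ ?_ ?_)
    · rw [map_sub, map_smul, sub_apply, smul_apply, h.symm hxΩ (n' x), h.symm hxΩ (n x),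
        partialDeriv, h.normal x hxΩ, h'.normal x hxΩ, smul_zero, sub_zero]
    · rw [map_sub, map_smul, sub_apply, smul_apply, h.symm hxΩ (n' x), h.symm hxΩ (n x),
        partialDeriv, h.normal x hxΩ, h'.normal x hxΩ, smul_zero, sub_zero]
    · rw [map_sub, map_smul, sub_apply, smul_apply, h.unit x hxΩ, smul_eq_mul, mul_one, sub_self]
  exact hdw (by rw [hzero.fderiv_eq, fderiv_fun_const]; rfl)

/-- Locally n' = b n with b² = 1, so db = 0. It carries the front condition, known for some local
normal field, over to the given one. -/
lemma fderiv_field_eq_zero (h : IsNormalPair s G Ω F n) (h' : IsNormalPair s G Ω F n')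
    (hz : z ∈ Ω) (hd : fderiv ℝ (areaDet F n) z ≠ 0) {N : Plane} (hN : fderiv ℝ n z N = 0) :
    fderiv ℝ n' z N = 0 := by
  set b : Plane → ℝ := fun w => gramForm (G (F w)) (n' w) (n w) with hb
  have hev : n' =ᶠ[𝓝 z] fun w => b w • n w := h.eventually_eq_smul h' hz hd
  have hbd : DifferentiableAt ℝ b z := ContDiffAt.smooth_differentiableAt
    (smooth_bilin_apply (smooth_gramForm (h.smooth_gram_comp hz)) (h'.field_smooth z hz)
      (h.field_smooth z hz))
  have hsq : (fun w => b w * b w) =ᶠ[𝓝 z] fun _ => 1 := by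
    filter_upwards [hev, h.isOpen_source.mem_nhds hz] with w hw hwΩ
    have h1 := h'.unit w hwΩ
    rw [hw] at h1
    simpa only [map_smul, smul_apply, h.unit w hwΩ, smul_eq_mul, mul_one] using h1
  have hb0 : b z ≠ 0 := fun h0 => by
    have := hsq.self_of_nhds
    simp [h0] at this
  have hdb : fderiv ℝ b z N = 0 := by
    have h1 := (hbd.hasFDerivAt.fun_mul hbd.hasFDerivAt).fderiv
    rw [hsq.fderiv_eq, fderiv_fun_const] at h1
    have h2 := DFunLike.congr_fun h1 N
    simp only [Pi.zero_apply, zero_apply, add_apply, smul_apply, smul_eq_mul] at h2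
    have h3 : b z * fderiv ℝ b z N = 0 := by linarith
    exact (mul_eq_zero.1 h3).resolve_left hb0
  have hnd := ContDiffAt.smooth_differentiableAt (h.field_smooth z hz)
  rw [hev.fderiv_eq, (hbd.hasFDerivAt.fun_smul hnd.hasFDerivAt).fderiv]
  simp [hN, hdb]

end IsNormalPair

section Nondegenerate
set_option linter.unusedSectionVars false

variable {S : Type*} [TopologicalSpace S] [ChartedSpace (EuclideanSpace ℝ (Fin 2)) S]
  [IsManifold (𝓡 2) ∞ S]
  {M : Type*} [TopologicalSpace M] [ChartedSpace (EuclideanSpace ℝ (Fin 3)) M]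
  [IsManifold (𝓡 3) ∞ M]
  {g : RiemMetric M} {f : S → M}
  {ν : ∀ q : S, TangentSpace (𝓡 3) (f q)} {U : Set S}

/-- At a nondegenerate point of a front, a null direction is not in the kernel of `dν`. -/
lemma IsFront.fderiv_coordField_ne_zero (hf : IsFront g f) (hν : IsUnitNormalOn g f ν U)
    (hU : IsOpen U) {p : S} (hp : p ∈ U)
    (hd : fderiv ℝ (areaDet (coordMap f (chartAt (EuclideanSpace ℝ (Fin 2)) p)
          (chartAt (EuclideanSpace ℝ (Fin 3)) (f p)))
        (coordField f ν (chartAt (EuclideanSpace ℝ (Fin 2)) p)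
          (chartAt (EuclideanSpace ℝ (Fin 3)) (f p)))) (chartAt (EuclideanSpace ℝ (Fin 2)) p p) ≠ 0)
    {N : Plane} (hN : N ≠ 0)
    (hFN : fderiv ℝ (coordMap f (chartAt (EuclideanSpace ℝ (Fin 2)) p)
          (chartAt (EuclideanSpace ℝ (Fin 3)) (f p)))
          (chartAt (EuclideanSpace ℝ (Fin 2)) p p) N = 0) :
    fderiv ℝ (coordField f ν (chartAt (EuclideanSpace ℝ (Fin 2)) p)
          (chartAt (EuclideanSpace ℝ (Fin 3)) (f p)))
          (chartAt (EuclideanSpace ℝ (Fin 2)) p p) N ≠ 0 := by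
  intro hnN
  obtain ⟨U', hU', hpU', ν', hν', himm⟩ := hf.2 p
  have he : chartAt (EuclideanSpace ℝ (Fin 2)) p ∈ IsManifold.maximalAtlas (𝓡 2) ∞ S :=
    IsManifold.chart_mem_maximalAtlas p
  have hy : chartAt (EuclideanSpace ℝ (Fin 3)) (f p) ∈ IsManifold.maximalAtlas (𝓡 3) ∞ M :=
    IsManifold.chart_mem_maximalAtlas (f p)
  have hsub : IsUnitNormalOn g f ν (U ∩ U') := ⟨hν.smooth.mono inter_subset_left,
    fun q hq => hν.unit q hq.1, fun q hq => hν.normal q hq.1⟩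
  have hsub' : IsUnitNormalOn g f ν' (U ∩ U') := ⟨hν'.smooth.mono inter_subset_right,
    fun q hq => hν'.unit q hq.2, fun q hq => hν'.normal q hq.2⟩
  have h := isNormalPair_coord hf.1 hsub (hU.inter hU') he hy
  have h' := isNormalPair_coord hf.1 hsub' (hU.inter hU') he hy
  have hpe := mem_chart_source (EuclideanSpace ℝ (Fin 2)) p
  have hz : chartAt (EuclideanSpace ℝ (Fin 2)) p p ∈ {z : Plane |
      z ∈ (chartAt (EuclideanSpace ℝ (Fin 2)) p).target ∧
      (chartAt (EuclideanSpace ℝ (Fin 2)) p).symm z ∈ U ∩ U' ∧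
      f ((chartAt (EuclideanSpace ℝ (Fin 2)) p).symm z) ∈
        (chartAt (EuclideanSpace ℝ (Fin 3)) (f p)).source} := by
    refine ⟨OpenPartialHomeomorph.map_source _ hpe, ?_, ?_⟩
    · rw [OpenPartialHomeomorph.left_inv _ hpe]; exact ⟨hp, hpU'⟩
    · rw [OpenPartialHomeomorph.left_inv _ hpe]; exact mem_chart_source _ _
  have h0 := h.fderiv_field_eq_zero h' hz hd hnN
  have h1 := mfderiv_liftTM_eq_zero hf.1
    (ContDiffAt.smooth_differentiableAt (h'.field_smooth _ hz)) hFN h0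
  exact hN (himm p hpU' (h1.trans (map_zero _).symm))

end Nondegenerate

/-! ### Straightening the singular curve -/

/-- Coordinates of the plane with a prescribed second coordinate. -/
lemma exists_straightening {a : Plane → ℝ} {Ω : Set Plane} {z₀ : Plane} (hΩ : IsOpen Ω)
    (hz₀ : z₀ ∈ Ω) (ha : ∀ z ∈ Ω, ContDiffAt ℝ ∞ a z) (ha₀ : a z₀ = 0) {N X : Plane}
    (hNX : planeDet N X ≠ 0) (hN : fderiv ℝ a z₀ N = 0) (hX : fderiv ℝ a z₀ X ≠ 0) :
    ∃ ρ : OpenPartialHomeomorph Plane Plane, z₀ ∈ ρ.source ∧ ρ.source ⊆ Ω ∧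
      ContDiffOn ℝ ∞ ρ ρ.source ∧ ContDiffOn ℝ ∞ ρ.symm ρ.target ∧ ρ z₀ = 0 ∧
      (∀ z ∈ ρ.source, ρ z 1 = (fderiv ℝ a z₀ X)⁻¹ * a z) ∧
      fderiv ℝ ρ.symm 0 (basisVec 0) = N ∧ fderiv ℝ ρ.symm 0 (basisVec 1) = X := by
  set c := (fderiv ℝ a z₀ X)⁻¹ with hc
  have hc0 : c ≠ 0 := inv_ne_zero hX
  -- The first coordinate is the N-coefficient in the basis N, X, the second is a rescaled so that
  -- its derivative along X is 1. Hence dr(N) and dr(X) are the standard basis vectors.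
  set r : Plane → Plane := fun z => !₂[planeDet (z - z₀) X / planeDet N X, c * a z] with hr
  have hlin : ContDiff ℝ ∞ fun z : Plane => planeDet (z - z₀) X / planeDet N X := by
    unfold planeDet
    fun_prop
  have hrs : ∀ z ∈ Ω, ContDiffAt ℝ ∞ r z := by
    intro z hz
    rw [hr, contDiffAt_euclidean]
    intro i
    fin_cases i
    · exact hlin.contDiffAt
    · exact contDiffAt_const.mul (ha z hz)
  have hrd := ContDiffAt.smooth_differentiableAt (hrs z₀ hz₀)
  have hr0 : ∀ V, fderiv ℝ r z₀ V 0 = planeDet V X / planeDet N X := by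
    intro V
    have h1 := ((EuclideanSpace.proj (0 : Fin 2) : Plane →L[ℝ] ℝ).hasFDerivAt.comp z₀
      hrd.hasFDerivAt).fderiv
    have h2 : HasFDerivAt (fun z : Plane => planeDet (z - z₀) X / planeDet N X)
        ((planeDet N X)⁻¹ • (X 1 • (EuclideanSpace.proj (0 : Fin 2) : Plane →L[ℝ] ℝ) -
          X 0 • (EuclideanSpace.proj (1 : Fin 2) : Plane →L[ℝ] ℝ))) z₀ := by
      have e : (fun z : Plane => planeDet (z - z₀) X / planeDet N X) = fun z =>
          ((planeDet N X)⁻¹ • (X 1 • (EuclideanSpace.proj (0 : Fin 2) : Plane →L[ℝ] ℝ) -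
          X 0 • (EuclideanSpace.proj (1 : Fin 2) : Plane →L[ℝ] ℝ))) z
          - planeDet z₀ X / planeDet N X := by
        funext z
        simp [planeDet]
        ring
      rw [e]
      exact (ContinuousLinearMap.hasFDerivAt _).sub_const _
    have h3 := h1.symm.trans h2.fderiv
    refine (DFunLike.congr_fun h3 V).trans ?_
    simp [planeDet]
    ring
  have hr1 : ∀ V, fderiv ℝ r z₀ V 1 = c * fderiv ℝ a z₀ V := by
    intro V
    have h1 := ((EuclideanSpace.proj (1 : Fin 2) : Plane →L[ℝ] ℝ).hasFDerivAt.comp z₀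
      hrd.hasFDerivAt).fderiv
    have h2 := ((ContDiffAt.smooth_differentiableAt (ha z₀ hz₀)).hasFDerivAt.const_mul c).fderiv
    exact DFunLike.congr_fun (h1.symm.trans h2) V
  have hrN : fderiv ℝ r z₀ N = basisVec 0 := by
    ext i
    fin_cases i
    · refine (hr0 N).trans ?_
      simp [div_self hNX]
    · refine (hr1 N).trans ?_
      simp [hN]
  have hrX : fderiv ℝ r z₀ X = basisVec 1 := by
    ext i
    fin_cases i
    · refine (hr0 X).trans ?_
      simp [planeDet_self]
    · refine (hr1 X).trans ?_
      simp [hc, inv_mul_cancel₀ hX]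
  have hinj : Function.Injective (fderiv ℝ r z₀) := by
    rw [injective_iff_map_eq_zero]
    intro V hV
    have h0 := (hr0 V).symm.trans (congrArg (fun v : Plane => v 0) hV)
    have h1 := (hr1 V).symm.trans (congrArg (fun v : Plane => v 1) hV)
    have h2 : planeDet V X = 0 := by simpa [hNX] using h0
    have h3 : fderiv ℝ a z₀ V = 0 := by simpa [hc0] using h1
    have h4 := planeDet_smul_eq N X V
    rw [h2, zero_smul, zero_add] at h4
    have h5 := congrArg (fderiv ℝ a z₀) h4
    rw [map_smul, map_smul, h3, smul_zero] at h5
    rw [(smul_eq_zero.1 h5.symm).resolve_right hX, zero_smul] at h4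
    exact (smul_eq_zero.1 h4).resolve_left hNX
  set A : Plane ≃L[ℝ] Plane :=
    (LinearEquiv.ofInjectiveEndo (fderiv ℝ r z₀ : Plane →ₗ[ℝ] Plane) hinj).toContinuousLinearEquiv
    with hA
  have hAr : (A : Plane →L[ℝ] Plane) = fderiv ℝ r z₀ := by
    ext1 V
    rfl
  have hrA : HasFDerivAt r (A : Plane →L[ℝ] Plane) z₀ := hAr ▸ hrd.hasFDerivAt
  -- Shrinking to points where dr is invertible makes the inverse smooth on its whole domain.
  have hev : ∀ᶠ z in 𝓝 z₀, z ∈ Ω ∧ fderiv ℝ r z ∈ range ((↑) : (Plane ≃L[ℝ] Plane) → _) := by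
    refine (hΩ.eventually_mem hz₀).and
      ((ContDiffAt.smooth_fderiv (hrs z₀ hz₀)).continuousAt.eventually ?_)
    rw [← hAr]
    exact A.nhds
  obtain ⟨O, hO, hOo, hzO⟩ := eventually_nhds_iff.1 hev
  set ρ₀ := (hrs z₀ hz₀).toOpenPartialHomeomorph r hrA (by simp) with hρ₀
  have hρ₀c : ∀ z, ρ₀ z = r z := fun z => rfl
  have hz₀ρ : z₀ ∈ ρ₀.source := (hrs z₀ hz₀).mem_toOpenPartialHomeomorph_source hrA (by simp)
  have hsrc : (ρ₀.restrOpen O hOo).source = ρ₀.source ∩ O := ρ₀.restrOpen_source O hOo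
  have hz : z₀ ∈ (ρ₀.restrOpen O hOo).source := hsrc ▸ ⟨hz₀ρ, hzO⟩
  have hval : ρ₀.restrOpen O hOo z₀ = 0 := by
    change r z₀ = 0
    ext i
    fin_cases i
    · simp [hr, planeDet]
    · simp [hr, ha₀]
  have hsymm : ∀ w ∈ (ρ₀.restrOpen O hOo).target, (ρ₀.restrOpen O hOo).symm w ∈ O := fun w hw =>
    (hsrc ▸ (ρ₀.restrOpen O hOo).map_target hw).2
  have h0t : (0 : Plane) ∈ (ρ₀.restrOpen O hOo).target :=
    hval ▸ (ρ₀.restrOpen O hOo).map_source hz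
  have hs0 : (ρ₀.restrOpen O hOo).symm 0 = z₀ := by
    rw [← hval, (ρ₀.restrOpen O hOo).left_inv hz]
  have hds : fderiv ℝ (ρ₀.restrOpen O hOo).symm 0 = (A.symm : Plane →L[ℝ] Plane) := by
    refine HasFDerivAt.fderiv ((ρ₀.restrOpen O hOo).hasFDerivAt_symm h0t ?_)
    rw [hs0]
    exact hrA
  refine ⟨ρ₀.restrOpen O hOo, hz, ?_, ?_, ?_, hval, ?_, ?_, ?_⟩
  · rw [hsrc]; exact fun z hz => (hO z hz.2).1
  · rw [hsrc]; exact fun z hz => (hrs z (hO z hz.2).1).contDiffWithinAt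
  · intro w hw
    obtain ⟨hwΩ, B, hB⟩ := hO _ (hsymm w hw)
    refine ((ρ₀.restrOpen O hOo).contDiffAt_symm (f₀' := B) hw ?_ (hrs _ hwΩ)).contDiffWithinAt
    rw [hB]
    exact (ContDiffAt.smooth_differentiableAt (hrs _ hwΩ)).hasFDerivAt
  · intro z _
    change r z 1 = _
    simp [hr]
  · rw [hds, ← hrN, ← hAr]
    exact A.symm_apply_apply N
  · rw [hds, ← hrX, ← hAr]
    exact A.symm_apply_apply X

/-! ### The null direction at a point of the second kind. -/

section SecondKind
set_option linter.unusedSectionVars false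

variable {S : Type*} [TopologicalSpace S] [ChartedSpace (EuclideanSpace ℝ (Fin 2)) S]
  [IsManifold (𝓡 2) ∞ S]
  {M : Type*} [TopologicalSpace M] [ChartedSpace (EuclideanSpace ℝ (Fin 3)) M]
  [IsManifold (𝓡 3) ∞ M]
  {g : RiemMetric M} {f : S → M}
  {ν : ∀ q : S, TangentSpace (𝓡 3) (f q)} {U : Set S}

/-- The two densities differ by the factor √det G, whose derivative does not contribute at a zero of
λ. -/
lemma fderiv_areaDet_ne_zero {G : Space → Matrix (Fin 3) (Fin 3) ℝ} {s : Set Space}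
    {Ω : Set Plane} {F n : Plane → Space} {z : Plane} (h : IsNormalPair s G Ω F n) (hz : z ∈ Ω)
    (h0 : areaDet F n z = 0)
    (hd : fderiv ℝ (fun w => Real.sqrt (G (F w)).det * areaDet F n w) z ≠ 0) :
    fderiv ℝ (areaDet F n) z ≠ 0 := by
  intro h1
  have h2 : DifferentiableAt ℝ (fun w => Real.sqrt (G (F w)).det) z :=
    (ContDiffAt.smooth_differentiableAt (smooth_det (h.smooth_gram_comp hz))).sqrt
      (h.gram_det_ne_zero hz)
  have h3 := (ContDiffAt.smooth_differentiableAt (h.smooth_areaDet hz)).hasFDerivAt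
  exact hd ((h2.hasFDerivAt.fun_mul h3).fderiv.trans (by simp [h0, h1]))

/-- N is the velocity of the singular curve in the chart: nonzero because the curve is regular, null
because the point is of the second kind, and killed by dλ because λ vanishes along the curve. -/
lemma IsSecondKind.exists_null_direction (hf : ContMDiff (𝓡 2) (𝓡 3) ∞ f)
    (hν : IsUnitNormalOn g f ν U) (hU : IsOpen U) {p : S} (hpU : p ∈ U)
    (hp : IsSecondKind g f ν p)
    {e : OpenPartialHomeomorph S (EuclideanSpace ℝ (Fin 2))}
    {y : OpenPartialHomeomorph M (EuclideanSpace ℝ (Fin 3))}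
    (hea : e = chartAt (EuclideanSpace ℝ (Fin 2)) p)
    (hya : y = chartAt (EuclideanSpace ℝ (Fin 3)) (f p)) :
    areaDet (coordMap f e y) (coordField f ν e y) (e p) = 0 ∧
    fderiv ℝ (areaDet (coordMap f e y) (coordField f ν e y)) (e p) ≠ 0 ∧
    ∃ N : Plane, N ≠ 0 ∧ fderiv ℝ (coordMap f e y) (e p) N = 0 ∧
      fderiv ℝ (areaDet (coordMap f e y) (coordField f ν e y)) (e p) N = 0 := by
  obtain ⟨⟨hsing, hd⟩, γ, ⟨hγ0, ε, hε, hγs, hγd, O, hO, hγO⟩, hnull⟩ := hp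
  rw [← hea, ← hya] at hd
  have he : e ∈ IsManifold.maximalAtlas (𝓡 2) ∞ S := hea ▸ IsManifold.chart_mem_maximalAtlas p
  have hy : y ∈ IsManifold.maximalAtlas (𝓡 3) ∞ M := hya ▸ IsManifold.chart_mem_maximalAtlas (f p)
  have hpe : p ∈ e.source := hea ▸ mem_chart_source _ p
  have hpy : f p ∈ y.source := hya ▸ mem_chart_source _ (f p)
  have h := isNormalPair_coord hf hν hU he hy
  have hmem : ∀ q, q ∈ e.source → q ∈ U → f q ∈ y.source →
      e q ∈ {z : Plane | z ∈ e.target ∧ e.symm z ∈ U ∧ f (e.symm z) ∈ y.source} := by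
    intro q h1 h2 h3
    exact ⟨e.map_source h1, by rwa [e.left_inv h1], by rwa [e.left_inv h1]⟩
  have hz := hmem p hpe hpU hpy
  have hsing' : ∀ q, q ∈ e.source → q ∈ U → f q ∈ y.source → IsSingularPt f q →
      areaDet (coordMap f e y) (coordField f ν e y) (e q) = 0 := by
    intro q h1 h2 h3 h4
    rw [h.areaDet_eq_zero_iff (hmem q h1 h2 h3),
      ← isSingularPt_iff hf he hy (e.map_source h1) (by rwa [e.left_inv h1]), e.left_inv h1]
    exact h4
  have ha0 := hsing' p hpe hpU hpy hsing
  refine ⟨ha0, fderiv_areaDet_ne_zero h hz ha0 hd, ?_⟩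
  have h0ε : (0 : ℝ) ∈ Ioo (-ε) ε := ⟨by linarith, hε⟩
  have hγm : MDifferentiableAt 𝓘(ℝ, ℝ) (𝓡 2) γ 0 :=
    (hγs.contMDiffAt (isOpen_Ioo.mem_nhds h0ε)).mdifferentiableAt (by simp)
  have hem : MDifferentiableAt (𝓡 2) (𝓡 2) e (γ 0) :=
    (chart_mdifferentiable he).mdifferentiableAt (by rwa [hγ0])
  have hcd : DifferentiableAt ℝ (fun t => e (γ t)) 0 :=
    (hem.comp (0 : ℝ) hγm).differentiableAt
  have hc : fderiv ℝ (fun t => e (γ t)) 0 1 =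
      mfderiv (𝓡 2) (𝓡 2) e (γ 0) (mfderiv 𝓘(ℝ, ℝ) (𝓡 2) γ 0 (1 : ℝ)) := by
    have h1 := mfderiv_comp (0 : ℝ) hem hγm
    rw [mfderiv_eq_fderiv] at h1
    exact DFunLike.congr_fun h1 (1 : ℝ)
  have hev : ∀ᶠ t in 𝓝 (0 : ℝ), γ t ∈ e.source ∧ γ t ∈ U ∧ f (γ t) ∈ y.source := by
    have := hγm.continuousAt.preimage_mem_nhds ((e.open_source.inter (hU.inter
      (y.open_source.preimage hf.continuous))).mem_nhds (by rw [hγ0]; exact ⟨hpe, hpU, hpy⟩))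
    exact this
  refine ⟨fderiv ℝ (fun t => e (γ t)) 0 1, ?_, ?_, ?_⟩
  · rw [hc]
    intro h1
    refine hγd 0 h0ε ?_
    have h2 : mfderiv 𝓘(ℝ, ℝ) (𝓡 2) γ 0 (1 : ℝ) = 0 :=
      (chart_mdifferentiable he).mfderiv_injective (by rwa [hγ0]) (h1.trans (map_zero _).symm)
    exact ContinuousLinearMap.ext_ring h2
  · have hFd : HasFDerivAt (coordMap f e y) (fderiv ℝ (coordMap f e y) (e p)) (e (γ 0)) := by
      rw [hγ0]
      exact (ContDiffAt.smooth_differentiableAt (h.map_smooth _ hz)).hasFDerivAt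
    have h1 := (hFd.comp (0 : ℝ) hcd.hasFDerivAt).fderiv
    have h2 : (coordMap f e y ∘ fun t => e (γ t)) =ᶠ[𝓝 0] fun t => y (f (γ t)) := by
      filter_upwards [hev] with t ht
      simp only [Function.comp_apply, coordMap, e.left_inv ht.1]
    rw [h2.fderiv_eq] at h1
    refine (DFunLike.congr_fun h1 1).symm.trans ?_
    have hym : MDifferentiableAt (𝓡 3) (𝓡 3) y (f (γ 0)) :=
      (chart_mdifferentiable hy).mdifferentiableAt (by rwa [hγ0])
    have hfm : MDifferentiableAt (𝓡 2) (𝓡 3) f (γ 0) := hf.mdifferentiableAt (by simp)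
    have h3 := mfderiv_comp (0 : ℝ) hym (hfm.comp (0 : ℝ) hγm)
    rw [mfderiv_eq_fderiv, mfderiv_comp (0 : ℝ) hfm hγm] at h3
    refine (DFunLike.congr_fun h3 (1 : ℝ)).trans ?_
    refine (congrArg (mfderiv (𝓡 3) (𝓡 3) y (f (γ 0))) hnull).trans (map_zero _)
  · have hFd : HasFDerivAt (areaDet (coordMap f e y) (coordField f ν e y))
        (fderiv ℝ (areaDet (coordMap f e y) (coordField f ν e y)) (e p)) (e (γ 0)) := by
      rw [hγ0]
      exact (ContDiffAt.smooth_differentiableAt (h.smooth_areaDet hz)).hasFDerivAt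
    have h1 := (hFd.comp (0 : ℝ) hcd.hasFDerivAt).fderiv
    have h2 : (areaDet (coordMap f e y) (coordField f ν e y) ∘ fun t => e (γ t)) =ᶠ[𝓝 0]
        fun _ => 0 := by
      filter_upwards [hev, isOpen_Ioo.mem_nhds h0ε] with t ht htε
      have hmem : γ t ∈ γ '' Ioo (-ε) ε := mem_image_of_mem γ htε
      rw [hγO] at hmem
      exact hsing' _ ht.1 ht.2.1 ht.2.2 hmem.2
    rw [h2.fderiv_eq, fderiv_fun_const] at h1
    exact (DFunLike.congr_fun h1 1).symm

end SecondKind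

/-! ### Adapted coordinates in which K = h/v. -/

section NormalForm
set_option linter.unusedSectionVars false

variable {S : Type*} [TopologicalSpace S] [ChartedSpace (EuclideanSpace ℝ (Fin 2)) S]
  [IsManifold (𝓡 2) ∞ S]
  {M : Type*} [TopologicalSpace M] [ChartedSpace (EuclideanSpace ℝ (Fin 3)) M]
  [IsManifold (𝓡 3) ∞ M]
  {g : RiemMetric M} {f : S → M}
  {ν : ∀ q : S, TangentSpace (𝓡 3) (f q)} {U : Set S}

/-- Adapted coordinates `(u, v)` in which the Gaussian curvature is `h / v`, with a smooth function
`h` that is a nonvanishing multiple of the limiting normal curvature on the singular set. -/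
structure IsNormalForm (g : RiemMetric M) (f : S → M) (ν : ∀ q : S, TangentSpace (𝓡 3) (f q))
    (p : S) (e : OpenPartialHomeomorph S (EuclideanSpace ℝ (Fin 2))) (h m : Plane → ℝ) : Prop where
  adapted : IsAdapted g f p e
  numer_smooth : ∀ z ∈ e.target, ContDiffAt ℝ ∞ h z
  factor_smooth : ∀ z ∈ e.target, ContDiffAt ℝ ∞ m z
  factor_ne_zero : ∀ z ∈ e.target, m z ≠ 0
  gaussCurv_mul : ∀ z ∈ e.target, z 1 ≠ 0 → gaussCurv g f (e.symm z) * z 1 = h z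
  limNormalCurv_mul : ∀ z ∈ e.target, z 1 = 0 → limNormalCurv g f ν (e.symm z) * m z = h z

/-- The new second coordinate is v = cλ, so Kv = c Kλ; the same c multiplies the factor in front of
κ_ν. -/
lemma isNormalForm_of_straightening (hf : ContMDiff (𝓡 2) (𝓡 3) ∞ f)
    (hν : IsUnitNormalOn g f ν U) (hU : IsOpen U) {p : S}
    {e : OpenPartialHomeomorph S (EuclideanSpace ℝ (Fin 2))}
    {y : OpenPartialHomeomorph M (EuclideanSpace ℝ (Fin 3))}
    (he : e ∈ IsManifold.maximalAtlas (𝓡 2) ∞ S) (hy : y ∈ IsManifold.maximalAtlas (𝓡 3) ∞ M)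
    (hpe : p ∈ e.source) {N X : Plane} (hNX : planeDet N X ≠ 0)
    (hFN : fderiv ℝ (coordMap f e y) (e p) N = 0)
    (hX1 : gramForm (chartGram g y (coordMap f e y (e p))) (fderiv ℝ (coordMap f e y) (e p) X)
      (fderiv ℝ (coordMap f e y) (e p) X) = 1)
    {ρ : OpenPartialHomeomorph Plane Plane} (hpρ : e p ∈ ρ.source)
    (hρs : ContDiffOn ℝ ∞ ρ ρ.source) (hρs' : ContDiffOn ℝ ∞ ρ.symm ρ.target) (hρ0 : ρ (e p) = 0)
    {c : ℝ} (hc : c ≠ 0)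
    (hρ1 : ∀ z ∈ ρ.source, ρ z 1 = c * areaDet (coordMap f e y) (coordField f ν e y) z)
    (hρN : fderiv ℝ ρ.symm 0 (basisVec 0) = N) (hρX : fderiv ℝ ρ.symm 0 (basisVec 1) = X)
    (hΩ : ∀ z ∈ ρ.source, e.symm z ∈ U ∧ f (e.symm z) ∈ y.source)
    (hX : ∀ z ∈ ρ.source, fderiv ℝ (coordMap f e y) z X ≠ 0)
    (hfac : ∀ z ∈ ρ.source,
      normalFactor (chartGram g y) (coordMap f e y) (coordField f ν e y) N X z ≠ 0) :
    IsNormalForm g f ν p (e.trans ρ)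
      (fun z => c * curvNumer (chartGram g y) (coordMap f e y) (coordField f ν e y) (ρ.symm z))
      (fun z => c * normalFactor (chartGram g y) (coordMap f e y) (coordField f ν e y) N X
        (ρ.symm z)) := by
  have h := isNormalPair_coord hf hν hU he hy
  have hmem : e.trans ρ ∈ IsManifold.maximalAtlas (𝓡 2) ∞ S := trans_mem_maximalAtlas he hρs hρs'
  have hpe' : p ∈ (e.trans ρ).source := by
    rw [OpenPartialHomeomorph.trans_source]; exact ⟨hpe, hpρ⟩
  have htgt : ∀ z ∈ (e.trans ρ).target, z ∈ ρ.target ∧ ρ.symm z ∈ ρ.source ∧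
      ρ.symm z ∈ e.target := by
    intro z hz
    rw [OpenPartialHomeomorph.trans_target] at hz
    exact ⟨hz.1, ρ.map_target hz.1, hz.2⟩
  have hdom : ∀ z ∈ (e.trans ρ).target, ρ.symm z ∈
      {z : Plane | z ∈ e.target ∧ e.symm z ∈ U ∧ f (e.symm z) ∈ y.source} := fun z hz =>
    ⟨(htgt z hz).2.2, hΩ _ (htgt z hz).2.1⟩
  have h1 : ∀ z ∈ (e.trans ρ).target,
      z 1 = c * areaDet (coordMap f e y) (coordField f ν e y) (ρ.symm z) := by
    intro z hz
    rw [← hρ1 _ (htgt z hz).2.1, ρ.right_inv (htgt z hz).1]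
  have hsing : ∀ z ∈ (e.trans ρ).target, IsSingularPt f (e.symm (ρ.symm z)) ↔ z 1 = 0 := by
    intro z hz
    rw [isSingularPt_iff hf he hy (hdom z hz).1 (hdom z hz).2.2,
      ← h.areaDet_eq_zero_iff (hdom z hz), h1 z hz, mul_eq_zero, or_iff_right hc]
  have hsm : ∀ z ∈ (e.trans ρ).target, ContDiffAt ℝ ∞ ρ.symm z := fun z hz =>
    hρs'.contDiffAt (ρ.open_target.mem_nhds (htgt z hz).1)
  have hval : (e.trans ρ) p = 0 := hρ0
  have h0t : (0 : Plane) ∈ (e.trans ρ).target := hval ▸ (e.trans ρ).map_source hpe'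
  have hs0 : ρ.symm 0 = e p := by rw [← hρ0, ρ.left_inv hpρ]
  have hder : ∀ V, fderiv ℝ (coordMap f (e.trans ρ) y) 0 V =
      fderiv ℝ (coordMap f e y) (e p) (fderiv ℝ ρ.symm 0 V) := by
    intro V
    have hd : HasFDerivAt (coordMap f e y) (fderiv ℝ (coordMap f e y) (e p)) (ρ.symm 0) := by
      rw [← hs0]
      exact (ContDiffAt.smooth_differentiableAt (h.map_smooth _ (hdom 0 h0t))).hasFDerivAt
    exact DFunLike.congr_fun (hd.comp (0 : Plane)
      (ContDiffAt.smooth_differentiableAt (hsm 0 h0t)).hasFDerivAt).fderiv V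
  have hf0 : f ((e.trans ρ).symm 0) ∈ y.source := (hdom 0 h0t).2.2
  refine ⟨⟨⟨hmem, hpe', hval⟩, ?_, ?_, ?_⟩, ?_, ?_, ?_, ?_, ?_⟩
  · rw [← fderiv_coordMap_eq_zero_iff hf hmem hy h0t hf0, hder, hρN, hFN]
  · intro q hq
    have h2 := hsing _ ((e.trans ρ).map_source hq)
    have h3 : e.symm (ρ.symm ((e.trans ρ) q)) = q := (e.trans ρ).left_inv hq
    rwa [h3] at h2
  · have hF0 : coordMap f (e.trans ρ) y 0 = coordMap f e y (e p) := by
      rw [← hs0]; rfl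
    rw [firstForm_eq_pullGram hf hmem hy h0t hf0, pullGram, Matrix.of_apply, partialDeriv, hder,
      hρX, hF0, hX1]
  · intro z hz
    exact contDiffAt_const.mul ((h.smooth_curvNumer (hdom z hz)).comp z (hsm z hz))
  · intro z hz
    exact contDiffAt_const.mul ((h.smooth_normalFactor (hdom z hz) N
      (hX _ (htgt z hz).2.1)).comp z (hsm z hz))
  · intro z hz
    exact mul_ne_zero hc (hfac _ (htgt z hz).2.1)
  · intro z hz hz1
    have hs : e.symm (ρ.symm z) ∈ e.source := e.map_target (hdom z hz).1
    have hreg : ¬ IsSingularPt f (e.symm (ρ.symm z)) := fun h' => hz1 ((hsing z hz).1 h')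
    change gaussCurv g f (e.symm (ρ.symm z)) * z 1 = _
    rw [gaussCurv_eq hf hν hU he hy hs (hdom z hz).2.1 (hdom z hz).2.2 hreg,
      e.right_inv (hdom z hz).1, h1 z hz, ← h.gaussOfGram_mul_areaDet (hdom z hz) ?_]
    · ring
    · intro h0
      rw [h1 z hz, h0, mul_zero] at hz1
      exact hz1 rfl
  · intro z hz hz1
    have hs : e.symm (ρ.symm z) ∈ e.source := e.map_target (hdom z hz).1
    have h2 := limNormalCurv_mul_normalFactor hf hν hU he hy hs (hdom z hz).2.1 (hdom z hz).2.2
      ((hsing z hz).2 hz1) hNX (by rw [e.right_inv (hdom z hz).1]; exact hX _ (htgt z hz).2.1)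
      (by rw [e.right_inv (hdom z hz).1]; exact hfac _ (htgt z hz).2.1)
    rw [e.right_inv (hdom z hz).1] at h2
    change limNormalCurv g f ν (e.symm (ρ.symm z)) * _ = _
    rw [← h2]
    ring

/-- Around a nondegenerate singular point of the second kind there are normal form coordinates. -/
theorem IsSecondKind.exists_isNormalForm (hf : IsFront g f) (hν : IsUnitNormalOn g f ν U)
    (hU : IsOpen U) {p : S} (hpU : p ∈ U) (hp : IsSecondKind g f ν p) :
    ∃ e h m, IsNormalForm g f ν p e h m := by
  obtain ⟨e, hea⟩ : ∃ e, e = chartAt (EuclideanSpace ℝ (Fin 2)) p := ⟨_, rfl⟩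
  obtain ⟨y, hya⟩ : ∃ y, y = chartAt (EuclideanSpace ℝ (Fin 3)) (f p) := ⟨_, rfl⟩
  have he : e ∈ IsManifold.maximalAtlas (𝓡 2) ∞ S := hea ▸ IsManifold.chart_mem_maximalAtlas p
  have hy : y ∈ IsManifold.maximalAtlas (𝓡 3) ∞ M := hya ▸ IsManifold.chart_mem_maximalAtlas (f p)
  have hpe : p ∈ e.source := hea ▸ mem_chart_source _ p
  have hpy : f p ∈ y.source := hya ▸ mem_chart_source _ (f p)
  obtain ⟨ha0, hda, N, hN0, hFN, haN⟩ := hp.exists_null_direction hf.1 hν hU hpU hea hya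
  have h := isNormalPair_coord hf.1 hν hU he hy
  have hz : e p ∈ {z : Plane | z ∈ e.target ∧ e.symm z ∈ U ∧ f (e.symm z) ∈ y.source} :=
    ⟨e.map_source hpe, by rwa [e.left_inv hpe], by rwa [e.left_inv hpe]⟩
  have hnN : fderiv ℝ (coordField f ν e y) (e p) N ≠ 0 := by
    have := hf.fderiv_coordField_ne_zero hν hU hpU (N := N)
    rw [← hea, ← hya] at this
    exact this hda hN0 hFN
  obtain ⟨X₀, hNX₀⟩ := exists_planeDet_ne_zero hN0
  have hker : ∀ {E : Type} [NormedAddCommGroup E] [NormedSpace ℝ E] (L : Plane →L[ℝ] E),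
      L N = 0 → L X₀ = 0 → L = 0 := by
    intro E _ _ L h1 h2
    ext1 Y
    have h3 := congrArg L (planeDet_smul_eq N X₀ Y)
    rw [map_add, map_smul, map_smul, map_smul, h1, h2, smul_zero, smul_zero, add_zero] at h3
    exact (smul_eq_zero.1 h3).resolve_left hNX₀
  -- Otherwise df would vanish at p, and dλ with it.
  have hFX₀ : fderiv ℝ (coordMap f e y) (e p) X₀ ≠ 0 := fun h0 =>
    hda (h.fderiv_areaDet_eq_zero hz (hker _ hFN h0))
  have haX₀ : fderiv ℝ (areaDet (coordMap f e y) (coordField f ν e y)) (e p) X₀ ≠ 0 := fun h0 =>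
    hda (hker _ haN h0)
  set b := gramForm (chartGram g y (coordMap f e y (e p))) (fderiv ℝ (coordMap f e y) (e p) X₀)
      (fderiv ℝ (coordMap f e y) (e p) X₀) with hb
  have hbpos : 0 < b := h.leviCivita.pos _ (h.mapsTo hz) _ hFX₀
  -- Normalises |f_v(p)| to 1, as adapted coordinates demand.
  set t := (Real.sqrt b)⁻¹ with ht
  have hsb : Real.sqrt b ≠ 0 := (Real.sqrt_pos.2 hbpos).ne'
  have ht0 : t ≠ 0 := inv_ne_zero hsb
  have hNX : planeDet N (t • X₀) ≠ 0 := by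
    have : planeDet N (t • X₀) = t * planeDet N X₀ := by simp [planeDet]; ring
    rw [this]; exact mul_ne_zero ht0 hNX₀
  have hFX : fderiv ℝ (coordMap f e y) (e p) (t • X₀) ≠ 0 := by
    rw [map_smul]; exact smul_ne_zero ht0 hFX₀
  have haX : fderiv ℝ (areaDet (coordMap f e y) (coordField f ν e y)) (e p) (t • X₀) ≠ 0 := by
    rw [map_smul]; exact smul_ne_zero ht0 haX₀
  have hX1 : gramForm (chartGram g y (coordMap f e y (e p)))
      (fderiv ℝ (coordMap f e y) (e p) (t • X₀))
      (fderiv ℝ (coordMap f e y) (e p) (t • X₀)) = 1 := by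
    simp only [map_smul, smul_apply, smul_eq_mul, ← hb]
    rw [ht, ← mul_assoc, ← mul_inv, Real.mul_self_sqrt hbpos.le, inv_mul_cancel₀ hbpos.ne']
  have hfac := h.normalFactor_ne_zero hz hNX hFX hFN hnN
  have hev : ∀ᶠ z in 𝓝 (e p),
      z ∈ {z : Plane | z ∈ e.target ∧ e.symm z ∈ U ∧ f (e.symm z) ∈ y.source} ∧
      fderiv ℝ (coordMap f e y) z (t • X₀) ≠ 0 ∧
      normalFactor (chartGram g y) (coordMap f e y) (coordField f ν e y) N (t • X₀) z ≠ 0 :=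
    (h.isOpen_source.eventually_mem hz).and
      (((ContDiffAt.smooth_fderiv_apply (h.map_smooth _ hz) _).continuousAt.eventually_ne hFX).and
        ((h.smooth_normalFactor hz N hFX).continuousAt.eventually_ne hfac))
  obtain ⟨O, hO, hOo, hpO⟩ := eventually_nhds_iff.1 hev
  obtain ⟨ρ, hpρ, hρO, hρs, hρs', hρ0, hρ1, hρN, hρX⟩ := exists_straightening hOo hpO
    (fun z hz => h.smooth_areaDet (hO z hz).1) ha0 hNX haN haX
  exact ⟨_, _, _, isNormalForm_of_straightening hf.1 hν hU he hy hpe hNX hFN hX1 hpρ hρs hρs' hρ0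
    (inv_ne_zero haX) hρ1 hρN hρX (fun z hz => (hO z (hρO hz)).1.2)
    (fun z hz => (hO z (hρO hz)).2.1) (fun z hz => (hO z (hρO hz)).2.2)⟩

end NormalForm

/-! ### Hadamard's lemma -/

-- Differentiation under the integral sign yields an integral of the same kind with values in linear
-- maps. The induction therefore has to range over all target spaces V.
open MeasureTheory in
lemma contDiff_integral_param_nat {E : Type} [NormedAddCommGroup E] [NormedSpace ℝ E]
    [FiniteDimensional ℝ E] (n : ℕ) : ∀ {V : Type} [NormedAddCommGroup V] [NormedSpace ℝ V]
    [CompleteSpace V] {Φ : E × ℝ → V}, ContDiff ℝ ∞ Φ →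
      ContDiff ℝ n fun z => ∫ t in (0 : ℝ)..1, Φ (z, t) := by
  induction n with
  | zero =>
    intro V _ _ _ Φ hΦ
    exact contDiff_zero.2 (intervalIntegral.continuous_parametric_intervalIntegral_of_continuous'
      (f := fun z t => Φ (z, t)) hΦ.continuous 0 1)
  | succ n ih =>
    intro V _ _ _ Φ hΦ
    have hΨ : ContDiff ℝ ∞ fun w : E × ℝ =>
        (fderiv ℝ Φ w).comp (ContinuousLinearMap.inl ℝ E ℝ) :=
      (hΦ.fderiv_right (m := ∞) (by simp)).clm_comp contDiff_const
    refine contDiff_succ_iff_hasFDerivAt.2 ⟨_, ih hΨ, fun z => ?_⟩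
    obtain ⟨C, hC⟩ := ((isCompact_closedBall z 1).prod
      (isCompact_Icc (a := (0 : ℝ)) (b := 1))).exists_bound_of_continuousOn
        hΨ.continuous.continuousOn
    have hm : ∀ x, Continuous fun t : ℝ => Φ (x, t) := fun x => by
      exact hΦ.continuous.comp (by fun_prop)
    have hm' : Continuous fun t : ℝ =>
        (fderiv ℝ Φ (z, t)).comp (ContinuousLinearMap.inl ℝ E ℝ) :=
      hΨ.continuous.comp (f := fun t : ℝ => (z, t)) (by fun_prop)
    refine intervalIntegral.hasFDerivAt_integral_of_dominated_of_fderiv_le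
      (F := fun z t => Φ (z, t))
      (F' := fun z t => (fderiv ℝ Φ (z, t)).comp (ContinuousLinearMap.inl ℝ E ℝ)) (bound := fun _ => C)
      (Metric.closedBall_mem_nhds z one_pos) (Eventually.of_forall fun x =>
        (hm x).aestronglyMeasurable) ((hm z).intervalIntegrable _ _)
      hm'.aestronglyMeasurable (Eventually.of_forall fun t ht x hx => ?_)
      intervalIntegrable_const (Eventually.of_forall fun t ht x hx => ?_)
    · refine hC (x, t) ⟨hx, ?_⟩
      rw [uIoc_of_le zero_le_one] at ht
      exact ⟨ht.1.le, ht.2⟩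
    · exact ((hΦ.differentiable (by simp)) (x, t)).hasFDerivAt.comp x (hasFDerivAt_prodMk_left x t)

lemma contDiff_integral_param {E V : Type} [NormedAddCommGroup E] [NormedSpace ℝ E]
    [FiniteDimensional ℝ E] [NormedAddCommGroup V] [NormedSpace ℝ V]
    [CompleteSpace V] {Φ : E × ℝ → V} (hΦ : ContDiff ℝ ∞ Φ) :
    ContDiff ℝ ∞ fun z => ∫ t in (0 : ℝ)..1, Φ (z, t) :=
  contDiff_infty.2 fun n => contDiff_integral_param_nat n hΦ

/-- A function that is smooth near a point agrees near it with a globally smooth function. -/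
lemma exists_contDiff_eqOn_ball {E : Type*} [NormedAddCommGroup E] [NormedSpace ℝ E]
    [FiniteDimensional ℝ E] {h : E → ℝ} {T : Set E} {z : E} (hT : T ∈ 𝓝 z)
    (hh : ∀ w ∈ T, ContDiffAt ℝ ∞ h w) :
    ∃ r > 0, Metric.ball z r ⊆ T ∧ ∃ k : E → ℝ, ContDiff ℝ ∞ k ∧ EqOn h k (Metric.ball z r) := by
  obtain ⟨R, hR, hRT⟩ := Metric.mem_nhds_iff.1 hT
  let b : ContDiffBump z := ⟨R / 4, R / 2, by linarith, by linarith⟩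
  refine ⟨R / 4, by linarith, (Metric.ball_subset_ball (by linarith)).trans hRT,
    fun w => b w * h w, ?_, ?_⟩
  · rw [contDiff_iff_contDiffAt]
    intro w
    by_cases hw : w ∈ Metric.ball z R
    · exact b.contDiffAt.mul (hh w (hRT hw))
    · have hw' : w ∈ (Metric.closedBall z (R / 2))ᶜ := fun h' =>
        hw (Metric.closedBall_subset_ball (by linarith) h')
      refine (contDiffAt_const (c := (0 : ℝ))).congr_of_eventuallyEq ?_
      filter_upwards [Metric.isClosed_closedBall.isOpen_compl.mem_nhds hw'] with x hx
      rw [b.zero_of_le_dist, zero_mul]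
      have : ¬ dist x z ≤ R / 2 := hx
      exact (not_le.1 this).le
  · intro w hw
    simp only
    rw [b.one_of_mem_closedBall (Metric.ball_subset_closedBall hw), one_mul]

/-- Hadamard's lemma in the plane. -/
lemma exists_eq_coord_mul_add {h : Plane → ℝ} {T : Set Plane} (hT : T ∈ 𝓝 0)
    (hh : ∀ w ∈ T, ContDiffAt ℝ ∞ h w) (h0 : h 0 = 0) :
    ∃ r > 0, Metric.ball 0 r ⊆ T ∧ ∃ a b : Plane → ℝ, ContDiff ℝ ∞ a ∧ ContDiff ℝ ∞ b ∧
      a 0 = fderiv ℝ h 0 (basisVec 0) ∧ b 0 = fderiv ℝ h 0 (basisVec 1) ∧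
      ∀ z ∈ Metric.ball (0 : Plane) r, h z = z 0 * a z + z 1 * b z := by
  -- Replacing h by a global function makes the integrals of its derivative over segments from the
  -- origin smooth on the whole plane.
  obtain ⟨r, hr, hrT, k, hk, hhk⟩ := exists_contDiff_eqOn_ball hT hh
  have hk' : ContDiff ℝ ∞ (fderiv ℝ k) := hk.fderiv_right (m := ∞) (by simp)
  have hΦ : ∀ v : Plane, ContDiff ℝ ∞ fun w : Plane × ℝ => fderiv ℝ k (w.2 • w.1) v := fun v =>
    (hk'.comp (contDiff_snd.smul contDiff_fst)).clm_apply contDiff_const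
  have hd : fderiv ℝ h 0 = fderiv ℝ k 0 :=
    (hhk.eventuallyEq_of_mem (Metric.ball_mem_nhds 0 hr)).fderiv_eq
  refine ⟨r, hr, hrT, fun z => ∫ t in (0 : ℝ)..1, fderiv ℝ k (t • z) (basisVec 0),
    fun z => ∫ t in (0 : ℝ)..1, fderiv ℝ k (t • z) (basisVec 1),
    contDiff_integral_param (hΦ _), contDiff_integral_param (hΦ _), ?_, ?_, fun z hz => ?_⟩
  · simp [hd]
  · simp [hd]
  · have hline : ∀ t : ℝ, HasDerivAt (fun t : ℝ => k (t • z)) (fderiv ℝ k (t • z) z) t := by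
      intro t
      have h1 : HasDerivAt (fun t : ℝ => t • z) z t := by
        simpa using (hasDerivAt_id t).smul_const z
      exact ((hk.differentiable (by simp)) (t • z)).hasFDerivAt.comp_hasDerivAt t h1
    have hcont : ∀ v : Plane, Continuous fun t : ℝ => fderiv ℝ k (t • z) v := fun v =>
      (hΦ v).continuous.comp (f := fun t : ℝ => (z, t)) (by fun_prop)
    have hint := intervalIntegral.integral_eq_sub_of_hasDerivAt (a := 0) (b := 1)
      (fun t _ => hline t) ((hcont z).intervalIntegrable _ _)
    have hk0 : k 0 = 0 := by rw [← hhk (Metric.mem_ball_self hr), h0]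
    rw [one_smul, zero_smul, hk0, sub_zero] at hint
    rw [hhk hz, ← hint, ← intervalIntegral.integral_const_mul, ← intervalIntegral.integral_const_mul,
      ← intervalIntegral.integral_add]
    · refine intervalIntegral.integral_congr fun t _ => ?_
      have h1 := congrArg (fderiv ℝ k (t • z)) (plane_eq z)
      rw [map_add, map_smul, map_smul] at h1
      exact h1
    · exact (continuous_const.mul (hcont _)).intervalIntegrable _ _
    · exact (continuous_const.mul (hcont _)).intervalIntegrable _ _

/-! ### Rational boundedness and rational continuity of h/v. -/

section Conclusion
set_option linter.unusedSectionVars false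

variable {S : Type*} [TopologicalSpace S] [ChartedSpace (EuclideanSpace ℝ (Fin 2)) S]
  [IsManifold (𝓡 2) ∞ S]
  {M : Type*} [TopologicalSpace M] [ChartedSpace (EuclideanSpace ℝ (Fin 3)) M]
  [IsManifold (𝓡 3) ∞ M]
  {g : RiemMetric M} {f : S → M}
  {ν : ∀ q : S, TangentSpace (𝓡 3) (f q)} {p : S}
  {e : OpenPartialHomeomorph S (EuclideanSpace ℝ (Fin 2))} {h m : Plane → ℝ}

namespace IsNormalForm

lemma mem_source (nf : IsNormalForm g f ν p e h m) : p ∈ e.source := nf.adapted.centered.2.1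

lemma mem_atlas (nf : IsNormalForm g f ν p e h m) : e ∈ IsManifold.maximalAtlas (𝓡 2) ∞ S :=
  nf.adapted.centered.1

lemma symm_zero (nf : IsNormalForm g f ν p e h m) : e.symm 0 = p := by
  rw [← nf.adapted.centered.2.2, e.left_inv nf.mem_source]

lemma zero_mem (nf : IsNormalForm g f ν p e h m) : (0 : Plane) ∈ e.target :=
  nf.adapted.centered.2.2 ▸ e.map_source nf.mem_source

lemma isSingularPt_symm_iff (nf : IsNormalForm g f ν p e h m) {z : Plane} (hz : z ∈ e.target) :
    IsSingularPt f (e.symm z) ↔ z 1 = 0 := by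
  rw [nf.adapted.axis _ (e.map_target hz), e.right_inv hz]

lemma limNormalCurv_eq_zero_iff (nf : IsNormalForm g f ν p e h m) {z : Plane} (hz : z ∈ e.target)
    (hz1 : z 1 = 0) : limNormalCurv g f ν (e.symm z) = 0 ↔ h z = 0 := by
  rw [← nf.limNormalCurv_mul z hz hz1, mul_eq_zero, or_iff_left (nf.factor_ne_zero z hz)]

lemma limNormalCurv_center_eq_zero_iff (nf : IsNormalForm g f ν p e h m) :
    limNormalCurv g f ν p = 0 ↔ h 0 = 0 := by
  rw [← nf.limNormalCurv_eq_zero_iff nf.zero_mem rfl, nf.symm_zero]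

/-- Restriction to an open subset of the coordinate domain. -/
lemma restrict (nf : IsNormalForm g f ν p e h m) {B : Set Plane} (hB : IsOpen B) (h0 : 0 ∈ B)
    (hBe : B ⊆ e.target) : ∃ e', IsNormalForm g f ν p e' h m ∧ e'.target = B ∧
      ∀ z, e'.symm z = e.symm z := by
  have hsrc : p ∈ (e.trans (OpenPartialHomeomorph.ofSet B hB)).source := by
    rw [OpenPartialHomeomorph.trans_source]
    refine ⟨nf.mem_source, ?_⟩
    change e p ∈ B
    rwa [nf.adapted.centered.2.2]
  have htgt : (e.trans (OpenPartialHomeomorph.ofSet B hB)).target = B := by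
    rw [OpenPartialHomeomorph.trans_target]
    exact inter_eq_left.2 hBe
  have hmem : e.trans (OpenPartialHomeomorph.ofSet B hB) ∈ IsManifold.maximalAtlas (𝓡 2) ∞ S :=
    trans_mem_maximalAtlas nf.mem_atlas contDiff_id.contDiffOn contDiff_id.contDiffOn
  refine ⟨e.trans (OpenPartialHomeomorph.ofSet B hB), ⟨⟨⟨hmem, hsrc, nf.adapted.centered.2.2⟩,
    nf.adapted.null, fun q hq => ?_, nf.adapted.unit⟩, ?_, ?_, ?_, ?_, ?_⟩, htgt, fun z => rfl⟩
  · rw [OpenPartialHomeomorph.trans_source] at hq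
    exact nf.adapted.axis q hq.1
  all_goals rw [htgt]
  · exact fun z hz => nf.numer_smooth z (hBe hz)
  · exact fun z hz => nf.factor_smooth z (hBe hz)
  · exact fun z hz => nf.factor_ne_zero z (hBe hz)
  · exact fun z hz => nf.gaussCurv_mul z (hBe hz)
  · exact fun z hz => nf.limNormalCurv_mul z (hBe hz)

lemma tendsto_add_smul (z : Plane) :
    Tendsto (fun s : ℝ => z + s • (basisVec 1 : Plane)) (𝓝[≠] 0) (𝓝 z) := by
  have hc : Continuous fun s : ℝ => z + s • (basisVec 1 : Plane) := by fun_prop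
  have := hc.tendsto 0
  rw [zero_smul, add_zero] at this
  exact this.mono_left nhdsWithin_le_nhds

lemma eventually_add_smul_one_ne_zero {z : Plane} (hz : z 1 = 0) :
    ∀ᶠ s : ℝ in 𝓝[≠] 0, (z + s • (basisVec 1 : Plane)) 1 ≠ 0 := by
  filter_upwards [self_mem_nhdsWithin] with s hs
  simpa [hz] using hs

lemma isOpen_regular (nf : IsNormalForm g f ν p e h m) : IsOpen (regularSet f ∩ e.source) := by
  have h1 : regularSet f ∩ e.source = e.source ∩ e ⁻¹' {z | z 1 ≠ 0} := by
    ext q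
    constructor
    · rintro ⟨h1, h2⟩
      exact ⟨h2, fun h3 => h1 ((nf.adapted.axis q h2).2 h3)⟩
    · rintro ⟨h1, h2⟩
      exact ⟨fun h3 => h2 ((nf.adapted.axis q h1).1 h3), h1⟩
  rw [h1]
  exact e.isOpen_inter_preimage
    (isOpen_ne_fun (EuclideanSpace.proj (1 : Fin 2) : Plane →L[ℝ] ℝ).continuous continuous_const)

lemma dense_regular (nf : IsNormalForm g f ν p e h m) :
    e.source ⊆ closure (regularSet f ∩ e.source) := by
  intro q hq
  by_cases hs : IsSingularPt f q
  · have hq1 := (nf.adapted.axis q hq).1 hs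
    have ht : Tendsto (fun s : ℝ => e.symm (e q + s • (basisVec 1 : Plane))) (𝓝[≠] 0) (𝓝 q) := by
      have := (e.continuousAt_symm (e.map_source hq)).tendsto.comp (tendsto_add_smul (e q))
      rwa [e.left_inv hq] at this
    refine mem_closure_of_tendsto ht ?_
    filter_upwards [eventually_add_smul_one_ne_zero hq1, (tendsto_add_smul (e q)).eventually
      (e.open_target.mem_nhds (e.map_source hq))] with s h1 h2
    exact ⟨fun h3 => h1 ((nf.isSingularPt_symm_iff h2).1 h3), e.map_target h2⟩
  · exact subset_closure ⟨hs, hq⟩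

lemma gaussCurv_eq_div (nf : IsNormalForm g f ν p e h m) {q : S}
    (hq : q ∈ regularSet f ∩ e.source) : gaussCurv g f q = h (e q) / e q 1 := by
  have h1 : e q 1 ≠ 0 := fun h1 => hq.1 ((nf.adapted.axis q hq.2).2 h1)
  rw [eq_div_iff h1, ← nf.gaussCurv_mul _ (e.map_source hq.2) h1, e.left_inv hq.2]

lemma smooth_gaussCurv (nf : IsNormalForm g f ν p e h m) :
    ContMDiffOn (𝓡 2) 𝓘(ℝ, ℝ) ∞ (gaussCurv g f) (regularSet f ∩ e.source) := by
  have h1 : ContMDiffOn (𝓡 2) 𝓘(ℝ, ℝ) ∞ (fun q => h (e q) / e q 1) (regularSet f ∩ e.source) := by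
    intro q hq
    have h1 : e q 1 ≠ 0 := fun h1 => hq.1 ((nf.adapted.axis q hq.2).2 h1)
    have h2 : ContDiffAt ℝ ∞ (fun z : Plane => h z / z 1) (e q) :=
      (nf.numer_smooth _ (e.map_source hq.2)).div (smooth_coord contDiffAt_id 1) h1
    exact (h2.contMDiffAt.comp q (contMDiffAt_of_mem_maximalAtlas nf.mem_atlas hq.2)
      ).contMDiffWithinAt
  exact h1.congr fun q hq => nf.gaussCurv_eq_div hq

lemma contDiff_polar : ContDiff ℝ ∞ polar := by
  rw [contDiff_euclidean]
  intro i
  fin_cases i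
  · exact contDiff_fst.mul (Real.contDiff_cos.comp contDiff_snd)
  · exact contDiff_fst.mul (Real.contDiff_sin.comp contDiff_snd)

lemma polar_neg (r θ : ℝ) : polar (-r, θ + Real.pi) = polar (r, θ) := by
  simp [polar, Real.cos_add_pi, Real.sin_add_pi]

lemma polar_zero (θ : ℝ) : polar (0, θ) = 0 := by
  ext i
  fin_cases i <;> simp [polar]

lemma polar_eq_smul (r θ : ℝ) : polar (r, θ) = r • !₂[Real.cos θ, Real.sin θ] := by
  ext i
  fin_cases i <;> simp [polar]

/-- If the limiting normal curvature vanishes at `p`, the curvature is rationally bounded, with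
explicit functions on the blow-up. -/
lemma exists_isRationalWitness (nf : IsNormalForm g f ν p e h m) (h0 : h 0 = 0) :
    ∃ e' lam psi, IsRationalWitness (regularSet f ∩ e'.source) (gaussCurv g f) p e' lam psi ∧
      ∀ θ, lam (0, θ) = Real.sin θ ^ 2 ∧ psi (0, θ) = Real.sin θ *
        (Real.cos θ * fderiv ℝ h 0 (basisVec 0) + Real.sin θ * fderiv ℝ h 0 (basisVec 1)) := by
  obtain ⟨r, hr, hre, a, b, ha, hb, ha0, hb0, hab⟩ :=
    exists_eq_coord_mul_add (e.open_target.mem_nhds nf.zero_mem) nf.numer_smooth h0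
  obtain ⟨e', nf', he', -⟩ := nf.restrict Metric.isOpen_ball (Metric.mem_ball_self hr) hre
  have hs : ContDiff ℝ ∞ fun w : ℝ × ℝ => Real.sin w.2 := Real.contDiff_sin.comp contDiff_snd
  have hc : ContDiff ℝ ∞ fun w : ℝ × ℝ => Real.cos w.2 := Real.contDiff_cos.comp contDiff_snd
  have hmem : ∀ w ∈ blowUpDomain e', w.1 ≠ 0 →
      (e'.symm (polar w) ∈ regularSet f ∩ e'.source ↔ Real.sin w.2 ≠ 0) := by
    intro w hw hw1
    have h1 := nf'.isSingularPt_symm_iff hw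
    have h2 : polar w 1 = w.1 * Real.sin w.2 := rfl
    rw [h2, mul_eq_zero, or_iff_right hw1] at h1
    constructor
    · rintro ⟨h3, -⟩ h4
      exact h3 (h1.2 h4)
    · intro h3
      exact ⟨fun h4 => h3 (h1.1 h4), e'.map_target hw⟩
  -- Numerator and denominator of (a cos θ + b sin θ)/sin θ are multiplied by sin θ, because sin θ
  -- changes sign under (r, θ) ∼ (−r, θ + π) and so is not a function on the blow-up.
  refine ⟨e', fun w => Real.sin w.2 ^ 2,
    fun w => Real.sin w.2 * (Real.cos w.2 * a (polar w) + Real.sin w.2 * b (polar w)),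
    ⟨nf'.adapted.centered, nf'.isOpen_regular, inter_subset_right, nf'.dense_regular,
      nf'.smooth_gaussCurv, ⟨(hs.pow 2).contDiffOn, ?_⟩, ⟨?_, ?_⟩, ?_, ?_, ?_⟩, ?_⟩
  · intro w _
    simp [Real.sin_add_pi]
  · exact (hs.mul ((hc.mul (ha.comp contDiff_polar)).add
      (hs.mul (hb.comp contDiff_polar)))).contDiffOn
  · intro w _
    simp only [polar_neg, Real.sin_add_pi, Real.cos_add_pi, Prod.mk.eta]
    ring
  · intro w hw hw1
    rw [hmem w hw hw1, pow_ne_zero_iff two_ne_zero]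
  · refine (finite_singleton (0 : ℝ)).subset ?_
    rintro θ ⟨⟨h1, h2⟩, h3⟩
    by_contra hne
    exact (Real.sin_pos_of_pos_of_lt_pi (lt_of_le_of_ne h1 (Ne.symm hne)) h2).ne'
      (pow_eq_zero_iff two_ne_zero |>.1 h3)
  · intro w hw hwO
    have hreg : polar w 1 ≠ 0 := fun h1 => hwO.1 ((nf'.isSingularPt_symm_iff hw).2 h1)
    have h1 : w.1 ≠ 0 := fun h1 => hreg (by simp [polar, h1])
    have h2 := nf'.gaussCurv_mul _ hw hreg
    have h3 := hab (polar w) (he' ▸ hw)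
    have h4 : polar w 0 = w.1 * Real.cos w.2 := rfl
    have h5 : polar w 1 = w.1 * Real.sin w.2 := rfl
    rw [← h2, h4, h5] at h3
    refine mul_left_cancel₀ h1 ?_
    linear_combination -Real.sin w.2 * h3
  · intro θ
    simp only [polar_zero, ha0, hb0]
    exact ⟨trivial, trivial⟩

lemma exists_ne_zero_of_finite {k : ℝ → ℝ} (hk : {θ : ℝ | θ ∈ Ico 0 Real.pi ∧ k θ = 0}.Finite)
    (F : Set ℝ) (hF : F.Finite) : ∃ θ ∈ Ico 0 Real.pi, k θ ≠ 0 ∧ θ ∉ F := by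
  obtain ⟨θ, hθ, hn⟩ := ((Ico_infinite Real.pi_pos).sdiff (hk.union hF)).nonempty
  exact ⟨θ, hθ, fun h0 => hn (Or.inl ⟨hθ, h0⟩), fun h1 => hn (Or.inr h1)⟩

/-- A rational witness satisfies the relation imposed by the normal form. -/
lemma rationalWitness_relation (nf : IsNormalForm g f ν p e h m)
    {e₁ : OpenPartialHomeomorph S (EuclideanSpace ℝ (Fin 2))} {lam psi : ℝ × ℝ → ℝ}
    (hw : IsRationalWitness (regularSet f ∩ e₁.source) (gaussCurv g f) p e₁ lam psi) :
    h 0 = 0 ∧ ∀ θ, psi (0, θ) * fderiv ℝ (fun z => e (e₁.symm z)) 0 !₂[Real.cos θ, Real.sin θ] 1 =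
      lam (0, θ) * fderiv ℝ h 0
        (fderiv ℝ (fun z => e (e₁.symm z)) 0 !₂[Real.cos θ, Real.sin θ]) := by
  obtain ⟨hea, hpe, hp0⟩ := hw.centered
  have h0t : (0 : Plane) ∈ e₁.target := hp0 ▸ e₁.map_source hpe
  have hs0 : e₁.symm 0 = p := by rw [← hp0, e₁.left_inv hpe]
  -- The witness may use any centred chart; σ is the transition to the normal form coordinates.
  set σ : Plane → Plane := fun z => e (e₁.symm z) with hσ
  have hσ0 : σ 0 = 0 := by rw [hσ]; simp only; rw [hs0, nf.adapted.centered.2.2]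
  have hσs : ContDiffAt ℝ ∞ σ 0 :=
    smooth_transition hea nf.mem_atlas h0t (by rw [hs0]; exact nf.mem_source)
  have hσd := (ContDiffAt.smooth_differentiableAt hσs).hasFDerivAt
  have hdir : ∀ θ : ℝ, HasDerivAt (fun r : ℝ => σ (polar (r, θ)))
      (fderiv ℝ σ 0 !₂[Real.cos θ, Real.sin θ]) 0 := by
    intro θ
    have h1 : HasDerivAt (fun r : ℝ => polar (r, θ)) (!₂[Real.cos θ, Real.sin θ] : Plane) 0 := by
      simp only [polar_eq_smul]
      simpa using (hasDerivAt_id (0 : ℝ)).smul_const (!₂[Real.cos θ, Real.sin θ] : Plane)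
    have h2 : HasFDerivAt σ (fderiv ℝ σ 0) (polar (0, θ)) := by rwa [polar_zero]
    exact h2.comp_hasDerivAt (0 : ℝ) h1
  have hV : ∀ θ : ℝ, HasDerivAt (fun r : ℝ => σ (polar (r, θ)) 1)
      (fderiv ℝ σ 0 !₂[Real.cos θ, Real.sin θ] 1) 0 := fun θ =>
    (EuclideanSpace.proj (1 : Fin 2) : Plane →L[ℝ] ℝ).hasFDerivAt.comp_hasDerivAt (0 : ℝ) (hdir θ)
  have hH : ∀ θ : ℝ, HasDerivAt (fun r : ℝ => h (σ (polar (r, θ))))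
      (fderiv ℝ h 0 (fderiv ℝ σ 0 !₂[Real.cos θ, Real.sin θ])) 0 := by
    intro θ
    have h2 : HasFDerivAt h (fderiv ℝ h 0) (σ (polar (0, θ))) := by
      rw [polar_zero, hσ0]
      exact (ContDiffAt.smooth_differentiableAt (nf.numer_smooth 0 nf.zero_mem)).hasFDerivAt
    exact h2.comp_hasDerivAt (0 : ℝ) (hdir θ)
  have hbd : IsOpen (blowUpDomain e₁) := e₁.open_target.preimage contDiff_polar.continuous
  have h0b : ∀ θ : ℝ, ((0 : ℝ), θ) ∈ blowUpDomain e₁ := fun θ => by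
    rw [blowUpDomain, mem_ofPred_eq, polar_zero]; exact h0t
  have hblow : ∀ {k : ℝ × ℝ → ℝ}, IsBlowUpFun e₁ k → ∀ θ : ℝ,
      DifferentiableAt ℝ (fun r : ℝ => k (r, θ)) 0 := by
    intro k hk θ
    have h1 : DifferentiableAt ℝ k (0, θ) := ContDiffAt.smooth_differentiableAt
      (hk.1.contDiffAt (hbd.mem_nhds (h0b θ)))
    exact h1.comp (0 : ℝ) (f := fun r : ℝ => (r, θ)) (by fun_prop)
  have hrel : ∀ θ : ℝ, ∀ᶠ r : ℝ in 𝓝[≠] 0,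
      psi (r, θ) * σ (polar (r, θ)) 1 = lam (r, θ) * h (σ (polar (r, θ))) := by
    intro θ
    have hc : Tendsto (fun r : ℝ => polar (r, θ)) (𝓝[≠] 0) (𝓝 0) := by
      have h1 : Continuous fun r : ℝ => polar (r, θ) :=
        contDiff_polar.continuous.comp (by fun_prop)
      have h2 := h1.tendsto 0
      rw [polar_zero] at h2
      exact h2.mono_left nhdsWithin_le_nhds
    have hsrc : ∀ᶠ z in 𝓝 (0 : Plane), e₁.symm z ∈ e.source :=
      (e₁.continuousAt_symm h0t).preimage_mem_nhds
        (e.open_source.mem_nhds (by rw [hs0]; exact nf.mem_source))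
    filter_upwards [hc.eventually (e₁.open_target.mem_nhds h0t), hc.eventually hsrc,
      self_mem_nhdsWithin] with r h1 h2 h3
    have h4 : ((r, θ) : ℝ × ℝ) ∈ blowUpDomain e₁ := h1
    by_cases hreg : e₁.symm (polar (r, θ)) ∈ regularSet f
    · have h5 := hw.psi_eq _ h4 ⟨hreg, e₁.map_target h1⟩
      have h6 := nf.gaussCurv_eq_div ⟨hreg, h2⟩
      have h7 : σ (polar (r, θ)) 1 ≠ 0 := fun h7 => hreg ((nf.adapted.axis _ h2).2 h7)
      rw [h5, h6, mul_assoc]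
      change lam (r, θ) * (h (σ (polar (r, θ))) / σ (polar (r, θ)) 1 * σ (polar (r, θ)) 1) = _
      rw [div_mul_cancel₀ _ h7]
    -- At a singular point off the exceptional circle both Λ and v vanish, so the relation survives
    -- where K is meaningless.
    · have h5 : lam (r, θ) = 0 := by
        by_contra h5
        exact hreg ((hw.lam_ne_zero _ h4 h3).2 h5).1
      have h7 : σ (polar (r, θ)) 1 = 0 := (nf.adapted.axis _ h2).1 (not_not.1 hreg)
      rw [h5, h7, zero_mul, mul_zero]
  -- Let r → 0 along a ray on which Λ does not vanish: v tends to 0, which leaves Λ(0, θ) h(0) = 0.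
  have hh0 : h 0 = 0 := by
    obtain ⟨θ, -, hθ, -⟩ := exists_ne_zero_of_finite hw.finite_zeros ∅ finite_empty
    have hl := ((hblow hw.psi_smooth θ).continuousAt.mul (hV θ).continuousAt).tendsto.mono_left
      (nhdsWithin_le_nhds (s := {0}ᶜ))
    have hr := ((hblow hw.lam_smooth θ).continuousAt.mul (hH θ).continuousAt).tendsto.mono_left
      (nhdsWithin_le_nhds (s := {0}ᶜ))
    have h1 := tendsto_nhds_unique (hl.congr' (hrel θ)) hr
    simp only [Pi.mul_apply, polar_zero, hσ0, PiLp.zero_apply, mul_zero] at h1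
    exact (mul_eq_zero.1 h1.symm).resolve_left hθ
  refine ⟨hh0, fun θ => ?_⟩
  have hrel' : (fun r : ℝ => psi (r, θ) * σ (polar (r, θ)) 1) =ᶠ[𝓝 0]
      fun r => lam (r, θ) * h (σ (polar (r, θ))) := by
    refine eventually_nhdsWithin_iff.1 (hrel θ) |>.mono fun r hr => ?_
    by_cases h1 : r = 0
    · subst h1
      simp [polar_zero, hσ0, hh0]
    · exact hr h1
  -- Compare derivatives in r at 0. Since v and h vanish there, only their own derivatives survive
  -- in the product rule.
  have h1 := ((hblow hw.psi_smooth θ).hasDerivAt.fun_mul (hV θ)).deriv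
  have h2 := ((hblow hw.lam_smooth θ).hasDerivAt.fun_mul (hH θ)).deriv
  rw [hrel'.deriv_eq, h2] at h1
  simpa [polar_zero, hσ0, hh0] using h1.symm

theorem rationallyBoundedAt_iff (nf : IsNormalForm g f ν p e h m) :
    RationallyBoundedAt (regularSet f) (gaussCurv g f) p ↔ limNormalCurv g f ν p = 0 := by
  rw [nf.limNormalCurv_center_eq_zero_iff]
  constructor
  · rintro ⟨e₁, lam, psi, hw⟩
    exact (nf.rationalWitness_relation hw).1
  · intro h0
    obtain ⟨e', lam, psi, hw, -⟩ := nf.exists_isRationalWitness h0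
    exact ⟨e', lam, psi, hw⟩

/-- Distinct angles in [0, π) give linearly independent directions, the determinant being sin(θ' −
θ). -/
lemma eq_zero_of_apply_directions {L : Plane →L[ℝ] ℝ} {θ θ' : ℝ} (hθ : θ ∈ Ico 0 Real.pi)
    (hθ' : θ' ∈ Ico 0 Real.pi) (hne : θ ≠ θ') (h1 : L !₂[Real.cos θ, Real.sin θ] = 0)
    (h2 : L !₂[Real.cos θ', Real.sin θ'] = 0) : L = 0 := by
  have hs : Real.sin (θ' - θ) ≠ 0 := by
    intro h0
    obtain ⟨k, hk⟩ := Real.sin_eq_zero_iff.1 h0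
    have hb1 : (k : ℝ) * Real.pi < 1 * Real.pi := by rw [hk]; linarith [hθ'.2, hθ.1]
    have hb2 : (-1 : ℝ) * Real.pi < k * Real.pi := by rw [hk]; linarith [hθ.2, hθ'.1]
    have hk1 : k < 1 := by exact_mod_cast lt_of_mul_lt_mul_right hb1 Real.pi_pos.le
    have hk2 : -1 < k := by exact_mod_cast lt_of_mul_lt_mul_right hb2 Real.pi_pos.le
    have hk0 : k = 0 := by omega
    rw [hk0, Int.cast_zero, zero_mul] at hk
    exact hne (by linarith)
  rw [plane_eq !₂[Real.cos θ, Real.sin θ], map_add, map_smul, map_smul] at h1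
  rw [plane_eq !₂[Real.cos θ', Real.sin θ'], map_add, map_smul, map_smul] at h2
  simp only [Matrix.cons_val_zero, Matrix.cons_val_one, smul_eq_mul] at h1 h2
  rw [Real.sin_sub] at hs
  have e0 : L (basisVec 0) = 0 := by
    refine (mul_eq_zero.1 ?_).resolve_left hs
    linear_combination Real.sin θ' * h1 - Real.sin θ * h2
  have e1 : L (basisVec 1) = 0 := by
    refine (mul_eq_zero.1 ?_).resolve_left hs
    linear_combination Real.cos θ * h2 - Real.cos θ' * h1
  ext1 Y
  rw [plane_eq Y, map_add, map_smul, map_smul, e0, e1]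
  simp

/-- With ψ = cΛ the relation on the exceptional circle says that dh − c dv vanishes on dσ of all but
finitely many directions; two of them suffice, so dh = c dv and h_u(0) = 0. Conversely the explicit
witness works with c = h_v(0). -/
lemma rationallyContinuousAt_iff_fderiv (nf : IsNormalForm g f ν p e h m) :
    RationallyContinuousAt (regularSet f) (gaussCurv g f) p ↔
      h 0 = 0 ∧ fderiv ℝ h 0 (basisVec 0) = 0 := by
  constructor
  · rintro ⟨e₁, lam, psi, hw, c, hc⟩
    obtain ⟨h0, hrel⟩ := nf.rationalWitness_relation hw
    refine ⟨h0, ?_⟩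
    obtain ⟨hea, hpe, hp0⟩ := hw.centered
    have h0t : (0 : Plane) ∈ e₁.target := hp0 ▸ e₁.map_source hpe
    have hs0 : e₁.symm 0 = p := by rw [← hp0, e₁.left_inv hpe]
    set D := fderiv ℝ (fun z => e (e₁.symm z)) 0 with hD
    set L : Plane →L[ℝ] ℝ := fderiv ℝ h 0 - c • (EuclideanSpace.proj (1 : Fin 2) : Plane →L[ℝ] ℝ)
      with hL
    have hLz : ∀ θ, lam (0, θ) ≠ 0 → (L.comp D) !₂[Real.cos θ, Real.sin θ] = 0 := by
      intro θ hθ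
      refine (mul_eq_zero.1 ?_).resolve_left hθ
      have h1 := hrel θ
      rw [hc θ] at h1
      change lam (0, θ) * (fderiv ℝ h 0 (D !₂[Real.cos θ, Real.sin θ]) -
        c * D !₂[Real.cos θ, Real.sin θ] 1) = 0
      linear_combination -h1
    obtain ⟨θ, hθ, hθ0, -⟩ := exists_ne_zero_of_finite hw.finite_zeros ∅ finite_empty
    obtain ⟨θ', hθ', hθ0', hne⟩ := exists_ne_zero_of_finite hw.finite_zeros {θ} (finite_singleton θ)
    have hLD := eq_zero_of_apply_directions hθ hθ' (fun h1 => hne h1.symm) (hLz θ hθ0)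
      (hLz θ' hθ0')
    have hsurj : D (fderiv ℝ (fun z => e₁ (e.symm z)) 0 (basisVec 0)) = basisVec 0 := by
      have := transition_fderiv_comp nf.mem_atlas hea nf.zero_mem (by rwa [nf.symm_zero])
        (basisVec 0)
      rwa [nf.symm_zero, hp0] at this
    have h2 := DFunLike.congr_fun hLD (fderiv ℝ (fun z => e₁ (e.symm z)) 0 (basisVec 0))
    rw [ContinuousLinearMap.comp_apply, hsurj, hL] at h2
    simpa using h2
  · rintro ⟨h0, hu⟩
    obtain ⟨e', lam, psi, hw, hv⟩ := nf.exists_isRationalWitness h0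
    refine ⟨e', lam, psi, hw, fderiv ℝ h 0 (basisVec 1), fun θ => ?_⟩
    rw [(hv θ).1, (hv θ).2, hu]
    ring

end IsNormalForm

end Conclusion

/-! ### The covector ω_ν, and boundedness of h/v. -/

section Boundedness
set_option linter.unusedSectionVars false

variable {S : Type*} [TopologicalSpace S] [ChartedSpace (EuclideanSpace ℝ (Fin 2)) S]
  [IsManifold (𝓡 2) ∞ S]
  {M : Type*} [TopologicalSpace M] [ChartedSpace (EuclideanSpace ℝ (Fin 3)) M]
  [IsManifold (𝓡 3) ∞ M]
  {g : RiemMetric M} {f : S → M}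
  {ν : ∀ q : S, TangentSpace (𝓡 3) (f q)} {p : S}
  {e : OpenPartialHomeomorph S (EuclideanSpace ℝ (Fin 2))} {h m : Plane → ℝ}

namespace IsNormalForm

/-- On the axis κ_ν = h/m, whose derivative at a zero of h is h_u(0)/m(0). Another adapted chart
only inserts the factor ξ, nonzero because the transition map preserves the axis. -/
lemma omegaNu_eq_zero_iff (nf : IsNormalForm g f ν p e h m) (h0 : h 0 = 0)
    {e₁ : OpenPartialHomeomorph S (EuclideanSpace ℝ (Fin 2))} (ha : IsAdapted g f p e₁) :
    omegaNu g f ν e₁ p = 0 ↔ fderiv ℝ h 0 (basisVec 0) = 0 := by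
  obtain ⟨hea, hpe, hp0⟩ := ha.centered
  have h0t : (0 : Plane) ∈ e₁.target := hp0 ▸ e₁.map_source hpe
  have hs0 : e₁.symm 0 = p := by rw [← hp0, e₁.left_inv hpe]
  set σ : Plane → Plane := fun z => e (e₁.symm z) with hσ
  have hσ0 : σ 0 = 0 := by rw [hσ]; simp only; rw [hs0, nf.adapted.centered.2.2]
  have hσd := ContDiffAt.smooth_differentiableAt
    (smooth_transition hea nf.mem_atlas h0t (by rw [hs0]; exact nf.mem_source))
  have hu : ∀ u : ℝ, (!₂[u, 0] : Plane) = u • basisVec 0 := by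
    intro u
    ext i
    fin_cases i <;> simp
  have hu0 : (!₂[(0 : ℝ), 0] : Plane) = 0 := by rw [hu, zero_smul]
  have hud : HasDerivAt (fun u : ℝ => (!₂[u, 0] : Plane)) (basisVec 0) 0 := by
    simp only [hu]
    simpa using (hasDerivAt_id (0 : ℝ)).smul_const (basisVec 0 : Plane)
  have hσu : HasDerivAt (fun u : ℝ => σ !₂[u, 0]) (fderiv ℝ σ 0 (basisVec 0)) 0 := by
    have h1 : HasFDerivAt σ (fderiv ℝ σ 0) (!₂[(0 : ℝ), 0] : Plane) := by
      rw [hu0]; exact hσd.hasFDerivAt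
    exact h1.comp_hasDerivAt (0 : ℝ) hud
  have hev : ∀ᶠ u : ℝ in 𝓝 0, (!₂[u, 0] : Plane) ∈ e₁.target ∧ e₁.symm !₂[u, 0] ∈ e.source := by
    have hc : Tendsto (fun u : ℝ => (!₂[u, 0] : Plane)) (𝓝 0) (𝓝 0) := by
      have := hud.continuousAt.tendsto
      rwa [hu0] at this
    have hsrc : ∀ᶠ z in 𝓝 (0 : Plane), e₁.symm z ∈ e.source :=
      (e₁.continuousAt_symm h0t).preimage_mem_nhds
        (e.open_source.mem_nhds (by rw [hs0]; exact nf.mem_source))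
    exact hc.eventually ((e₁.open_target.eventually_mem h0t).and hsrc)
  have hsing : ∀ᶠ u : ℝ in 𝓝 0, σ !₂[u, 0] ∈ e.target ∧ σ !₂[u, 0] 1 = 0 ∧
      e.symm (σ !₂[u, 0]) = e₁.symm !₂[u, 0] := by
    filter_upwards [hev] with u hu
    have h1 : IsSingularPt f (e₁.symm !₂[u, 0]) := by
      rw [ha.axis _ (e₁.map_target hu.1), e₁.right_inv hu.1]
      rfl
    exact ⟨e.map_source hu.2, (nf.adapted.axis _ hu.2).1 h1, e.left_inv hu.2⟩
  have hκ : (fun u : ℝ => limNormalCurv g f ν (e₁.symm !₂[u, 0])) =ᶠ[𝓝 0]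
      fun u => h (σ !₂[u, 0]) / m (σ !₂[u, 0]) := by
    filter_upwards [hsing] with u hu
    rw [eq_div_iff (nf.factor_ne_zero _ hu.1), ← nf.limNormalCurv_mul _ hu.1 hu.2.1, hu.2.2]
  have hv : fderiv ℝ σ 0 (basisVec 0) 1 = 0 := by
    have h1 : HasDerivAt (fun u : ℝ => σ !₂[u, 0] 1) (fderiv ℝ σ 0 (basisVec 0) 1) 0 :=
      (EuclideanSpace.proj (1 : Fin 2) : Plane →L[ℝ] ℝ).hasFDerivAt.comp_hasDerivAt (0 : ℝ) hσu
    have h2 : (fun u : ℝ => σ !₂[u, 0] 1) =ᶠ[𝓝 0] fun _ => 0 := by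
      filter_upwards [hsing] with u hu using hu.2.1
    rw [← h1.deriv, h2.deriv_eq, deriv_const]
  set ξ := fderiv ℝ σ 0 (basisVec 0) 0 with hξ
  have hD : fderiv ℝ σ 0 (basisVec 0) = ξ • basisVec 0 := by
    rw [plane_eq (fderiv ℝ σ 0 (basisVec 0)), hv, zero_smul, add_zero]
  have hξ0 : ξ ≠ 0 := by
    intro h1
    rw [h1, zero_smul] at hD
    have h2 := transition_fderiv_comp hea nf.mem_atlas h0t (by rw [hs0]; exact nf.mem_source)
      (basisVec 0)
    rw [show fderiv ℝ (fun w => e (e₁.symm w)) 0 (basisVec 0) = 0 from hD, map_zero] at h2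
    simpa using congrArg (fun v : Plane => v 0) h2
  have hHd : HasDerivAt (fun u : ℝ => h (σ !₂[u, 0])) (ξ * fderiv ℝ h 0 (basisVec 0)) 0 := by
    have h1 : HasFDerivAt h (fderiv ℝ h 0) (σ !₂[(0 : ℝ), 0]) := by
      rw [hu0, hσ0]
      exact (ContDiffAt.smooth_differentiableAt (nf.numer_smooth 0 nf.zero_mem)).hasFDerivAt
    have h2 := h1.comp_hasDerivAt (0 : ℝ) hσu
    rw [hD, map_smul] at h2
    exact h2
  have hmd : DifferentiableAt ℝ (fun u : ℝ => m (σ !₂[u, 0])) 0 := by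
    have h1 : HasFDerivAt m (fderiv ℝ m 0) (σ !₂[(0 : ℝ), 0]) := by
      rw [hu0, hσ0]
      exact (ContDiffAt.smooth_differentiableAt (nf.factor_smooth 0 nf.zero_mem)).hasFDerivAt
    exact (h1.comp_hasDerivAt (0 : ℝ) hσu).differentiableAt
  have hm0 : m 0 ≠ 0 := nf.factor_ne_zero 0 nf.zero_mem
  have hderiv : deriv (fun u : ℝ => limNormalCurv g f ν (e₁.symm !₂[u, 0])) 0 =
      ξ * fderiv ℝ h 0 (basisVec 0) / m 0 := by
    rw [hκ.deriv_eq, (hHd.fun_div hmd.hasDerivAt (by rwa [hu0, hσ0])).deriv]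
    simp only [hu0, hσ0, h0, zero_mul, sub_zero]
    field_simp
  rw [omegaNu, hderiv]
  have hproj : (EuclideanSpace.proj (0 : Fin 2) : EuclideanSpace ℝ (Fin 2) →L[ℝ] ℝ).comp
      (mfderiv (𝓡 2) (𝓡 2) e₁ p) ≠ 0 := by
    intro h1
    obtain ⟨V, hV⟩ := (chart_mdifferentiable hea).mfderiv_surjective hpe (basisVec 0 : Plane)
    have h2 : (basisVec 0 : Plane) 0 = 0 :=
      (congrArg (fun v : Plane => v 0) hV).symm.trans (DFunLike.congr_fun h1 V)
    simp at h2
  constructor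
  · intro h1
    have h2 := (smul_eq_zero.1 h1).resolve_right hproj
    rw [div_eq_zero_iff, or_iff_left hm0] at h2
    exact (mul_eq_zero.1 h2).resolve_left hξ0
  · intro h1
    rw [h1, mul_zero, zero_div]
    exact zero_smul ℝ _

theorem rationallyContinuousAt_iff (nf : IsNormalForm g f ν p e h m)
    {e₁ : OpenPartialHomeomorph S (EuclideanSpace ℝ (Fin 2))} (ha : IsAdapted g f p e₁) :
    RationallyContinuousAt (regularSet f) (gaussCurv g f) p ↔
      limNormalCurv g f ν p = 0 ∧ omegaNu g f ν e₁ p = 0 := by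
  rw [nf.rationallyContinuousAt_iff_fderiv, nf.limNormalCurv_center_eq_zero_iff]
  exact and_congr_right fun h0 => (nf.omegaNu_eq_zero_iff h0 ha).symm

/-- Approach the axis vertically: |h| = |K||v| ≤ C|v| tends to 0, and h is continuous. -/
lemma numer_eq_zero_of_bounded (nf : IsNormalForm g f ν p e h m) {C : ℝ}
    (hC : ∀ q ∈ e.source ∩ regularSet f, |gaussCurv g f q| ≤ C) {z : Plane} (hz : z ∈ e.target)
    (hz1 : z 1 = 0) : h z = 0 := by
  have ht := IsNormalForm.tendsto_add_smul z
  have h1 : Tendsto (fun s : ℝ => h (z + s • (basisVec 1 : Plane))) (𝓝[≠] 0) (𝓝 (h z)) :=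
    (nf.numer_smooth z hz).continuousAt.tendsto.comp ht
  have h2 : Tendsto (fun s : ℝ => C * |s|) (𝓝[≠] 0) (𝓝 0) := by
    have hc : Continuous fun s : ℝ => C * |s| := by fun_prop
    have := hc.tendsto 0
    rw [abs_zero, mul_zero] at this
    exact this.mono_left nhdsWithin_le_nhds
  refine tendsto_nhds_unique h1 (squeeze_zero_norm' ?_ h2)
  filter_upwards [eventually_add_smul_one_ne_zero hz1, ht.eventually (e.open_target.mem_nhds hz)]
    with s hs hst
  have hs1 : (z + s • (basisVec 1 : Plane)) 1 = s := by simp [hz1]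
  rw [← nf.gaussCurv_mul _ hst hs, hs1, Real.norm_eq_abs, abs_mul]
  refine mul_le_mul_of_nonneg_right (hC _ ⟨e.map_target hst, fun h3 => ?_⟩) (abs_nonneg s)
  exact hs ((nf.isSingularPt_symm_iff hst).1 h3)

/-- A ball about 0 is convex and contains the projection of each of its points to the u-axis. If h
vanishes at that projection, the mean value inequality gives |h| ≤ C|v|, so the bound on dh bounds
K. -/
lemma bounded_iff (nf : IsNormalForm g f ν p e h m) {r : ℝ} (he : e.target = Metric.ball 0 r)
    {C : ℝ} (hC : ∀ z ∈ e.target, ‖fderiv ℝ h z‖ ≤ C) :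
    (∃ C : ℝ, ∀ q ∈ e.source ∩ regularSet f, |gaussCurv g f q| ≤ C) ↔
      ∀ q ∈ e.source, IsSingularPt f q → limNormalCurv g f ν q = 0 := by
  constructor
  · rintro ⟨C, hC⟩ q hq hs
    have h1 := (nf.adapted.axis q hq).1 hs
    rw [← e.left_inv hq, nf.limNormalCurv_eq_zero_iff (e.map_source hq) h1]
    exact nf.numer_eq_zero_of_bounded hC (e.map_source hq) h1
  · intro hκ
    refine ⟨C, fun q hq => ?_⟩
    have hz := e.map_source hq.1
    have hz1 : e q 1 ≠ 0 := fun h1 => hq.2 ((nf.adapted.axis q hq.1).2 h1)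
    set z₀ : Plane := e q 0 • basisVec 0 with hz₀
    have hz₀1 : z₀ 1 = 0 := by simp [hz₀]
    have hz₀t : z₀ ∈ e.target := by
      rw [he, mem_ball_zero_iff] at hz ⊢
      refine lt_of_le_of_lt ?_ hz
      have h1 : ‖z₀‖ = ‖e q 0‖ := by rw [hz₀, norm_smul]; simp
      rw [h1]
      exact PiLp.norm_apply_le (e q) 0
    have hz₀h : h z₀ = 0 := by
      rw [← nf.limNormalCurv_eq_zero_iff hz₀t hz₀1]
      exact hκ _ (e.map_target hz₀t) ((nf.isSingularPt_symm_iff hz₀t).2 hz₀1)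
    have hconv : Convex ℝ e.target := he ▸ convex_ball 0 r
    have h2 := hconv.norm_image_sub_le_of_norm_fderiv_le
      (fun z hz => ContDiffAt.smooth_differentiableAt (nf.numer_smooth z hz)) hC hz₀t hz
    have h3 : e q - z₀ = e q 1 • basisVec 1 := by
      rw [sub_eq_iff_eq_add, add_comm]
      exact plane_eq (e q)
    rw [hz₀h, sub_zero, h3, norm_smul] at h2
    have h4 : ‖(basisVec 1 : Plane)‖ = 1 := by simp
    rw [h4, mul_one, Real.norm_eq_abs, Real.norm_eq_abs] at h2
    rw [nf.gaussCurv_eq_div ⟨hq.2, hq.1⟩, abs_div, div_le_iff₀ (abs_pos.2 hz1)]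
    exact h2

/-- There are arbitrarily small neighborhoods in which the curvature is bounded if and only if the
limiting normal curvature vanishes. -/
theorem exists_nhds_bounded_iff (nf : IsNormalForm g f ν p e h m) {W : Set S} (hW : W ∈ 𝓝 p) :
    ∃ V ⊆ W, IsOpen V ∧ p ∈ V ∧
      ((∃ C : ℝ, ∀ q ∈ V ∩ regularSet f, |gaussCurv g f q| ≤ C) ↔
        ∀ q ∈ V, IsSingularPt f q → limNormalCurv g f ν q = 0) := by
  have hfd : ContinuousAt (fun z => ‖fderiv ℝ h z‖) 0 :=
    (ContDiffAt.smooth_fderiv (nf.numer_smooth 0 nf.zero_mem)).continuousAt.norm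
  -- The ball is chosen inside W and so small that dh is bounded on it.
  have hev : ∀ᶠ z in 𝓝 (0 : Plane), z ∈ e.target ∧ e.symm z ∈ W ∧
      ‖fderiv ℝ h z‖ < ‖fderiv ℝ h 0‖ + 1 := by
    refine (e.open_target.eventually_mem nf.zero_mem).and (Eventually.and ?_ ?_)
    · exact (e.continuousAt_symm nf.zero_mem).preimage_mem_nhds (by rwa [nf.symm_zero])
    · exact hfd.eventually_lt continuousAt_const (lt_add_one _)
  obtain ⟨r, hr, hball⟩ := Metric.eventually_nhds_iff_ball.1 hev
  obtain ⟨e', nf', he', hsymm⟩ := nf.restrict Metric.isOpen_ball (Metric.mem_ball_self hr)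
    (fun z hz => (hball z hz).1)
  refine ⟨e'.source, fun q hq => ?_, e'.open_source, nf'.mem_source,
    nf'.bounded_iff he' (fun z hz => (hball z (he' ▸ hz)).2.2.le)⟩
  have h1 := (hball (e' q) (he' ▸ e'.map_source hq)).2.1
  rwa [← hsymm, e'.left_inv hq] at h1

/-- Both conditions pass to smaller neighbourhoods, so the equivalence on arbitrarily small ones is
enough. -/
theorem bounded_near_iff (nf : IsNormalForm g f ν p e h m) :
    (∃ V ∈ 𝓝 p, ∃ C : ℝ, ∀ q ∈ V ∩ regularSet f, |gaussCurv g f q| ≤ C) ↔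
      ∃ V ∈ 𝓝 p, ∀ q ∈ V, IsSingularPt f q → limNormalCurv g f ν q = 0 := by
  constructor
  · rintro ⟨W, hW, C, hC⟩
    obtain ⟨V, hVW, hV, hp, hiff⟩ := nf.exists_nhds_bounded_iff hW
    exact ⟨V, hV.mem_nhds hp, hiff.1 ⟨C, fun q hq => hC q ⟨hVW hq.1, hq.2⟩⟩⟩
  · rintro ⟨W, hW, hκ⟩
    obtain ⟨V, hVW, hV, hp, hiff⟩ := nf.exists_nhds_bounded_iff hW
    exact ⟨V, hV.mem_nhds hp, hiff.2 fun q hq => hκ q (hVW hq)⟩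

end IsNormalForm

end Boundedness

end FrontCurv

end

theorem theorem3
    {S : Type*} [TopologicalSpace S] [T2Space S] [ChartedSpace (EuclideanSpace ℝ (Fin 2)) S]
    [IsManifold (𝓡 2) ∞ S]
    {M : Type*} [TopologicalSpace M] [T2Space M] [ChartedSpace (EuclideanSpace ℝ (Fin 3)) M]
    [IsManifold (𝓡 3) ∞ M]
    (g : FrontCurv.RiemMetric M) (f : S → M) (hf : FrontCurv.IsFront g f)
    (p : S) (U : Set S) (hU : IsOpen U) (hpU : p ∈ U)
    (ν : ∀ q : S, TangentSpace (𝓡 3) (f q)) (hν : FrontCurv.IsUnitNormalOn g f ν U)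
    (hp : FrontCurv.IsSecondKind g f ν p) :
    (FrontCurv.RationallyBoundedAt (FrontCurv.regularSet f) (FrontCurv.gaussCurv g f) p ↔
      FrontCurv.limNormalCurv g f ν p = 0) ∧
    ((∃ e, FrontCurv.IsAdapted g f p e) ∧ ∀ e, FrontCurv.IsAdapted g f p e →
      (FrontCurv.RationallyContinuousAt (FrontCurv.regularSet f) (FrontCurv.gaussCurv g f) p ↔
        FrontCurv.limNormalCurv g f ν p = 0 ∧ FrontCurv.omegaNu g f ν e p = 0)) ∧
    ((∃ V ∈ 𝓝 p, ∃ C : ℝ, ∀ q ∈ V ∩ FrontCurv.regularSet f, |FrontCurv.gaussCurv g f q| ≤ C) ↔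
      ∃ V ∈ 𝓝 p, ∀ q ∈ V, FrontCurv.IsSingularPt f q → FrontCurv.limNormalCurv g f ν q = 0) ∧
    (∀ W ∈ 𝓝 p, ∃ V ⊆ W, IsOpen V ∧ p ∈ V ∧
      ((∃ C : ℝ, ∀ q ∈ V ∩ FrontCurv.regularSet f, |FrontCurv.gaussCurv g f q| ≤ C) ↔
        ∀ q ∈ V, FrontCurv.IsSingularPt f q → FrontCurv.limNormalCurv g f ν q = 0)) := by
  obtain ⟨e, h, m, nf⟩ := hp.exists_isNormalForm hf hν hU hpU
  exact ⟨nf.rationallyBoundedAt_iff, ⟨⟨e, nf.adapted⟩,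
    fun e₁ ha => nf.rationallyContinuousAt_iff ha⟩, nf.bounded_near_iff,
    fun W hW => nf.exists_nhds_bounded_iff hW⟩
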